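/- Manifolds are smooth, finite-dimensional, without boundary; their components may have different dimensions, and they need not be Hausdorff or second countable. Let $G\rightrightarrows G_0$ be a Lie groupoid with structure maps $l,r:G\to G_0$ (the product $gh$ is defined when $r(g)=l(h)$) and Lie algebroid $A$, where $A_x=\ker(T_{1_x}r)\subset T_{1_x}G$. Let $Q_A=\bigwedge^{\rm top}A\otimes\bigwedge^{\rm top}T^*G_0$. For an arrow $g$ with $y=l(g)$ and $x=r(g)$, the tangent maps of $k\mapsto kg$ (on $r^{-1}(y)$) and of $k\mapsto gk^{-1}$ (on $r^{-1}(x)$) identify $A_y$ with $\ker T_gr$ and $A_x$ with $\ker T_gl$. The resulting exact sequences $0\to A_y\to T_gG\to T_xG_0\to0$ and $0\to A_x\to T_gG\to T_yG_0\to 0$ determine an isomorphism $j_g:(Q_A)_y\to(Q_A)_x$, characterized as follows: $j_g(\alpha_y\otimes\theta_y)=\alpha_x\otimes\theta_x$ if and only if $$(-1)^{\operatorname{rk}A_y\,\operatorname{rk}A_x}\;\theta_y(l_*w)\;\alpha_y\wedge w'=\theta_x(r_*w')\;\alpha_x\wedge w$$ for all $w\in\bigwedge^{\dim_yG_0}T_gG$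 and $w'\in\bigwedge^{\dim_xG_0}T_gG$, where $\alpha_y$ and $\alpha_x$ are regarded as elements of $\bigwedge T_gG$ through the identifications above. A section $\lambda$ of $Q_A$ (not necessarily continuous) is called $G$-invariant if $j_g\lambda(l(g))=\lambda(r(g))$ for every $g\in G$. Let $G_0'\subseteq G_0$ be an open subset that is full, i.e. meets every $G$-orbit, and let $G'\rightrightarrows G_0'$ be the restriction of $G$ to $G'_0$ (all arrows with both ends in $G'_0$), with Lie algebroid $A'=A|_{G_0'}$. Then restriction of sections to $G_0'$ defines an isomorphism of real vector spaces from the smooth $G$-invariant sections of $Q_A$ to the smooth $G'$-invariant sections of $Q_{A'}$. Moreover, a $G$-invariant section of $Q_A$ is smooth if and only if its restriction to $G_0'$ is smooth. -/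

import Mathlib

noncomputable section

namespace DiffStack

open TopologicalSpace
open scoped ContDiff TensorProduct Topology

/-! ### Manifolds whose components may have different dimensions

Mathlib's manifolds are modelled on one fixed model space.  Here the dimension is allowed to vary
from component to component, so the atlas is spelled out: every point `x` has a preferred chart
with values in `ℝ ^ dim x`, and all transition maps are smooth.  (Hausdorffness and second
countability are not required, so that the arrow space of a groupoid may be non-Hausdorff.) -/

/-- Euclidean space of dimension `n`. -/
abbrev Euc (n : ℕ) : Type := EuclideanSpace ℝ (Fin n)

/-- A smooth manifold without boundary, all components finite-dimensional, but possibly of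
different dimensions. -/
class SmoothMfd (X : Type*) [TopologicalSpace X] where
  /-- the dimension at a point -/
  dim : X → ℕ
  /-- the preferred chart around a point -/
  chart : (x : X) → OpenPartialHomeomorph X (Euc (dim x))
  mem_source : ∀ x, x ∈ (chart x).source
  smooth_transition : ∀ x y,
    ContDiffOn ℝ ∞ (chart y ∘ (chart x).symm) ((chart x).symm.trans (chart y)).source

open SmoothMfd

section SmoothMaps

variable {X Y : Type*} [TopologicalSpace X] [TopologicalSpace Y] [SmoothMfd X] [SmoothMfd Y]

/-- The tangent space at `x`, identified with `ℝ ^ dim x` by the preferred chart at `x`. -/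
abbrev Tan (x : X) : Type := Euc (dim x)

/-- The map `f` read in the preferred charts at `x` and at `y`. -/
def rep (f : X → Y) (x : X) (y : Y) : Euc (dim x) → Euc (dim y) :=
  chart y ∘ f ∘ (chart x).symm

/-- A map between manifolds is smooth if it is continuous and smooth in charts. -/
def Smooth (f : X → Y) : Prop :=
  Continuous f ∧ ∀ x, ContDiffAt ℝ ∞ (rep f x (f x)) (chart x x)

/-- The derivative of `f` at `x`, the target being read in the preferred chart at `y`
(any point whose chart contains `f x`).  If `y = f x` this is the tangent map
`T_x X → T_{f x} Y`; for `f = id` it is the derivative at `x` of the chart at `y`. -/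
def tmap (f : X → Y) (x : X) (y : Y) : Tan x →L[ℝ] Tan y :=
  fderiv ℝ (rep f x y) (chart x x)

/-- A submersion: a smooth map all of whose tangent maps are onto. -/
def IsSubmersion (f : X → Y) : Prop :=
  Smooth f ∧ ∀ x, Function.Surjective (tmap f x (f x))

end SmoothMaps

/-! ### Open submanifolds -/

section Opens

variable {X Y : Type*} [TopologicalSpace X] [TopologicalSpace Y] [SmoothMfd X] [SmoothMfd Y]

/-- An open subset of a manifold is a manifold: the charts are restricted. -/
instance (U : Opens X) : SmoothMfd U where
  dim x := dim x.1
  chart x := (chart x.1).subtypeRestr ⟨x⟩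
  mem_source x := by
    rw [OpenPartialHomeomorph.subtypeRestr_source]
    exact mem_source x.1
  smooth_transition x y := by
    have hsub : ∀ v ∈ (((chart x.1).subtypeRestr ⟨x⟩).symm.trans
        ((chart y.1).subtypeRestr (s := U) ⟨y⟩)).source,
        v ∈ ((chart x.1).symm.trans (chart y.1)).source ∧
        (((chart x.1).subtypeRestr (s := U) ⟨x⟩).symm v : X) = (chart x.1).symm v := by
      intro v hv
      rw [OpenPartialHomeomorph.trans_source] at hv ⊢
      have h1 := (chart x.1).subtypeRestr_symm_apply (U := U) ⟨x⟩ hv.1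
      have h2 := hv.2
      rw [Set.mem_preimage, OpenPartialHomeomorph.subtypeRestr_source, Set.mem_preimage] at h2
      refine ⟨⟨(chart x.1).subtypeRestr_target_subset ⟨x⟩ hv.1, ?_⟩, h1⟩
      rw [Set.mem_preimage, ← h1]
      exact h2
    refine ((smooth_transition x.1 y.1).mono fun v hv => (hsub v hv).1).congr ?_
    intro v hv
    simp only [Function.comp_apply, OpenPartialHomeomorph.subtypeRestr_coe, Set.domRestrict_apply]
    rw [(hsub v hv).2]

theorem symm_opens (U : Opens X) (x : U) :
    ∀ᶠ v in 𝓝 (chart x.1 x.1), v ∈ (chart x).target ∧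
      (((chart x).symm v : U) : X) = (chart x.1).symm v := by
  have h : (chart x).target ∈ 𝓝 (chart x.1 x.1) :=
    (chart x).open_target.mem_nhds ((chart x).map_source (mem_source x))
  filter_upwards [h] with v hv
  exact ⟨hv, (chart x.1).subtypeRestr_symm_apply ⟨x⟩ hv⟩

/-- A map between open subsets reads in charts as the ambient map it is induced by. -/
theorem rep_opens {U : Opens X} {V : Opens Y} (f : X → Y) (f' : U → V)
    (hf : ∀ x, (f' x : Y) = f x) (x : U) (y : V) :
    rep f' x y =ᶠ[𝓝 (chart x.1 x.1)] rep f x.1 y.1 := by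
  filter_upwards [symm_opens U x] with v hv
  change chart y.1 (f' ((chart x).symm v) : Y) = chart y.1 (f ((chart x.1).symm v))
  rw [hf, hv.2]

theorem tmap_opens {U : Opens X} {V : Opens Y} (f : X → Y) (f' : U → V)
    (hf : ∀ x, (f' x : Y) = f x) (x : U) (y : V) :
    tmap f' x y = tmap f x.1 y.1 :=
  (rep_opens f f' hf x y).fderiv_eq

/-- In the preferred charts, the tangent map of the inclusion of an open subset is the identity:
the tangent spaces of `U` are those of `X`. -/
theorem tmap_val (U : Opens X) (x : U) :
    tmap (Subtype.val : U → X) x x.1 = ContinuousLinearMap.id ℝ (Tan x.1) := by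
  have h : rep (Subtype.val : U → X) x x.1 =ᶠ[𝓝 (chart x.1 x.1)] id := by
    filter_upwards [symm_opens U x, (chart x.1).open_target.mem_nhds
      ((chart x.1).map_source (mem_source x.1))] with v hv hv'
    change chart x.1 (((chart x).symm v : U) : X) = v
    rw [hv.2, (chart x.1).right_inv hv']
  exact h.fderiv_eq.trans fderiv_id

theorem Smooth.opens {U : Opens X} {V : Opens Y} {f : X → Y} (h : Smooth f) (f' : U → V)
    (hf : ∀ x, (f' x : Y) = f x) : Smooth f' := by
  refine ⟨?_, fun x => ?_⟩
  · rw [continuous_induced_rng]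
    exact (h.1.comp continuous_subtype_val).congr fun x => (hf x).symm
  · have h1 := h.2 x.1
    rw [← hf x] at h1
    exact h1.congr_of_eventuallyEq (rep_opens f f' hf x (f' x))

theorem IsSubmersion.opens {U : Opens X} {V : Opens Y} {f : X → Y} (h : IsSubmersion f)
    (f' : U → V) (hf : ∀ x, (f' x : Y) = f x) : IsSubmersion f' := by
  refine ⟨h.1.opens f' hf, fun x => ?_⟩
  have h1 := h.2 x.1
  rw [← hf x] at h1
  rw [tmap_opens f f' hf]
  exact h1

end Opens

/-! ### Determinant lines -/

section Determinants

open Module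

/-- The top exterior power of a finite-dimensional real vector space. -/
abbrev detLine (V : Type*) [AddCommGroup V] [Module ℝ V] : Submodule ℝ (ExteriorAlgebra ℝ V) :=
  ⋀[ℝ]^(finrank ℝ V) V

/-- The map of top exterior powers induced by an isomorphism. -/
def detMap {V W : Type*} [AddCommGroup V] [Module ℝ V] [AddCommGroup W] [Module ℝ W]
    (e : V ≃ₗ[ℝ] W) : detLine V →ₗ[ℝ] detLine W :=
  (LinearEquiv.ofEq (⋀[ℝ]^(finrank ℝ V) W) (detLine W) (by rw [e.finrank_eq])).toLinearMap ∘ₗ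
    exteriorPower.map (finrank ℝ V) e.toLinearMap

/-- For linear maps `R : A → T`, `p : T → Y` and `w ∈ Λⁿ T`, `w' ∈ Λᵐ T`, the linear map
`α ⊗ θ ↦ ⟨θ, p_* w⟩ • (R_* α ∧ w')` on `Λ^top A ⊗ Λⁿ Y*`, with values in the exterior algebra
of `T`. -/
def wedgeForm {A T Y : Type*} [AddCommGroup A] [Module ℝ A] [AddCommGroup T] [Module ℝ T]
    [AddCommGroup Y] [Module ℝ Y] (R : A →ₗ[ℝ] T) (p : T →ₗ[ℝ] Y) {n m : ℕ}
    (w : ⋀[ℝ]^n T) (w' : ⋀[ℝ]^m T) :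
    (detLine A ⊗[ℝ] ⋀[ℝ]^n (Dual ℝ Y)) →ₗ[ℝ] ExteriorAlgebra ℝ T :=
  TensorProduct.lift <|
    (LinearMap.lsmul ℝ (ExteriorAlgebra ℝ T)).flip.compl₁₂
      (LinearMap.mulRight ℝ (w' : ExteriorAlgebra ℝ T) ∘ₗ
        (ExteriorAlgebra.map R).toLinearMap ∘ₗ (detLine A).subtype)
      ((exteriorPower.pairingDual ℝ Y n).flip (exteriorPower.map n p w))

theorem wedgeForm_tmul {A T Y : Type*} [AddCommGroup A] [Module ℝ A] [AddCommGroup T]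
    [Module ℝ T] [AddCommGroup Y] [Module ℝ Y] (R : A →ₗ[ℝ] T) (p : T →ₗ[ℝ] Y) {n m : ℕ}
    (w : ⋀[ℝ]^n T) (w' : ⋀[ℝ]^m T) (α : detLine A) (θ : ⋀[ℝ]^n (Dual ℝ Y)) :
    wedgeForm R p w w' (α ⊗ₜ θ) =
      exteriorPower.pairingDual ℝ Y n θ (exteriorPower.map n p w) •
        (ExteriorAlgebra.map R (α : ExteriorAlgebra ℝ A) * (w' : ExteriorAlgebra ℝ T)) :=
  rfl

end Determinants

/-! ### Lie groupoids -/

/-- A groupoid with arrows `G` and objects `G₀`; the product `g h` is defined when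
`r g = l h`. -/
structure Grpd (G G₀ : Type*) where
  l : G → G₀
  r : G → G₀
  one : G₀ → G
  inv : G → G
  mul : (g h : G) → r g = l h → G
  l_one : ∀ x, l (one x) = x
  r_one : ∀ x, r (one x) = x
  l_inv : ∀ g, l (inv g) = r g
  r_inv : ∀ g, r (inv g) = l g
  l_mul : ∀ g h hc, l (mul g h hc) = l g
  r_mul : ∀ g h hc, r (mul g h hc) = r h
  assoc : ∀ g h k (h₁ : r g = l h) (h₂ : r h = l k),
    mul (mul g h h₁) k ((r_mul g h h₁).trans h₂) = mul g (mul h k h₂) (h₁.trans (l_mul h k h₂).symm)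
  one_mul : ∀ g, mul (one (l g)) g (r_one _) = g
  mul_one : ∀ g, mul g (one (r g)) (l_one _).symm = g
  inv_mul : ∀ g, mul (inv g) g (r_inv g) = one (r g)
  mul_inv : ∀ g, mul g (inv g) (l_inv g).symm = one (l g)

namespace Grpd

variable {G G₀ : Type*} (𝒢 : Grpd G G₀)

/-- The restriction of a groupoid to a set `U` of objects: all arrows with both ends in `U`. -/
def restrict (U : Set G₀) (V : Set G) (hV : ∀ g, g ∈ V ↔ 𝒢.l g ∈ U ∧ 𝒢.r g ∈ U) :
    Grpd V U where
  l g := ⟨𝒢.l g.1, ((hV g.1).1 g.2).1⟩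
  r g := ⟨𝒢.r g.1, ((hV g.1).1 g.2).2⟩
  one x := ⟨𝒢.one x.1, (hV _).2 (by rw [𝒢.l_one, 𝒢.r_one]; exact ⟨x.2, x.2⟩)⟩
  inv g := ⟨𝒢.inv g.1, (hV _).2 (by rw [𝒢.l_inv, 𝒢.r_inv]; exact ((hV g.1).1 g.2).symm)⟩
  mul g h hc := ⟨𝒢.mul g.1 h.1 (congrArg Subtype.val hc), (hV _).2 (by
    rw [𝒢.l_mul, 𝒢.r_mul]; exact ⟨((hV g.1).1 g.2).1, ((hV h.1).1 h.2).2⟩)⟩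
  l_one x := Subtype.ext (𝒢.l_one x.1)
  r_one x := Subtype.ext (𝒢.r_one x.1)
  l_inv g := Subtype.ext (𝒢.l_inv g.1)
  r_inv g := Subtype.ext (𝒢.r_inv g.1)
  l_mul g h hc := Subtype.ext (𝒢.l_mul g.1 h.1 _)
  r_mul g h hc := Subtype.ext (𝒢.r_mul g.1 h.1 _)
  assoc g h k h₁ h₂ := Subtype.ext (𝒢.assoc g.1 h.1 k.1 _ _)
  one_mul g := Subtype.ext (𝒢.one_mul g.1)
  mul_one g := Subtype.ext (𝒢.mul_one g.1)
  inv_mul g := Subtype.ext (𝒢.inv_mul g.1)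
  mul_inv g := Subtype.ext (𝒢.mul_inv g.1)

variable [TopologicalSpace G] [TopologicalSpace G₀] [SmoothMfd G] [SmoothMfd G₀]

/-- The composable pairs, read in the charts at `g` and `h`. -/
def compSet (g h : G) : Set (Tan g × Tan h) :=
  {v | v.1 ∈ (chart g).target ∧ v.2 ∈ (chart h).target ∧
    𝒢.r ((chart g).symm v.1) = 𝒢.l ((chart h).symm v.2)}

open Classical in
/-- The multiplication, read in the charts at `g`, `h` and (in the target) `p`.  The value `0`
off the composable pairs is irrelevant: only the values on `compSet g h` are used. -/
def mulRep (g h p : G) : Tan g × Tan h → Tan p := fun v =>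
  if hc : 𝒢.r ((chart g).symm v.1) = 𝒢.l ((chart h).symm v.2) then
    chart p (𝒢.mul _ _ hc) else 0

/-- The tangent map of the multiplication at the composable pair `(g, h)`, where `p = g h`.
It is only meaningful, and will only be used, on the vectors tangent to the submanifold of
composable pairs, i.e. on the `(u, v)` with `T r u = T l v`. -/
def tmul (g h p : G) : Tan g × Tan h →L[ℝ] Tan p :=
  fderivWithin ℝ (𝒢.mulRep g h p) (𝒢.compSet g h) (chart g g, chart h h)

end Grpd

/-- A Lie groupoid: the objects and arrows form manifolds, `l` and `r` are submersions, and
the structure maps are smooth (the multiplication as a map on the submanifold of composable pairs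
of `G × G`). -/
structure LieGroupoid (G G₀ : Type*) [TopologicalSpace G] [TopologicalSpace G₀]
    [SmoothMfd G] [SmoothMfd G₀] extends Grpd G G₀ where
  submersion_l : IsSubmersion l
  submersion_r : IsSubmersion r
  smooth_one : Smooth one
  smooth_inv : Smooth inv
  continuous_mul : Continuous fun p : {p : G × G // r p.1 = l p.2} => mul p.1.1 p.1.2 p.2
  smooth_mul : ∀ g h (hc : r g = l h),
    ContDiffWithinAt ℝ ∞ (toGrpd.mulRep g h (mul g h hc)) (toGrpd.compSet g h)
      (chart g g, chart h h)

namespace LieGroupoid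

variable {G G₀ : Type*} [TopologicalSpace G] [TopologicalSpace G₀] [SmoothMfd G] [SmoothMfd G₀]
  (𝒢 : LieGroupoid G G₀)

/-- The open set of all arrows with both ends in `U`. -/
def arrowsOver (U : Opens G₀) : Opens G :=
  ⟨𝒢.l ⁻¹' U ∩ 𝒢.r ⁻¹' U,
    (U.isOpen.preimage 𝒢.submersion_l.1.1).inter (U.isOpen.preimage 𝒢.submersion_r.1.1)⟩

/-- The underlying groupoid of the restriction to an open set of objects. -/
def restrictGrpd (U : Opens G₀) : Grpd (𝒢.arrowsOver U) U :=
  𝒢.toGrpd.restrict (U : Set G₀) (𝒢.arrowsOver U : Set G) fun _ => Iff.rfl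

theorem mulRep_restrict (U : Opens G₀) (g h p : 𝒢.arrowsOver U) :
    ∀ᶠ v : Tan g × Tan h in 𝓝 (chart g g, chart h h),
      (v ∈ (𝒢.restrictGrpd U).compSet g h ↔
        v ∈ (𝒢.compSet g.1 h.1 : Set (Tan g.1 × Tan h.1))) ∧
      (𝒢.restrictGrpd U).mulRep g h p v = 𝒢.mulRep g.1 h.1 p.1 v := by
  have hg := (chart g.1).open_target.mem_nhds ((chart g.1).map_source (mem_source g.1))
  have hh := (chart h.1).open_target.mem_nhds ((chart h.1).map_source (mem_source h.1))
  have hev := ((symm_opens _ g).and hg).prodMk_nhds ((symm_opens _ h).and hh)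
  refine Filter.Eventually.mono hev fun v hv => ?_
  obtain ⟨⟨⟨hg1, hg2⟩, hg3⟩, ⟨hh1, hh2⟩, hh3⟩ := hv
  have hiff : (𝒢.restrictGrpd U).r
        ((chart g).symm v.1) =
      (𝒢.restrictGrpd U).l
        ((chart h).symm v.2) ↔ 𝒢.r ((chart g.1).symm v.1) = 𝒢.l ((chart h.1).symm v.2) := by
    rw [← hg2, ← hh2]
    exact Subtype.ext_iff
  refine ⟨⟨fun hv => ⟨hg3, hh3, hiff.1 hv.2.2⟩, fun hv => ⟨hg1, hh1, hiff.2 hv.2.2⟩⟩, ?_⟩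
  by_cases hc : 𝒢.r ((chart g.1).symm v.1) = 𝒢.l ((chart h.1).symm v.2)
  · rw [Grpd.mulRep, Grpd.mulRep, dif_pos hc, dif_pos (hiff.2 hc)]
    have : ∀ (a b : G) (ha : a = (chart g.1).symm v.1) (hb : b = (chart h.1).symm v.2)
        (hab : 𝒢.r a = 𝒢.l b), chart p.1 (𝒢.mul a b hab) = chart p.1 (𝒢.mul _ _ hc) := by
      rintro a b rfl rfl hab
      rfl
    exact this _ _ hg2 hh2 _
  · rw [Grpd.mulRep, Grpd.mulRep, dif_neg hc, dif_neg (mt hiff.1 hc)]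

/-- The restriction of a Lie groupoid to an open set of objects. -/
def restrict (U : Opens G₀) : LieGroupoid (𝒢.arrowsOver U) U where
  toGrpd := 𝒢.restrictGrpd U
  submersion_l := 𝒢.submersion_l.opens _ fun _ => rfl
  submersion_r := 𝒢.submersion_r.opens _ fun _ => rfl
  smooth_one := 𝒢.smooth_one.opens _ fun _ => rfl
  smooth_inv := 𝒢.smooth_inv.opens _ fun _ => rfl
  continuous_mul := by
    rw [continuous_induced_rng]
    refine 𝒢.continuous_mul.comp (f := fun p : {p : 𝒢.arrowsOver U × 𝒢.arrowsOver U //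
      (⟨𝒢.r p.1.1, p.1.2.2⟩ : U) = ⟨𝒢.l p.2.1, p.2.2.1⟩} =>
      (⟨(p.1.1.1, p.1.2.1), congrArg Subtype.val p.2⟩ : {p : G × G // 𝒢.r p.1 = 𝒢.l p.2})) ?_
    fun_prop
  smooth_mul g h hc := by
    have h0 := 𝒢.smooth_mul g.1 h.1 (congrArg Subtype.val hc)
    have hev := 𝒢.mulRep_restrict U g h ((𝒢.restrictGrpd U).mul g h hc)
    refine (h0.congr_set (hev.mono fun v hv => propext hv.1.symm)).congr_of_eventuallyEq
      (nhdsWithin_le_nhds (hev.mono fun v hv => hv.2)) hev.self_of_nhds.2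

/-! ### The Lie algebroid and the line bundle `Q_A` -/

open Module

/-- The fibre at `x` of the Lie algebroid: the vectors tangent at the unit `1_x` to the
`r`-fibre of `x`. -/
def A (x : G₀) : Submodule ℝ (Tan (𝒢.one x)) :=
  LinearMap.ker (tmap 𝒢.r (𝒢.one x) x).toLinearMap

/-- The fibre at `x` of the line bundle `Q_A = Λ^top A ⊗ Λ^top T*G₀`. -/
abbrev Q (x : G₀) : Type :=
  detLine (𝒢.A x) ⊗[ℝ] ⋀[ℝ]^(dim x) (Dual ℝ (Tan x))

/-- The tangent map of right translation `k ↦ k g`, from the `r`-fibre of `l g` to the `r`-fibre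
of `r g`.  It identifies the algebroid at `l g` with the kernel of `T_g r`. -/
def rightTrans (g : G) : 𝒢.A (𝒢.l g) →ₗ[ℝ] Tan g :=
  (𝒢.tmul (𝒢.one (𝒢.l g)) g g).toLinearMap ∘ₗ LinearMap.inl ℝ _ _ ∘ₗ (𝒢.A (𝒢.l g)).subtype

/-- The tangent map of `k ↦ g k⁻¹`, from the `r`-fibre of `r g` to the `l`-fibre of `l g`.
It identifies the algebroid at `r g` with the kernel of `T_g l`. -/
def leftTrans (g : G) : 𝒢.A (𝒢.r g) →ₗ[ℝ] Tan g :=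
  (𝒢.tmul g (𝒢.one (𝒢.r g)) g).toLinearMap ∘ₗ LinearMap.inr ℝ _ _ ∘ₗ
    (tmap 𝒢.inv (𝒢.one (𝒢.r g)) (𝒢.one (𝒢.r g))).toLinearMap ∘ₗ (𝒢.A (𝒢.r g)).subtype

/-- The action of the arrow `g` on `Q_A`, as a relation: `q ∈ Q_{l g}` and `q' ∈ Q_{r g}`
correspond to each other under the isomorphism `j_g : Q_{l g} ≅ Q_{r g}`.

Put `y = l g`, `x = r g`.  The exact sequences
`0 → A_y → T_g G → T_x G₀ → 0` (right translation, then `T r`) and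
`0 → A_x → T_g G → T_y G₀ → 0` (inversion and left translation, then `T l`) give
`Λ^top A_y ⊗ Λ^top T_x G₀ ≅ Λ^top T_g G ≅ Λ^top A_x ⊗ Λ^top T_y G₀`, hence `j_g`.
Writing `q = α_y ⊗ θ_y` and `q' = α_x ⊗ θ_x`, the condition reads
`(-1) ^ (rk A_y * rk A_x) • θ_y(l_* w) • α_y ∧ w' = θ_x(r_* w') • α_x ∧ w`
for all multivectors `w`, `w'` at `g` of degrees `dim_y G₀`, `dim_x G₀`.  Each side, as a bilinear
form in `(w, w')`, identifies `Q_y`, respectively `Q_x`, with one and the same line of forms, so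
this is the graph of an isomorphism.  The sign makes units act trivially and makes `j`
multiplicative, also along orbits meeting components of `G₀` of different dimensions; where there
is a bisection through `g`, `j_g` is the inverse of the map induced by its adjoint action on `A`
and its action on `G₀`. -/
def Corresponds (g : G) (q : 𝒢.Q (𝒢.l g)) (q' : 𝒢.Q (𝒢.r g)) : Prop :=
  ∀ (w : ⋀[ℝ]^(dim (𝒢.l g)) (Tan g)) (w' : ⋀[ℝ]^(dim (𝒢.r g)) (Tan g)),
    (-1 : ℝ) ^ (finrank ℝ (𝒢.A (𝒢.l g)) * finrank ℝ (𝒢.A (𝒢.r g))) •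
        wedgeForm (𝒢.rightTrans g) (tmap 𝒢.l g (𝒢.l g)).toLinearMap w w' q =
      wedgeForm (𝒢.leftTrans g) (tmap 𝒢.r g (𝒢.r g)).toLinearMap w' w q'

/-- A section of `Q_A`, not assumed smooth or continuous, is invariant if
`j (σ (l g)) = σ (r g)` for every arrow `g`. -/
def IsInvariant (σ : ∀ x, 𝒢.Q x) : Prop :=
  ∀ g, 𝒢.Corresponds g (σ (𝒢.l g)) (σ (𝒢.r g))

/-- The bundle `Q_A` near `x₀`, read in charts: `A` is a subbundle of the pull-back of `TG` along
the units, and the chart of `G` at `1_{x₀}` and the chart of `G₀` at `x₀` trivialize `TG` and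
`T*G₀`.  Thus `Q_x` is mapped injectively into a fixed vector space, for `x` near `x₀`. -/
def localRep (x₀ x : G₀) : 𝒢.Q x →ₗ[ℝ]
    ExteriorAlgebra ℝ (Tan (𝒢.one x₀)) ⊗[ℝ] ExteriorAlgebra ℝ (Dual ℝ (Tan x₀)) :=
  TensorProduct.map
    ((ExteriorAlgebra.map
        ((tmap id (𝒢.one x) (𝒢.one x₀)).toLinearMap ∘ₗ (𝒢.A x).subtype)).toLinearMap ∘ₗ
      (detLine (𝒢.A x)).subtype)
    ((ExteriorAlgebra.map
        (fderiv ℝ (rep id x₀ x) (chart x₀ x)).toLinearMap.dualMap).toLinearMap ∘ₗ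
      (⋀[ℝ]^(dim x) (Dual ℝ (Tan x))).subtype)

/-- A section of `Q_A` is smooth if, near every point, all components of its expression in charts
are smooth. -/
def IsSmoothSection (σ : ∀ x, 𝒢.Q x) : Prop :=
  ∀ x₀, ∀ ψ : Dual ℝ
      (ExteriorAlgebra ℝ (Tan (𝒢.one x₀)) ⊗[ℝ] ExteriorAlgebra ℝ (Dual ℝ (Tan x₀))),
    ContDiffAt ℝ ∞
      (fun v => ψ (𝒢.localRep x₀ ((chart x₀).symm v) (σ ((chart x₀).symm v)))) (chart x₀ x₀)

/-- The vector space of smooth invariant sections of `Q_A`. -/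
def smoothInvariantSections : Submodule ℝ (∀ x, 𝒢.Q x) where
  carrier := {σ | 𝒢.IsSmoothSection σ ∧ 𝒢.IsInvariant σ}
  zero_mem' := by
    refine ⟨fun x₀ ψ => ?_, fun g w w' => ?_⟩
    · simpa using contDiffAt_const
    · simp
  add_mem' := by
    rintro σ τ ⟨h1, h2⟩ ⟨h3, h4⟩
    refine ⟨fun x₀ ψ => ?_, fun g w w' => ?_⟩
    · simpa using (h1 x₀ ψ).add (h3 x₀ ψ)
    · simpa using congrArg₂ (· + ·) (h2 g w w') (h4 g w w')
  smul_mem' := by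
    rintro c σ ⟨h1, h2⟩
    refine ⟨fun x₀ ψ => ?_, fun g w w' => ?_⟩
    · simpa using contDiffAt_const.mul (h1 x₀ ψ)
    · have h := congrArg (c • ·) (h2 g w w')
      simpa [smul_comm c] using h

/-! ### Full open subsets and restriction of sections -/

/-- A set of objects is full if it meets every orbit. -/
def IsFull (U : Set G₀) : Prop := ∀ x, ∃ g, 𝒢.r g = x ∧ 𝒢.l g ∈ U

/-- The Lie algebroid of the restriction to `U` is the restriction of the Lie algebroid
(recall that the tangent spaces of an open submanifold are those of the ambient manifold). -/
theorem A_restrict (U : Opens G₀) (x : U) : 𝒢.A x.1 = (𝒢.restrict U).A x := by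
  have h := tmap_opens (U := 𝒢.arrowsOver U) (V := U) 𝒢.r (𝒢.restrict U).r (fun _ => rfl)
    ((𝒢.restrict U).one x) x
  unfold A
  rw [h]
  rfl

/-- The identification of the fibre of `Q_A` at a point of `U` with the fibre of the
corresponding bundle `Q_{A'}` of the restriction to `U`. -/
def restrictFibre (U : Opens G₀) (x : U) : 𝒢.Q x.1 →ₗ[ℝ] (𝒢.restrict U).Q x :=
  TensorProduct.map (detMap (LinearEquiv.ofEq _ _ (𝒢.A_restrict U x))) LinearMap.id

/-- Restriction to `U` of sections of `Q_A`. -/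
def restrictSection (U : Opens G₀) (σ : ∀ x, 𝒢.Q x) : ∀ x, (𝒢.restrict U).Q x :=
  fun x => 𝒢.restrictFibre U x (σ x.1)

end LieGroupoid

end DiffStack

end

noncomputable section

namespace DiffStack

open TopologicalSpace Module
open scoped ContDiff TensorProduct Topology

/-! ### Exterior algebra of short exact sequences -/

section Exterior

variable {A B T X Y : Type*} [AddCommGroup A] [Module ℝ A] [AddCommGroup B] [Module ℝ B]
  [AddCommGroup T] [Module ℝ T] [AddCommGroup X] [Module ℝ X] [AddCommGroup Y] [Module ℝ Y]

/-! The point is that `j_g` is multiplicative and depends smoothly on `g`. Since a full open set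
sends an arrow to every object, an invariant section is determined by its values on `U`, and its
smoothness on `U` spreads along arrows.

Linear algebra: if `A → T → X` is short exact, wedging with a top form of `A` depends only on the
image in `ΛX`. A pair of sequences `A → T → X` and `B → T → Y` therefore makes the defining relation
of `j_g` (`Balanced`) a single equation in the line `Λ^top T` (`Balanced.tmul_iff`), hence the graph
of an isomorphism.

Multiplicativity (`Corr.trans`): for a composable pair `(g, h)` with ends `z, y, x`, let `K` be the
tangent space of the manifold of composable pairs. It maps onto `T_g G`, `T_h G` and `T_{gh} G` with
kernels `A_x`, `A_z` and `A_y`. Lifting the three relations to `ΛK` and wedging with top forms of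
the kernels reduces the claim to graded commutativity (`Balanced.trans`); the sign in the definition
of `j` is the one that cancels.

Extension: choose for every `x` an arrow `γ x` with left end in `U` and right end `x`, and transport
the given section along it. For an arrow `k`, the arrow `γ (l k) · k · (γ (r k))⁻¹` has both ends in
`U`, so multiplicativity gives invariance (`exists_isInvariant_extension`).

Smoothness: the choice of `γ` need not be continuous, so smoothness is proved for an arbitrary
invariant section (`IsInvariant.smoothSectionAt`). The submersion `r` has a local section `s`
through a given arrow, and the section near its right end is `j_{s v}` applied to the values at `l
(s v)`. In frames moving smoothly with `v`, the coefficient of `j_{s v}` is a quotient of smooth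
functions. -/

theorem coe_exteriorPower_map (n : ℕ) (f : T →ₗ[ℝ] X) (w : ⋀[ℝ]^n T) :
    (exteriorPower.map n f w : ExteriorAlgebra ℝ X) = ExteriorAlgebra.map f w := by
  have h : (⋀[ℝ]^n X).subtype ∘ₗ exteriorPower.map n f =
      (ExteriorAlgebra.map f).toLinearMap ∘ₗ (⋀[ℝ]^n T).subtype := by
    ext v
    simp [ExteriorAlgebra.map_apply_ιMulti]
  exact LinearMap.congr_fun h w

theorem map_map_apply (f : A →ₗ[ℝ] T) (g : T →ₗ[ℝ] X) (w : ExteriorAlgebra ℝ A) :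
    ExteriorAlgebra.map g (ExteriorAlgebra.map f w) = ExteriorAlgebra.map (g ∘ₗ f) w := by
  rw [← ExteriorAlgebra.map_comp_map]
  rfl

theorem map_mem_exteriorPower {n : ℕ} (f : T →ₗ[ℝ] X) {w : ExteriorAlgebra ℝ T}
    (hw : w ∈ ⋀[ℝ]^n T) : ExteriorAlgebra.map f w ∈ ⋀[ℝ]^n X := by
  rw [← coe_exteriorPower_map n f ⟨w, hw⟩]
  exact (exteriorPower.map n f ⟨w, hw⟩).2

theorem ι_mem_exteriorPower (v : T) : ExteriorAlgebra.ι ℝ v ∈ ⋀[ℝ]^1 T := by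
  rw [ExteriorAlgebra.exteriorPower, pow_one]
  exact LinearMap.mem_range_self _ v

theorem mul_mem_exteriorPower {p q n : ℕ} {a b : ExteriorAlgebra ℝ T} (ha : a ∈ ⋀[ℝ]^p T)
    (hb : b ∈ ⋀[ℝ]^q T) (hn : p + q = n) : a * b ∈ ⋀[ℝ]^n T := by
  subst hn
  rw [ExteriorAlgebra.exteriorPower, pow_add]
  exact Submodule.mul_mem_mul ha hb

theorem ι_mul_ι_swap (v w : T) :
    ExteriorAlgebra.ι ℝ v * ExteriorAlgebra.ι ℝ w =
      -(ExteriorAlgebra.ι ℝ w * ExteriorAlgebra.ι ℝ v) :=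
  eq_neg_of_add_eq_zero_left (ExteriorAlgebra.ι_add_mul_swap v w)

theorem ι_mul_comm {q : ℕ} {b : ExteriorAlgebra ℝ T} (hb : b ∈ ⋀[ℝ]^q T) (v : T) :
    ExteriorAlgebra.ι ℝ v * b = (-1 : ℝ) ^ q • (b * ExteriorAlgebra.ι ℝ v) := by
  induction hb using Submodule.pow_induction_on_left' with
  | algebraMap r => simp [Algebra.commutes]
  | add x y i _ _ hx hy => rw [mul_add, hx, hy, add_mul, smul_add]
  | mem_mul m hm i x _ hx =>
    obtain ⟨u, rfl⟩ := hm
    rw [← mul_assoc, ι_mul_ι_swap, neg_mul, mul_assoc, hx, pow_succ, mul_smul_comm, mul_assoc]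
    simp

/-- Graded commutativity of the exterior algebra. -/
theorem exteriorPower_mul_comm {p q : ℕ} {a b : ExteriorAlgebra ℝ T} (ha : a ∈ ⋀[ℝ]^p T)
    (hb : b ∈ ⋀[ℝ]^q T) : a * b = (-1 : ℝ) ^ (p * q) • (b * a) := by
  induction ha using Submodule.pow_induction_on_left' with
  | algebraMap r => simp [Algebra.commutes]
  | add x y i _ _ hx hy => rw [mul_add, add_mul, hx, hy, smul_add]
  | mem_mul m hm i x _ hx =>
    obtain ⟨u, rfl⟩ := hm
    rw [mul_assoc, hx, mul_smul_comm, ← mul_assoc, ι_mul_comm hb, smul_mul_assoc, mul_assoc,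
      smul_smul]
    congr 1
    rw [Nat.succ_mul, pow_add]

theorem finrank_detLine [FiniteDimensional ℝ A] : finrank ℝ (detLine A) = 1 := by
  rw [exteriorPower.finrank_eq, Nat.choose_self]

/-- The product has degree one more than the rank, where the exterior power vanishes. -/
theorem top_mul_ι [FiniteDimensional ℝ A] (α : detLine A) (a : A) :
    (α : ExteriorAlgebra ℝ A) * ExteriorAlgebra.ι ℝ a = 0 := by
  have h : finrank ℝ (⋀[ℝ]^(finrank ℝ A + 1) A) = 0 := by
    rw [exteriorPower.finrank_eq, Nat.choose_succ_self]
  have h0 := Submodule.finrank_eq_zero.1 h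
  have h1 := mul_mem_exteriorPower α.2 (ι_mem_exteriorPower a) rfl
  rw [h0] at h1
  simpa using h1

/-- A left inverse of the linear combination map gives functionals dual to `v`; pairing with their
product gives the determinant of the identity matrix. -/
theorem ιMulti_ne_zero {n : ℕ} {v : Fin n → T} (hv : LinearIndependent ℝ v) :
    ExteriorAlgebra.ιMulti ℝ n v ≠ 0 := by
  obtain ⟨f, hf⟩ := LinearMap.exists_leftInverse_of_injective (Fintype.linearCombination ℝ v)
    (LinearMap.ker_eq_bot.2 (LinearIndependent.fintypeLinearCombination_injective hv))
  have hfv : ∀ i, f (v i) = Pi.single i 1 := fun i => by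
    have := LinearMap.congr_fun hf (Pi.single i 1)
    simpa using this
  intro h
  have h1 : exteriorPower.ιMulti ℝ n v = 0 := Subtype.ext h
  have h2 := exteriorPower.pairingDual_ιMulti_ιMulti
    (fun j : Fin n => (LinearMap.proj j : (Fin n → ℝ) →ₗ[ℝ] ℝ) ∘ₗ f) v
  rw [h1, map_zero] at h2
  have h3 : (Matrix.of fun i j : Fin n =>
      ((LinearMap.proj j : (Fin n → ℝ) →ₗ[ℝ] ℝ) ∘ₗ f) (v i)) = 1 := by
    ext i j
    simp [hfv, Pi.single_apply, Matrix.one_apply, eq_comm]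
  rw [h3, Matrix.det_one] at h2
  exact zero_ne_one h2

/-- A short exact sequence `0 → A → T → X → 0`. -/
structure ShortExact (R : A →ₗ[ℝ] T) (p : T →ₗ[ℝ] X) : Prop where
  inj : Function.Injective R
  surj : Function.Surjective p
  exact : LinearMap.range R = LinearMap.ker p

namespace ShortExact

variable {R : A →ₗ[ℝ] T} {p : T →ₗ[ℝ] X}

theorem finrank_eq [FiniteDimensional ℝ T] (h : ShortExact R p) :
    finrank ℝ A + finrank ℝ X = finrank ℝ T := by
  rw [← LinearMap.finrank_range_add_finrank_ker p, ← h.exact,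
    LinearMap.finrank_range_of_inj h.inj, LinearMap.range_eq_top.2 h.surj, finrank_top, add_comm]

theorem apply_apply (h : ShortExact R p) (a : A) : p (R a) = 0 := by
  rw [← LinearMap.mem_ker, ← h.exact]
  exact LinearMap.mem_range_self _ a

theorem exists_section (h : ShortExact R p) : ∃ s : X →ₗ[ℝ] T, p ∘ₗ s = .id :=
  p.exists_rightInverse_of_surjective (LinearMap.range_eq_top.2 h.surj)

theorem append_linearIndependent (h : ShortExact R p) {k m : ℕ} {a : Fin k → A}
    (ha : LinearIndependent ℝ a) {t : Fin m → T} (ht : LinearIndependent ℝ (p ∘ t)) :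
    LinearIndependent ℝ (Fin.append (R ∘ a) t) := by
  rw [Fintype.linearIndependent_iff]
  intro g hg
  rw [Fin.sum_univ_add] at hg
  simp only [Fin.append_left, Fin.append_right, Function.comp_apply] at hg
  have h1 := congrArg p hg
  simp only [map_add, map_sum, map_smul, h.apply_apply, smul_zero, Finset.sum_const_zero, zero_add,
    map_zero] at h1
  have h2 := Fintype.linearIndependent_iff.1 ht _ h1
  simp only [h2, zero_smul, Finset.sum_const_zero, add_zero] at hg
  have h3 : R (∑ i, g (Fin.castAdd m i) • a i) = R 0 := by simpa using hg
  have h4 := Fintype.linearIndependent_iff.1 ha _ (h.inj h3)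
  intro i
  refine Fin.addCases (fun i => h4 i) (fun i => h2 i) i

variable [FiniteDimensional ℝ A]

/-- The factor `R a` anticommutes past the generators of `x` until it meets the top form of `A`,
which kills it. -/
theorem top_mul_mul_ι (α : detLine A) (x : ExteriorAlgebra ℝ T) (a : A) :
    ExteriorAlgebra.map R α * x * ExteriorAlgebra.ι ℝ (R a) = 0 := by
  induction x using CliffordAlgebra.right_induction with
  | algebraMap r =>
    rw [← Algebra.commutes, mul_assoc, ← ExteriorAlgebra.map_apply_ι, ← map_mul, top_mul_ι,
      map_zero, mul_zero]
  | add x y hx hy => rw [mul_add, add_mul, hx, hy, add_zero]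
  | mul_ι v x hx =>
    change ExteriorAlgebra.map R α * (x * ExteriorAlgebra.ι ℝ v) * _ = 0
    rw [mul_assoc, mul_assoc, ι_mul_ι_swap, mul_neg, mul_neg, ← mul_assoc, ← mul_assoc, hx,
      zero_mul, neg_zero]

/-- Wedging with a top form of `A` only depends on the multivector modulo `A`. -/
theorem top_mul_eq (h : ShortExact R p) {s : X →ₗ[ℝ] T} (hs : p ∘ₗ s = .id)
    (α : detLine A) (w : ExteriorAlgebra ℝ T) :
    ExteriorAlgebra.map R α * w =
      ExteriorAlgebra.map R α * ExteriorAlgebra.map s (ExteriorAlgebra.map p w) := by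
  induction w using CliffordAlgebra.right_induction with
  | algebraMap r =>
    erw [AlgHom.commutes, AlgHom.commutes]
  | add x y hx hy => rw [map_add, map_add, mul_add, mul_add, hx, hy]
  | mul_ι v x hx =>
    change _ * (x * ExteriorAlgebra.ι ℝ v) = _ * ExteriorAlgebra.map s
      (ExteriorAlgebra.map p (x * ExteriorAlgebra.ι ℝ v))
    -- Replacing the last factor `v` by `s (p v)` changes it by an element of `A`, which the top
    -- form kills by `top_mul_mul_ι`.
    have hv : v - s (p v) ∈ LinearMap.range R := by
      rw [h.exact, LinearMap.mem_ker, map_sub]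
      have := LinearMap.congr_fun hs (p v)
      simp only [LinearMap.comp_apply, LinearMap.id_apply] at this
      rw [this, sub_self]
    obtain ⟨a, ha⟩ := hv
    have h0 := top_mul_mul_ι (R := R) α (ExteriorAlgebra.map s (ExteriorAlgebra.map p x)) a
    rw [ha, map_sub, mul_sub, sub_eq_zero] at h0
    rw [← mul_assoc, hx, h0, map_mul, map_mul, ExteriorAlgebra.map_apply_ι,
      ExteriorAlgebra.map_apply_ι, mul_assoc]

theorem top_mul_eq_zero (h : ShortExact R p) (α : detLine A) {w : ExteriorAlgebra ℝ T}
    (hw : ExteriorAlgebra.map p w = 0) : ExteriorAlgebra.map R α * w = 0 := by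
  obtain ⟨s, hs⟩ := h.exists_section
  rw [h.top_mul_eq hs, hw, map_zero, mul_zero]

/-- After `w` is replaced by `s_* p_* w`, the product is a nonzero multiple of the wedge of a basis
of `A` followed by a lifted basis of `X`, a linearly independent family. -/
theorem top_mul_ne_zero [FiniteDimensional ℝ X] (h : ShortExact R p) {α : detLine A} (hα : α ≠ 0)
    {n : ℕ} (hn : finrank ℝ X = n) {w : ExteriorAlgebra ℝ T} (hw : w ∈ ⋀[ℝ]^n T)
    (hw0 : ExteriorAlgebra.map p w ≠ 0) : ExteriorAlgebra.map R α * w ≠ 0 := by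
  subst hn
  obtain ⟨s, hs⟩ := h.exists_section
  rw [h.top_mul_eq hs]
  let a := finBasis ℝ A
  let t := finBasis ℝ X
  have ha : exteriorPower.ιMulti ℝ _ a ≠ 0 := fun h0 =>
    ιMulti_ne_zero a.linearIndependent (congrArg Subtype.val h0)
  have ht : exteriorPower.ιMulti ℝ _ t ≠ 0 := fun h0 =>
    ιMulti_ne_zero t.linearIndependent (congrArg Subtype.val h0)
  obtain ⟨c, hc⟩ := exists_smul_eq_of_finrank_eq_one finrank_detLine ha α
  obtain ⟨d, hd⟩ := exists_smul_eq_of_finrank_eq_one finrank_detLine ht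
    ⟨ExteriorAlgebra.map p w, map_mem_exteriorPower p hw⟩
  have hd' : ExteriorAlgebra.map p w = d • ExteriorAlgebra.ιMulti ℝ _ t :=
    (congrArg Subtype.val hd).symm
  have hc' : (α : ExteriorAlgebra ℝ A) = c • ExteriorAlgebra.ιMulti ℝ _ a :=
    (congrArg Subtype.val hc).symm
  have hc0 : c ≠ 0 := by
    rintro rfl
    exact hα (by rw [← hc, zero_smul])
  have hd0 : d ≠ 0 := by
    rintro rfl
    exact hw0 (by rw [hd', zero_smul])
  rw [hd', hc', map_smul, map_smul, ExteriorAlgebra.map_apply_ιMulti,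
    ExteriorAlgebra.map_apply_ιMulti, smul_mul_smul_comm, ExteriorAlgebra.ιMulti_mul_ιMulti]
  refine smul_ne_zero (mul_ne_zero hc0 hd0) (ιMulti_ne_zero ?_)
  refine h.append_linearIndependent a.linearIndependent ?_
  have : p ∘ s ∘ t = t := by
    ext i
    exact LinearMap.congr_fun hs (t i)
  rw [this]
  exact t.linearIndependent

/-- Since `Λ^k X` is a line, `w` is a multiple of `τ` modulo the kernel of `p_*`, and `θ` reads off
the factor. -/
theorem top_mul_eq_smul [FiniteDimensional ℝ X] (h : ShortExact R p) {k : ℕ}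
    (hk : finrank ℝ X = k) {θ : ⋀[ℝ]^k (Dual ℝ X)} {τ : ⋀[ℝ]^k T}
    (hτ : exteriorPower.pairingDual ℝ X k θ (exteriorPower.map k p τ) = 1) (α : detLine A)
    (w : ⋀[ℝ]^k T) : ExteriorAlgebra.map R α * (w : ExteriorAlgebra ℝ T) =
      exteriorPower.pairingDual ℝ X k θ (exteriorPower.map k p w) •
        (ExteriorAlgebra.map R α * (τ : ExteriorAlgebra ℝ T)) := by
  subst hk
  have h0 : exteriorPower.map _ p τ ≠ 0 := fun h0 => by
    rw [h0, map_zero] at hτ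
    exact zero_ne_one hτ
  obtain ⟨c, hc⟩ := exists_smul_eq_of_finrank_eq_one finrank_detLine h0
    (exteriorPower.map _ p w)
  rw [← hc, map_smul, hτ, smul_eq_mul, mul_one, ← mul_smul_comm, ← sub_eq_zero, ← mul_sub]
  refine h.top_mul_eq_zero α ?_
  rw [map_sub, map_smul, ← coe_exteriorPower_map, ← coe_exteriorPower_map, ← hc]
  simp

end ShortExact

/-! ### The lines `Λ^top A ⊗ Λ^top Y*` and the relation between them -/

theorem exists_tmul_of_ne_zero [FiniteDimensional ℝ A] [FiniteDimensional ℝ Y] {n : ℕ}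
    (hn : finrank ℝ Y = n) : ∃ (α : detLine A) (θ : ⋀[ℝ]^n (Dual ℝ Y)), α ≠ 0 ∧ θ ≠ 0 ∧
      ∀ q : detLine A ⊗[ℝ] ⋀[ℝ]^n (Dual ℝ Y), ∃ c : ℝ, q = (c • α) ⊗ₜ θ := by
  have h2 : finrank ℝ (⋀[ℝ]^n (Dual ℝ Y)) = 1 := by
    rw [exteriorPower.finrank_eq, Subspace.dual_finrank_eq, hn, Nat.choose_self]
  obtain ⟨α, hα, hα'⟩ := finrank_eq_one_iff'.1 (finrank_detLine (A := A))
  obtain ⟨θ, hθ, hθ'⟩ := finrank_eq_one_iff'.1 h2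
  refine ⟨α, θ, hα, hθ, fun q => ?_⟩
  induction q using TensorProduct.induction_on with
  | zero => exact ⟨0, by simp⟩
  | add x y hx hy =>
    obtain ⟨c, rfl⟩ := hx
    obtain ⟨d, rfl⟩ := hy
    exact ⟨c + d, by rw [add_smul, TensorProduct.add_tmul]⟩
  | tmul x y =>
    obtain ⟨c, rfl⟩ := hα' x
    obtain ⟨d, rfl⟩ := hθ' y
    exact ⟨d * c, by rw [TensorProduct.tmul_smul, mul_smul, TensorProduct.smul_tmul']⟩

theorem eq_tmul_of_ne_zero [FiniteDimensional ℝ A] [FiniteDimensional ℝ Y] {n : ℕ}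
    (hn : finrank ℝ Y = n) {q : detLine A ⊗[ℝ] ⋀[ℝ]^n (Dual ℝ Y)} (hq : q ≠ 0) :
    ∃ (α : detLine A) (θ : ⋀[ℝ]^n (Dual ℝ Y)), α ≠ 0 ∧ θ ≠ 0 ∧ q = α ⊗ₜ θ := by
  obtain ⟨α, θ, hα, hθ, h⟩ := exists_tmul_of_ne_zero (A := A) hn
  obtain ⟨c, rfl⟩ := h q
  refine ⟨c • α, θ, fun h0 => hq (by rw [h0, TensorProduct.zero_tmul]), hθ, rfl⟩

/-- Dual bases show that the pairing of the two top powers is nonzero, and `p_*` is onto. Such a `τ`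
serves as a normalized test multivector. -/
theorem exists_pairingDual_eq_one [FiniteDimensional ℝ Y] {n : ℕ} (hn : finrank ℝ Y = n)
    {p : T →ₗ[ℝ] Y} (hp : Function.Surjective p) {θ : ⋀[ℝ]^n (Dual ℝ Y)} (hθ : θ ≠ 0) :
    ∃ τ : ⋀[ℝ]^n T, exteriorPower.pairingDual ℝ Y n θ (exteriorPower.map n p τ) = 1 := by
  subst hn
  let b := finBasis ℝ Y
  have h1 : exteriorPower.pairingDual ℝ Y _ (exteriorPower.ιMulti ℝ _ b.coord)
      (exteriorPower.ιMulti ℝ _ b) = 1 := by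
    rw [exteriorPower.pairingDual_ιMulti_ιMulti, ← Matrix.det_one (n := Fin (finrank ℝ Y))]
    congr 1
    ext i j
    simp [Matrix.one_apply, Finsupp.single_apply]
  have h2 : finrank ℝ (⋀[ℝ]^(finrank ℝ Y) (Dual ℝ Y)) = 1 := by
    rw [exteriorPower.finrank_eq, Subspace.dual_finrank_eq, Nat.choose_self]
  obtain ⟨c, hc⟩ := exists_smul_eq_of_finrank_eq_one h2 hθ (exteriorPower.ιMulti ℝ _ b.coord)
  obtain ⟨τ, hτ⟩ := exteriorPower.map_surjective (n := finrank ℝ Y) hp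
    (exteriorPower.ιMulti ℝ _ b)
  refine ⟨c • τ, ?_⟩
  rw [← hc, map_smul] at h1
  rw [map_smul, hτ, map_smul]
  exact h1

/-- The relation between `Λ^top A ⊗ Λ^top Y*` and `Λ^top B ⊗ Λ^top X*` that is induced by two
short exact sequences `A → T → X` and `B → T → Y`. -/
def Balanced (ε : ℝ) (R : A →ₗ[ℝ] T) (pX : T →ₗ[ℝ] X) (L : B →ₗ[ℝ] T) (pY : T →ₗ[ℝ] Y) {m n : ℕ}
    (q : detLine A ⊗[ℝ] ⋀[ℝ]^n (Dual ℝ Y)) (q' : detLine B ⊗[ℝ] ⋀[ℝ]^m (Dual ℝ X)) : Prop :=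
  ∀ (w : ⋀[ℝ]^n T) (w' : ⋀[ℝ]^m T), ε • wedgeForm R pY w w' q = wedgeForm L pX w' w q'

namespace Balanced

variable {ε : ℝ} {R : A →ₗ[ℝ] T} {pX : T →ₗ[ℝ] X} {L : B →ₗ[ℝ] T} {pY : T →ₗ[ℝ] Y} {m n : ℕ}
  {q q₁ q₂ : detLine A ⊗[ℝ] ⋀[ℝ]^n (Dual ℝ Y)} {q' q₁' q₂' : detLine B ⊗[ℝ] ⋀[ℝ]^m (Dual ℝ X)}

theorem zero : Balanced ε R pX L pY (0 : detLine A ⊗[ℝ] ⋀[ℝ]^n (Dual ℝ Y))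
    (0 : detLine B ⊗[ℝ] ⋀[ℝ]^m (Dual ℝ X)) := fun w w' => by simp

theorem sub (h₁ : Balanced ε R pX L pY q₁ q₁') (h₂ : Balanced ε R pX L pY q₂ q₂') :
    Balanced ε R pX L pY (q₁ - q₂) (q₁' - q₂') := fun w w' => by
  rw [map_sub, map_sub, smul_sub, h₁, h₂]

variable [FiniteDimensional ℝ A] [FiniteDimensional ℝ B]
  [FiniteDimensional ℝ X] [FiniteDimensional ℝ Y]

/-- By `top_mul_eq_smul` both sides of the relation at `(w, w')` are their values at `(τ, τ')` times
the same scalar, so one test pair decides. -/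
theorem tmul_iff (hR : ShortExact R pX) (hL : ShortExact L pY) (hm : finrank ℝ X = m)
    (hn : finrank ℝ Y = n) {α : detLine A} {θ : ⋀[ℝ]^n (Dual ℝ Y)} {β : detLine B}
    {η : ⋀[ℝ]^m (Dual ℝ X)} {τ : ⋀[ℝ]^n T} {τ' : ⋀[ℝ]^m T}
    (hτ : exteriorPower.pairingDual ℝ Y n θ (exteriorPower.map n pY τ) = 1)
    (hτ' : exteriorPower.pairingDual ℝ X m η (exteriorPower.map m pX τ') = 1) :
    Balanced ε R pX L pY (α ⊗ₜ θ) (β ⊗ₜ η) ↔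
      ε • (ExteriorAlgebra.map R α * (τ' : ExteriorAlgebra ℝ T)) =
        ExteriorAlgebra.map L β * (τ : ExteriorAlgebra ℝ T) := by
  constructor
  · intro h
    have := h τ τ'
    rwa [wedgeForm_tmul, wedgeForm_tmul, hτ, hτ', one_smul, one_smul] at this
  · intro h w w'
    rw [wedgeForm_tmul, wedgeForm_tmul, hR.top_mul_eq_smul hm hτ' α w',
      hL.top_mul_eq_smul hn hτ β w, ← h]
    simp only [smul_smul]
    congr 1
    ring

theorem wedge_ne_zero (hL : ShortExact L pY) (hn : finrank ℝ Y = n) {θ : ⋀[ℝ]^n (Dual ℝ Y)}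
    {β : detLine B} {τ : ⋀[ℝ]^n T} (hβ : β ≠ 0)
    (hτ : exteriorPower.pairingDual ℝ Y n θ (exteriorPower.map n pY τ) = 1) :
    ExteriorAlgebra.map L β * (τ : ExteriorAlgebra ℝ T) ≠ 0 := by
  refine hL.top_mul_ne_zero hβ hn τ.2 fun h0 => ?_
  have : exteriorPower.map n pY τ = 0 := Subtype.ext (by rw [coe_exteriorPower_map, h0]; rfl)
  rw [this, map_zero] at hτ
  exact zero_ne_one hτ

/-- The wedge of `β` and `τ` spans the line `Λ^top T`, so rescaling `β` solves the single equation
of `tmul_iff`. -/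
theorem exists_right [FiniteDimensional ℝ T] (hR : ShortExact R pX) (hL : ShortExact L pY) (hm : finrank ℝ X = m)
    (hn : finrank ℝ Y = n) (q : detLine A ⊗[ℝ] ⋀[ℝ]^n (Dual ℝ Y)) :
    ∃ q' : detLine B ⊗[ℝ] ⋀[ℝ]^m (Dual ℝ X), Balanced ε R pX L pY q q' := by
  by_cases hq : q = 0
  · subst hq
    exact ⟨0, zero⟩
  obtain ⟨α, θ, hα, hθ, rfl⟩ := eq_tmul_of_ne_zero hn hq
  obtain ⟨β, η, hβ, hη, -⟩ := exists_tmul_of_ne_zero (A := B) hm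
  obtain ⟨τ, hτ⟩ := exists_pairingDual_eq_one hn hL.surj hθ
  obtain ⟨τ', hτ'⟩ := exists_pairingDual_eq_one hm hR.surj hη
  have h1 : ExteriorAlgebra.map L β * (τ : ExteriorAlgebra ℝ T) ∈ detLine T :=
    mul_mem_exteriorPower (map_mem_exteriorPower L β.2) τ.2 (by rw [← hn, hL.finrank_eq])
  have h2 : ε • (ExteriorAlgebra.map R α * (τ' : ExteriorAlgebra ℝ T)) ∈ detLine T :=
    Submodule.smul_mem _ _ (mul_mem_exteriorPower (map_mem_exteriorPower R α.2) τ'.2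
      (by rw [← hm, hR.finrank_eq]))
  have h3 : (⟨_, h1⟩ : detLine T) ≠ 0 := fun h0 =>
    wedge_ne_zero hL hn hβ hτ (congrArg Subtype.val h0)
  obtain ⟨c, hc⟩ := exists_smul_eq_of_finrank_eq_one finrank_detLine h3 ⟨_, h2⟩
  refine ⟨(c • β) ⊗ₜ η, (tmul_iff hR hL hm hn hτ hτ').2 ?_⟩
  have hc' := congrArg Subtype.val hc
  simp only [SetLike.val_smul] at hc'
  rw [← hc', SetLike.val_smul, map_smul, smul_mul_assoc]

/-- Writing `0` as `0 ⊗ θ` turns the relation into the vanishing of a wedge that `wedge_ne_zero`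
excludes. -/
theorem eq_zero_right (hR : ShortExact R pX) (hL : ShortExact L pY) (hm : finrank ℝ X = m)
    (hn : finrank ℝ Y = n) (h : Balanced ε R pX L pY (0 : detLine A ⊗[ℝ] ⋀[ℝ]^n (Dual ℝ Y)) q') :
    q' = 0 := by
  by_contra hq
  obtain ⟨β, η, hβ, hη, rfl⟩ := eq_tmul_of_ne_zero hm hq
  obtain ⟨α, θ, hα, hθ, -⟩ := exists_tmul_of_ne_zero (A := A) hn
  obtain ⟨τ, hτ⟩ := exists_pairingDual_eq_one hn hL.surj hθ
  obtain ⟨τ', hτ'⟩ := exists_pairingDual_eq_one hm hR.surj hη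
  rw [← TensorProduct.zero_tmul _ θ, tmul_iff hR hL hm hn hτ hτ'] at h
  refine wedge_ne_zero hL hn hβ hτ ?_
  simpa using h.symm

theorem eq_zero_left (hε : ε ≠ 0) (hR : ShortExact R pX) (hL : ShortExact L pY)
    (hm : finrank ℝ X = m) (hn : finrank ℝ Y = n)
    (h : Balanced ε R pX L pY q (0 : detLine B ⊗[ℝ] ⋀[ℝ]^m (Dual ℝ X))) : q = 0 := by
  by_contra hq
  obtain ⟨α, θ, hα, hθ, rfl⟩ := eq_tmul_of_ne_zero hn hq
  obtain ⟨β, η, hβ, hη, -⟩ := exists_tmul_of_ne_zero (A := B) hm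
  obtain ⟨τ, hτ⟩ := exists_pairingDual_eq_one hn hL.surj hθ
  obtain ⟨τ', hτ'⟩ := exists_pairingDual_eq_one hm hR.surj hη
  rw [← TensorProduct.zero_tmul _ η, tmul_iff hR hL hm hn hτ hτ'] at h
  refine wedge_ne_zero hR hm hα hτ' ?_
  simpa [hε] using h

theorem right_unique (hR : ShortExact R pX) (hL : ShortExact L pY) (hm : finrank ℝ X = m)
    (hn : finrank ℝ Y = n) (h₁ : Balanced ε R pX L pY q q₁') (h₂ : Balanced ε R pX L pY q q₂') :
    q₁' = q₂' := by
  have := h₁.sub h₂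
  rw [sub_self] at this
  exact sub_eq_zero.1 (eq_zero_right hR hL hm hn this)

end Balanced

/-! ### Composition of the relations -/

section Trans

variable {Az Ay Ax T₁ T₂ T₃ K Z : Type*} [AddCommGroup Az] [Module ℝ Az] [AddCommGroup Ay]
  [Module ℝ Ay] [AddCommGroup Ax] [Module ℝ Ax] [AddCommGroup T₁] [Module ℝ T₁] [AddCommGroup T₂]
  [Module ℝ T₂] [AddCommGroup T₃] [Module ℝ T₃] [AddCommGroup K] [Module ℝ K] [AddCommGroup Z]
  [Module ℝ Z] [FiniteDimensional ℝ Az] [FiniteDimensional ℝ Ay] [FiniteDimensional ℝ Ax]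
  [FiniteDimensional ℝ T₃]
  [FiniteDimensional ℝ Z] [FiniteDimensional ℝ X] [FiniteDimensional ℝ Y]

/-- The relations `Balanced` compose, for three pairs of short exact sequences that are
arranged around a common space `K`. -/
theorem Balanced.trans {R₁ : Az →ₗ[ℝ] T₁} {r₁ : T₁ →ₗ[ℝ] Y} {L₁ : Ay →ₗ[ℝ] T₁} {l₁ : T₁ →ₗ[ℝ] Z}
    {R₂ : Ay →ₗ[ℝ] T₂} {r₂ : T₂ →ₗ[ℝ] X} {L₂ : Ax →ₗ[ℝ] T₂} {l₂ : T₂ →ₗ[ℝ] Y}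
    {R₃ : Az →ₗ[ℝ] T₃} {r₃ : T₃ →ₗ[ℝ] X} {L₃ : Ax →ₗ[ℝ] T₃} {l₃ : T₃ →ₗ[ℝ] Z}
    {π₁ : K →ₗ[ℝ] T₁} {π₂ : K →ₗ[ℝ] T₂} {μ : K →ₗ[ℝ] T₃}
    {jR : Az →ₗ[ℝ] K} {jL : Ax →ₗ[ℝ] K} {D : Ay →ₗ[ℝ] K}
    (hR₁ : ShortExact R₁ r₁) (hL₁ : ShortExact L₁ l₁) (hR₂ : ShortExact R₂ r₂)
    (hL₂ : ShortExact L₂ l₂) (hR₃ : ShortExact R₃ r₃) (hL₃ : ShortExact L₃ l₃)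
    (h₁ : ShortExact jL π₁) (h₂ : ShortExact jR π₂) (h₃ : ShortExact D μ)
    (eR₁ : π₁ ∘ₗ jR = R₁) (eR₃ : μ ∘ₗ jR = R₃) (eL₂ : π₂ ∘ₗ jL = L₂) (eL₃ : μ ∘ₗ jL = L₃)
    (eD₁ : π₁ ∘ₗ D = L₁) (eD₂ : π₂ ∘ₗ D = R₂)
    (ey : r₁ ∘ₗ π₁ = l₂ ∘ₗ π₂) (ez : l₃ ∘ₗ μ = l₁ ∘ₗ π₁) (ex : r₃ ∘ₗ μ = r₂ ∘ₗ π₂)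
    {nx ny nz : ℕ} (hx : finrank ℝ X = nx) (hy : finrank ℝ Y = ny) (hz : finrank ℝ Z = nz)
    {q : detLine Az ⊗[ℝ] ⋀[ℝ]^nz (Dual ℝ Z)} {q' : detLine Ay ⊗[ℝ] ⋀[ℝ]^ny (Dual ℝ Y)}
    {q'' : detLine Ax ⊗[ℝ] ⋀[ℝ]^nx (Dual ℝ X)}
    (b₁ : Balanced ((-1) ^ (finrank ℝ Az * finrank ℝ Ay)) R₁ r₁ L₁ l₁ q q')
    (b₂ : Balanced ((-1) ^ (finrank ℝ Ay * finrank ℝ Ax)) R₂ r₂ L₂ l₂ q' q'') :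
    Balanced ((-1) ^ (finrank ℝ Az * finrank ℝ Ax)) R₃ r₃ L₃ l₃ q q'' := by
  by_cases hq' : q' = 0
  · subst hq'
    have e1 := eq_zero_left (pow_ne_zero _ (by norm_num)) hR₁ hL₁ hy hz b₁
    have e2 := eq_zero_right hR₂ hL₂ hx hy b₂
    subst e1 e2
    exact zero
  have hq : q ≠ 0 := by
    rintro rfl
    exact hq' (eq_zero_right hR₁ hL₁ hy hz b₁)
  have hq'' : q'' ≠ 0 := by
    rintro rfl
    exact hq' (eq_zero_left (pow_ne_zero _ (by norm_num)) hR₂ hL₂ hx hy b₂)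
  obtain ⟨αz, θz, hαz, hθz, rfl⟩ := eq_tmul_of_ne_zero hz hq
  obtain ⟨αy, θy, hαy, hθy, rfl⟩ := eq_tmul_of_ne_zero hy hq'
  obtain ⟨αx, θx, hαx, hθx, rfl⟩ := eq_tmul_of_ne_zero hx hq''
  -- The test multivectors are taken in `ΛK`: each has images in two of the spaces `T₁`, `T₂`, `T₃`,
  -- so all three relations become statements about elements of `ΛK`.
  obtain ⟨τz, hτz⟩ := exists_pairingDual_eq_one hz (p := l₁ ∘ₗ π₁)
    (hL₁.surj.comp h₁.surj) hθz
  obtain ⟨τy, hτy⟩ := exists_pairingDual_eq_one hy (p := l₂ ∘ₗ π₂)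
    (hL₂.surj.comp h₂.surj) hθy
  obtain ⟨τx, hτx⟩ := exists_pairingDual_eq_one hx (p := r₂ ∘ₗ π₂)
    (hR₂.surj.comp h₂.surj) hθx
  have hτz' := hτz
  have hτy' := hτy
  have hτx' := hτx
  rw [← ez] at hτz'
  rw [← ey] at hτy'
  rw [← ex] at hτx'
  rw [exteriorPower.map_comp, LinearMap.comp_apply] at hτz hτy hτx hτz' hτy' hτx'
  rw [tmul_iff hR₁ hL₁ hy hz hτz hτy'] at b₁
  rw [tmul_iff hR₂ hL₂ hx hy hτy hτx] at b₂
  rw [tmul_iff hR₃ hL₃ hx hz hτz' hτx']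
  simp only [coe_exteriorPower_map] at b₁ b₂ ⊢
  subst eR₁ eR₃ eL₂ eL₃ eD₁ eD₂
  simp only [← map_map_apply, ← map_mul, ← map_smul] at b₁ b₂ ⊢
  set Zt := ExteriorAlgebra.map jR (αz : ExteriorAlgebra ℝ Az) with hZt
  set Xt := ExteriorAlgebra.map jL (αx : ExteriorAlgebra ℝ Ax) with hXt
  set Dt := ExteriorAlgebra.map D (αy : ExteriorAlgebra ℝ Ay) with hDt
  have hZm : Zt ∈ ⋀[ℝ]^(finrank ℝ Az) K := map_mem_exteriorPower _ αz.2
  have hXm : Xt ∈ ⋀[ℝ]^(finrank ℝ Ax) K := map_mem_exteriorPower _ αx.2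
  have hDm : Dt ∈ ⋀[ℝ]^(finrank ℝ Ay) K := map_mem_exteriorPower _ αy.2
  rw [← sub_eq_zero, ← map_sub] at b₁ b₂ ⊢
  -- The relation `b₁` says that an element of `ΛK` dies in `ΛT₁`; wedging it with a top form of the
  -- kernel `Ax` of `π₁` gives an identity in `ΛK` itself. The same works for `b₂` with the kernel
  -- `Az` of `π₂`.
  have c₁ := h₁.top_mul_eq_zero αx b₁
  have c₂ := h₂.top_mul_eq_zero αz b₂
  rw [← hXt, mul_sub, sub_eq_zero, mul_smul_comm, ← mul_assoc, ← mul_assoc] at c₁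
  rw [← hZt, mul_sub, sub_eq_zero, mul_smul_comm, ← mul_assoc, ← mul_assoc] at c₂
  -- Both terms reduce to multiples of `Zt * Xt * τy` by `c₁`, `c₂` and graded commutativity; the
  -- signs then agree.
  have key : Dt * ((-1 : ℝ) ^ (finrank ℝ Az * finrank ℝ Ax) • (Zt * (τx : ExteriorAlgebra ℝ K)) -
      Xt * (τz : ExteriorAlgebra ℝ K)) = 0 := by
    rw [mul_sub, sub_eq_zero, mul_smul_comm, ← mul_assoc, ← mul_assoc,
      exteriorPower_mul_comm hDm hXm, exteriorPower_mul_comm hDm hZm, smul_mul_assoc,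
      smul_mul_assoc, ← c₁, exteriorPower_mul_comm hXm hZm, smul_mul_assoc, ← c₂]
    simp only [smul_smul]
    congr 1
    have sq : ∀ k : ℕ, (-1 : ℝ) ^ k * (-1) ^ k = 1 := fun k => by
      rw [← mul_pow]
      simp
    generalize finrank ℝ Az = a
    generalize finrank ℝ Ay = b
    generalize finrank ℝ Ax = c
    rw [mul_comm b a, mul_comm c a, mul_comm b c, mul_comm c b]
    calc (-1 : ℝ) ^ (a * c) * (-1) ^ (a * b) = (-1) ^ (a * b) * (-1) ^ (a * c) := mul_comm _ _
      _ = _ := by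
        rw [show (-1 : ℝ) ^ (b * c) * ((-1) ^ (a * b) * ((-1) ^ (a * c) * (-1) ^ (b * c))) =
          ((-1) ^ (b * c) * (-1) ^ (b * c)) * ((-1) ^ (a * b) * (-1) ^ (a * c)) by ring, sq,
          one_mul]
  -- The element multiplied by `Dt` has degree `finrank ℝ T₃`. Were its image under `μ` nonzero,
  -- wedging with the top form `Dt` of the kernel of `μ` could not give zero.
  by_contra hne
  refine h₃.top_mul_ne_zero hαy rfl ?_ hne key
  refine Submodule.sub_mem _ (Submodule.smul_mem _ _ (mul_mem_exteriorPower hZm τx.2 ?_))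
    (mul_mem_exteriorPower hXm τz.2 ?_)
  · rw [← hx, hR₃.finrank_eq]
  · rw [← hz, hL₃.finrank_eq]

end Trans

end Exterior

end DiffStack

end

noncomputable section

namespace DiffStack

open TopologicalSpace Module SmoothMfd Filter
open scoped ContDiff TensorProduct Topology

/-! ### Smooth maps from vector spaces to manifolds -/

/-- The map `u ↦ f (a + S u)` has the identity as derivative at `0`; its local inverse `t` gives the
section `a + S (t y)`. -/
theorem exists_smooth_section {E F : Type*} [NormedAddCommGroup E] [NormedSpace ℝ E]
    [NormedAddCommGroup F] [NormedSpace ℝ F] [CompleteSpace F] {f : E → F} {a : E}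
    (hf : ContDiffAt ℝ ∞ f a) (S : F →L[ℝ] E)
    (hS : (fderiv ℝ f a).comp S = ContinuousLinearMap.id ℝ F) :
    ∃ s : F → E, s (f a) = a ∧ ContDiffAt ℝ ∞ s (f a) ∧ HasFDerivAt s S (f a) ∧
      ∀ᶠ y in 𝓝 (f a), f (s y) = y := by
  let φ : F → F := fun u => f (a + S u)
  have h0 : a + S 0 = a := by simp
  have hin : ContDiff ℝ ∞ fun u => a + S u := contDiff_const.add S.contDiff
  have hf0 : ContDiffAt ℝ ∞ f (a + S 0) := by rwa [h0]
  have hφ : ContDiffAt ℝ ∞ φ 0 := hf0.comp (0 : F) hin.contDiffAt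
  have hd : HasFDerivAt φ ((ContinuousLinearEquiv.refl ℝ F : F ≃L[ℝ] F) : F →L[ℝ] F) 0 := by
    have h1 : HasFDerivAt f (fderiv ℝ f a) (a + S 0) := by
      rw [h0]
      exact (hf.differentiableAt (by simp)).hasFDerivAt
    have h2 : HasFDerivAt (fun u => a + S u) S 0 := S.hasFDerivAt.const_add a
    have h3 := h1.comp (0 : F) h2
    rw [hS] at h3
    exact h3
  have hs := hφ.hasStrictFDerivAt' hd (by simp)
  have hφ0 : φ 0 = f a := by simp [φ]
  let t := hs.localInverse φ _ 0
  have ht0 : t (f a) = 0 := by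
    rw [← hφ0]
    exact hs.localInverse_apply_image
  have ht : ContDiffAt ℝ ∞ t (f a) := by
    rw [← hφ0]
    exact hφ.to_localInverse hd (by simp)
  have ht' : HasFDerivAt t (ContinuousLinearMap.id ℝ F) (f a) := by
    rw [← hφ0]
    exact hs.to_localInverse.hasFDerivAt
  refine ⟨fun y => a + S (t y), by simp [ht0], contDiffAt_const.add (S.contDiff.contDiffAt.comp _ ht),
    ?_, ?_⟩
  · have := (S.hasFDerivAt.comp _ ht').const_add a
    rwa [ContinuousLinearMap.comp_id] at this
  · have := hs.eventually_right_inverse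
    rw [hφ0] at this
    exact this

/-! ### Plots, changes of charts and lifts through submersions -/

section Plots

variable {X Y : Type*} [TopologicalSpace X] [TopologicalSpace Y] [SmoothMfd X] [SmoothMfd Y]
  {P P' : Type*} [NormedAddCommGroup P] [NormedSpace ℝ P] [NormedAddCommGroup P'] [NormedSpace ℝ P']

theorem source_mem_nhds {x z : X} (hz : z ∈ (chart x).source) : (chart x).source ∈ 𝓝 z :=
  (chart x).open_source.mem_nhds hz

theorem contDiffAt_transition {x y z : X} (hx : z ∈ (chart x).source) (hy : z ∈ (chart y).source) :
    ContDiffAt ℝ ∞ (chart y ∘ (chart x).symm) (chart x z) := by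
  refine (smooth_transition x y).contDiffAt
    (((chart x).symm.trans (chart y)).open_source.mem_nhds ?_)
  rw [OpenPartialHomeomorph.trans_source]
  refine ⟨(chart x).map_source hx, ?_⟩
  rw [Set.mem_preimage, (chart x).left_inv hx]
  exact hy

/-- A map from a normed space to a manifold is `C^n` at `p`. -/
structure PlotAt (n : ℕ∞) (φ : P → X) (p : P) : Prop where
  cont : ContinuousAt φ p
  smooth : ContDiffAt ℝ n (chart (φ p) ∘ φ) p

variable {n : ℕ∞} {φ ψ : P → X} {p : P}

theorem coe_le_infty (n : ℕ∞) : (n : WithTop ℕ∞) ≤ ∞ := by exact_mod_cast le_top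

theorem chart_comp_eventuallyEq {Q : Type*} [TopologicalSpace Q] {φ : Q → X} {p : Q}
    (hφ : ContinuousAt φ p) {x y : X} (hx : φ p ∈ (chart x).source) :
    chart y ∘ φ =ᶠ[𝓝 p] (chart y ∘ (chart x).symm) ∘ (chart x ∘ φ) := by
  filter_upwards [hφ.preimage_mem_nhds (source_mem_nhds hx)] with q hq
  simp only [Function.comp_apply, (chart x).left_inv hq]

theorem contDiffAt_chart_of_chart (hφ : ContinuousAt φ p) {x y : X}
    (hx : φ p ∈ (chart x).source) (hy : φ p ∈ (chart y).source)
    (h : ContDiffAt ℝ n (chart x ∘ φ) p) : ContDiffAt ℝ n (chart y ∘ φ) p :=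
  (((contDiffAt_transition hx hy).of_le (coe_le_infty n)).comp p h).congr_of_eventuallyEq
    (chart_comp_eventuallyEq hφ hx)

namespace PlotAt

theorem of_chart (hφ : ContinuousAt φ p) {x : X} (hx : φ p ∈ (chart x).source)
    (h : ContDiffAt ℝ n (chart x ∘ φ) p) : PlotAt n φ p :=
  ⟨hφ, contDiffAt_chart_of_chart hφ hx (mem_source _) h⟩

theorem chart_comp (h : PlotAt n φ p) {y : X} (hy : φ p ∈ (chart y).source) :
    ContDiffAt ℝ n (chart y ∘ φ) p :=
  contDiffAt_chart_of_chart h.cont (mem_source _) hy h.smooth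

theorem comp (u : P' → P) {p' : P'} (h : PlotAt n φ (u p')) (hu : ContDiffAt ℝ n u p') :
    PlotAt n (fun q => φ (u q)) p' := by
  have h1 : ContDiffAt ℝ n ((chart (φ (u p')) ∘ φ) ∘ u) p' := ContDiffAt.comp p' h.smooth hu
  exact ⟨ContinuousAt.comp h.cont hu.continuousAt, h1⟩

end PlotAt

theorem plotAt_const (x : X) : PlotAt n (fun _ : P => x) p :=
  ⟨continuousAt_const, contDiffAt_const⟩

theorem plotAt_chart_symm {x : X} {v : Tan x} (hv : v ∈ (chart x).target) :
    PlotAt n (chart x).symm v := by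
  refine PlotAt.of_chart ((chart x).continuousAt_symm hv) ((chart x).map_target hv) ?_
  refine contDiffAt_id.congr_of_eventuallyEq ?_
  filter_upwards [(chart x).open_target.mem_nhds hv] with w hw
  exact (chart x).right_inv hw

theorem chart_mem_target {x z : X} (hz : z ∈ (chart x).source) : chart x z ∈ (chart x).target :=
  (chart x).map_source hz

theorem PlotAt.map (h : PlotAt n φ p) {f : X → Y} (hf : Smooth f) : PlotAt n (f ∘ φ) p := by
  refine ⟨ContinuousAt.comp hf.1.continuousAt h.cont, ?_⟩
  have h1 := ((hf.2 (φ p)).of_le (coe_le_infty n)).comp p h.smooth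
  refine h1.congr_of_eventuallyEq ?_
  filter_upwards [h.cont.preimage_mem_nhds (source_mem_nhds (mem_source (φ p)))] with q hq
  simp only [Function.comp_apply, rep, (chart (φ p)).left_inv hq]

theorem contDiffAt_rep {f : X → Y} (hf : Smooth f) {x x' : X} {y : Y}
    (hx : x' ∈ (chart x).source) (hy : f x' ∈ (chart y).source) :
    ContDiffAt ℝ ∞ (rep f x y) (chart x x') := by
  have h := (plotAt_chart_symm (n := ⊤) (chart_mem_target hx)).map hf
  refine h.chart_comp ?_
  simpa only [Function.comp_apply, (chart x).left_inv hx] using hy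

theorem smooth_id : Smooth (id : X → X) :=
  ⟨continuous_id, fun x => contDiffAt_transition (mem_source x) (mem_source x)⟩

theorem hasFDerivAt_rep {f : X → Y} (hf : Smooth f) {x x' : X} {y : Y}
    (hx : x' ∈ (chart x).source) (hy : f x' ∈ (chart y).source) :
    HasFDerivAt (rep f x y) (fderiv ℝ (rep f x y) (chart x x')) (chart x x') :=
  ((contDiffAt_rep hf hx hy).differentiableAt (by simp)).hasFDerivAt

theorem hasFDerivAt_chart_map {f : X → Y} (hf : Smooth f) (hφ : ContinuousAt φ p) {x : X} {y : Y}
    (hx : φ p ∈ (chart x).source) (hy : f (φ p) ∈ (chart y).source) {D : P →L[ℝ] Tan x}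
    (hD : HasFDerivAt (chart x ∘ φ) D p) :
    HasFDerivAt (chart y ∘ f ∘ φ) ((fderiv ℝ (rep f x y) (chart x (φ p))).comp D) p := by
  refine ((hasFDerivAt_rep hf hx hy).comp p hD).congr_of_eventuallyEq ?_
  filter_upwards [hφ.preimage_mem_nhds (source_mem_nhds hx)] with q hq
  simp only [Function.comp_apply, rep, (chart x).left_inv hq]

/-- The tangent map in the preferred charts is conjugate to the derivative in other charts. -/
theorem tmap_id_comp_tmap {f : X → Y} (hf : Smooth f) {x x' : X} {y : Y}
    (hx : x' ∈ (chart x).source) (hy : f x' ∈ (chart y).source) :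
    (tmap id (f x') y).comp (tmap f x' (f x')) =
      (fderiv ℝ (rep f x y) (chart x x')).comp (tmap id x' x) := by
  have hs := plotAt_chart_symm (n := ⊤) (chart_mem_target (mem_source x'))
  have he : (chart x').symm (chart x' x') = x' := (chart x').left_inv (mem_source x')
  have h0 : HasFDerivAt (chart x' ∘ (chart x').symm) (ContinuousLinearMap.id ℝ _)
      (chart x' x') := by
    refine (hasFDerivAt_id _).congr_of_eventuallyEq ?_
    filter_upwards [(chart x').open_target.mem_nhds (chart_mem_target (mem_source x'))] with w hw
    exact (chart x').right_inv hw
  have h1 := hasFDerivAt_chart_map hf hs.cont (y := f x') (by rw [he]; exact mem_source x')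
    (by rw [he]; exact mem_source _) h0
  have h2 := hasFDerivAt_chart_map smooth_id (hs.map hf).cont (y := y)
    (by simp only [Function.comp_apply, he]; exact mem_source _)
    (by simp only [Function.comp_apply, he]; exact hy) h1
  have h3 := hasFDerivAt_chart_map smooth_id hs.cont (y := x) (by rw [he]; exact mem_source x')
    (by rw [he]; exact hx) h0
  have h4 := hasFDerivAt_chart_map hf (φ := id ∘ (chart x').symm) hs.cont (y := y)
    (by simp only [Function.comp_apply, id, he]; exact hx)
    (by simp only [Function.comp_apply, id, he]; exact hy) h3
  -- Both sides differentiate `f` read from the chart at `x'` to the chart at `y`, once through the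
  -- chart at `f x'` and once through the chart at `x`.
  have h5 := h2.unique h4
  simp only [Function.comp_apply, id, he, ContinuousLinearMap.comp_id] at h5
  exact h5

theorem tmap_id_self (x : X) : tmap id x x = ContinuousLinearMap.id ℝ (Tan x) := by
  have h : rep id x x =ᶠ[𝓝 (chart x x)] id := by
    filter_upwards [(chart x).open_target.mem_nhds (chart_mem_target (mem_source x))] with w hw
    exact (chart x).right_inv hw
  exact h.fderiv_eq.trans fderiv_id

/-- The coordinate change of tangent vectors, from the preferred chart at `x'` to the chart
at `x`. -/
theorem rep_id_comp_tmap_id {x x' : X} (hx : x' ∈ (chart x).source) :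
    (fderiv ℝ (rep id x x') (chart x x')).comp (tmap id x' x) = ContinuousLinearMap.id ℝ _ := by
  have := tmap_id_comp_tmap (smooth_id (X := X)) hx (mem_source x' : id x' ∈ (chart x').source)
  rw [← this]
  change (tmap id x' x').comp (tmap id x' x') = _
  rw [tmap_id_self, ContinuousLinearMap.comp_id]

theorem tmap_id_comp_rep_id {x x' : X} (hx : x' ∈ (chart x).source) :
    (tmap id x' x).comp (fderiv ℝ (rep id x x') (chart x x')) = ContinuousLinearMap.id ℝ _ := by
  have hs := plotAt_chart_symm (n := ⊤) (chart_mem_target hx)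
  have he : (chart x).symm (chart x x') = x' := (chart x).left_inv hx
  have h0 : HasFDerivAt (chart x ∘ (chart x).symm) (ContinuousLinearMap.id ℝ _) (chart x x') := by
    refine (hasFDerivAt_id _).congr_of_eventuallyEq ?_
    filter_upwards [(chart x).open_target.mem_nhds (chart_mem_target hx)] with w hw
    exact (chart x).right_inv hw
  have h1 := hasFDerivAt_chart_map smooth_id hs.cont (y := x') (by rw [he]; exact hx)
    (by rw [he]; exact mem_source _) h0
  have h2 := hasFDerivAt_chart_map smooth_id (φ := id ∘ (chart x).symm) hs.cont (y := x)
    (by simp only [Function.comp_apply, id, he]; exact mem_source _)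
    (by simp only [Function.comp_apply, id, he]; exact hx) h1
  have h3 := h2.unique h0
  simp only [Function.comp_apply, id, he, ContinuousLinearMap.comp_id] at h3
  exact h3

theorem tmap_id_injective {x x' : X} (hx : x' ∈ (chart x).source) :
    Function.Injective (tmap id x' x) := fun a b hab => by
  have h : ∀ w, fderiv ℝ (rep id x x') (chart x x') (tmap id x' x w) = w := fun w =>
    congrArg (fun D => D w) (rep_id_comp_tmap_id hx)
  rw [← h a, ← h b, hab]

theorem dim_eq_of_mem_source {x x' : X} (hx : x' ∈ (chart x).source) : dim x' = dim x := by
  have h1 := (LinearEquiv.ofLinearMap (tmap id x' x).toLinearMap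
    (fderiv ℝ (rep id x x') (chart x x')).toLinearMap
    (by ext1 v; exact congrArg (fun D => D v) (tmap_id_comp_rep_id hx))
    (by ext1 v; exact congrArg (fun D => D v) (rep_id_comp_tmap_id hx))).finrank_eq
  simpa using h1

/-- Maps into the base of a submersion can be lifted, with prescribed derivative. -/
theorem IsSubmersion.exists_lift {f : X → Y} (hf : IsSubmersion f) (x : X) {φ : P → Y} {p : P}
    [CompleteSpace P] (hp : φ p = f x) (hφ : PlotAt n φ p) (V : P →L[ℝ] Tan x)
    (hV : HasFDerivAt (chart (f x) ∘ φ) ((tmap f x (f x)).comp V) p) :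
    ∃ γ : P → X, γ p = x ∧ PlotAt n γ p ∧ HasFDerivAt (chart x ∘ γ) V p ∧
      ∀ᶠ q in 𝓝 p, f (γ q) = φ q := by
  obtain ⟨S, hS⟩ := (tmap f x (f x)).exists_rightInverse_of_surjective
    (LinearMap.range_eq_top.2 (hf.2 x))
  -- Carrying the parameter along lets the section depend on `q`, which is what makes the derivative
  -- of the lift freely prescribable.
  let F : Tan x × P → Tan (f x) × P := fun v => (rep f x (f x) v.1, v.2)
  have hrep := contDiffAt_rep hf.1 (mem_source x) (mem_source (f x))
  have hF : ContDiffAt ℝ ∞ F (chart x x, p) :=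
    (hrep.comp (chart x x, p) contDiffAt_fst).prodMk contDiffAt_snd
  have hF' : fderiv ℝ F (chart x x, p) = ((tmap f x (f x)).comp
      (ContinuousLinearMap.fst ℝ _ _)).prod (ContinuousLinearMap.snd ℝ _ _) := by
    have h1 := hasFDerivAt_rep hf.1 (mem_source x) (mem_source (f x))
    have h2 : HasFDerivAt F _ (chart x x, p) :=
      (HasFDerivAt.comp (g := rep f x (f x)) (chart x x, p) h1 hasFDerivAt_fst).prodMk
        (hasFDerivAt_snd (𝕜 := ℝ) (p := (chart x x, p)))
    exact h2.fderiv
  -- With `d` the tangent map of `f`, this sends `(w, q)` to `S w + V q - S (d (V q))`. Its image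
  -- under `d` is `w`, and on `(d (V q), q)` it returns `V q`, the required derivative.
  let W : Tan (f x) × P →L[ℝ] Tan x :=
    S.comp (ContinuousLinearMap.fst ℝ _ _) +
      (V - S.comp ((tmap f x (f x)).comp V)).comp (ContinuousLinearMap.snd ℝ _ _)
  have hS' : ∀ v, tmap f x (f x) (S v) = v := fun v => congrArg (fun D => D v) hS
  obtain ⟨s, hs0, hs, hs', hsr⟩ := exists_smooth_section hF
    (W.prod (ContinuousLinearMap.snd ℝ _ _)) (by
      rw [hF']
      refine ContinuousLinearMap.ext fun v => ?_
      simp [W, hS'])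
  have hF0 : F (chart x x, p) = (chart (f x) (φ p), p) := by
    simp only [F, rep, Function.comp_apply, (chart x).left_inv (mem_source x), hp]
  rw [hF0] at hs0 hs hs' hsr
  have hu : ContDiffAt ℝ n (fun q => (chart (f x) (φ q), q)) p :=
    (hφ.chart_comp (by rw [hp]; exact mem_source _)).prodMk contDiffAt_id
  have hu' := (hV.prodMk (hasFDerivAt_id p))
  have hsu : ContDiffAt ℝ n (fun q => (s (chart (f x) (φ q), q)).1) p :=
    (ContDiffAt.comp (f := fun q => (chart (f x) (φ q), q)) p (hs.of_le (coe_le_infty n)) hu).fst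
  have hsu' : HasFDerivAt (fun q => (s (chart (f x) (φ q), q)).1) V p := by
    have h1 := (HasFDerivAt.comp (f := fun q => (chart (f x) (φ q), q)) p hs' hu').fst
    refine h1.congr_fderiv ?_
    ext1 v
    simp [W]
  have hpt : (s (chart (f x) (φ p), p)).1 = chart x x := by rw [hs0]
  have htgt : ∀ᶠ q in 𝓝 p, (s (chart (f x) (φ q), q)).1 ∈ (chart x).target :=
    hsu.continuousAt.eventually_mem
      (by rw [hpt]; exact (chart x).open_target.mem_nhds (chart_mem_target (mem_source x)))
  have hγ0 : (chart x).symm (s (chart (f x) (φ p), p)).1 = x := by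
    rw [hpt, (chart x).left_inv (mem_source x)]
  have hγ : PlotAt n (fun q => (chart x).symm (s (chart (f x) (φ q), q)).1) p :=
    PlotAt.comp (fun q => (s (chart (f x) (φ q), q)).1) (plotAt_chart_symm htgt.self_of_nhds) hsu
  refine ⟨_, hγ0, hγ, hsu'.congr_of_eventuallyEq ?_, ?_⟩
  · filter_upwards [htgt] with q hq
    simp only [Function.comp_apply, (chart x).right_inv hq]
  -- The section property only gives equality of chart values; injectivity of the chart needs both
  -- points to lie in its source.
  · have h1 : ∀ᶠ q in 𝓝 p, f ((chart x).symm (s (chart (f x) (φ q), q)).1) ∈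
        (chart (f x)).source := by
      refine (hγ.map hf.1).cont.eventually_mem ?_
      simp only [Function.comp_apply, hγ0]
      exact source_mem_nhds (mem_source _)
    have h2 : ∀ᶠ q in 𝓝 p, φ q ∈ (chart (f x)).source :=
      hφ.cont.eventually_mem (by rw [hp]; exact source_mem_nhds (mem_source _))
    filter_upwards [h1, h2, hu.continuousAt.eventually hsr] with q h1 h2 h3
    exact (chart (f x)).injOn h1 h2 (congrArg Prod.fst h3)

/-- The curve `γ` passes through `x` at time `0`, with velocity `v`. -/
structure HasVel (γ : ℝ → X) (x : X) (v : Tan x) : Prop where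
  eq : γ 0 = x
  plot : PlotAt 1 γ 0
  deriv : HasDerivAt (chart x ∘ γ) v 0

namespace HasVel

variable {γ δ : ℝ → X} {x : X} {v v' : Tan x}

/-- This is how identities between tangent maps are obtained from groupoid identities: both sides
are velocities of curves that coincide near `0`. -/
theorem unique (h : HasVel γ x v) (h' : HasVel δ x v') (he : γ =ᶠ[𝓝 0] δ) : v = v' :=
  h.deriv.unique (h'.deriv.congr_of_eventuallyEq (he.fun_comp _))

theorem const (x : X) : HasVel (fun _ => x) x 0 :=
  ⟨rfl, plotAt_const x, hasDerivAt_const _ _⟩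

theorem hasDerivAt_rep (h : HasVel γ x v) {f : X → Y} (hf : Smooth f) {y : Y}
    (hy : f x ∈ (chart y).source) :
    HasDerivAt (chart y ∘ f ∘ γ) (tmap f x y v) 0 := by
  have h1 := hasFDerivAt_chart_map hf h.plot.cont (by rw [h.eq]; exact mem_source x)
    (by rw [h.eq]; exact hy) h.deriv.hasFDerivAt
  rw [h.eq] at h1
  simpa [tmap] using h1.hasDerivAt

theorem map (h : HasVel γ x v) {f : X → Y} (hf : Smooth f) {y : Y} (hy : f x = y) :
    HasVel (f ∘ γ) y (tmap f x y v) := by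
  subst hy
  exact ⟨congrArg f h.eq, h.plot.map hf, h.hasDerivAt_rep hf (mem_source _)⟩

theorem hasDerivAt_chart (h : HasVel γ x v) {x₀ : X} (hx : x ∈ (chart x₀).source) :
    HasDerivAt (chart x₀ ∘ γ) (tmap id x x₀ v) 0 :=
  h.hasDerivAt_rep smooth_id hx

end HasVel

theorem IsSubmersion.exists_vel_lift {f : X → Y} (hf : IsSubmersion f) {x : X} {y : Y}
    (hy : f x = y) {v : Tan x} {β : ℝ → Y} (hβ : HasVel β y (tmap f x y v)) :
    ∃ γ : ℝ → X, HasVel γ x v ∧ f ∘ γ =ᶠ[𝓝 0] β := by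
  subst hy
  obtain ⟨γ, h0, h1, h2, h3⟩ := hf.exists_lift x hβ.eq hβ.plot
    (ContinuousLinearMap.toSpanSingleton ℝ v) (by
      refine hβ.deriv.hasFDerivAt.congr_fderiv ?_
      ext
      simp)
  refine ⟨γ, ⟨h0, h1, ?_⟩, h3⟩
  simpa using h2.hasDerivAt

theorem exists_vel (x : X) (v : Tan x) : ∃ γ : ℝ → X, HasVel γ x v := by
  have hu : ContDiff ℝ 1 fun t : ℝ => chart x x + t • v :=
    contDiff_const.add (contDiff_id.smul contDiff_const)
  have h0 : chart x x + (0 : ℝ) • v = chart x x := by simp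
  have ht : chart x x + (0 : ℝ) • v ∈ (chart x).target := by
    rw [h0]
    exact chart_mem_target (mem_source x)
  refine ⟨fun t => (chart x).symm (chart x x + t • v), ?_,
    PlotAt.comp (fun t : ℝ => chart x x + t • v) (plotAt_chart_symm ht) hu.contDiffAt, ?_⟩
  · rw [h0, (chart x).left_inv (mem_source x)]
  · have h1 : HasDerivAt (fun t : ℝ => chart x x + t • v) v 0 := by
      simpa using ((hasDerivAt_id (0 : ℝ)).smul_const v).const_add (chart x x)
    refine h1.congr_of_eventuallyEq ?_
    filter_upwards [hu.continuous.continuousAt.eventually_mem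
      ((chart x).open_target.mem_nhds ht)] with t ht
    exact (chart x).right_inv ht

end Plots

end DiffStack

end

noncomputable section

namespace DiffStack

open TopologicalSpace Module SmoothMfd Filter
open scoped ContDiff TensorProduct Topology

/-! ### Tangent maps of the structure maps of a Lie groupoid -/

/-! ### Groupoid identities for the total multiplication -/

namespace Grpd

variable {G G₀ : Type*} (𝒢 : Grpd G G₀)

open Classical in
/-- The multiplication, extended by a junk value to the pairs that are not composable. -/
def m (g h : G) : G := if hc : 𝒢.r g = 𝒢.l h then 𝒢.mul g h hc else g

variable {𝒢} {g h k : G}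

theorem m_eq (hc : 𝒢.r g = 𝒢.l h) : 𝒢.m g h = 𝒢.mul g h hc := dif_pos hc

theorem l_m (hc : 𝒢.r g = 𝒢.l h) : 𝒢.l (𝒢.m g h) = 𝒢.l g := by rw [m_eq hc, 𝒢.l_mul]

theorem r_m (hc : 𝒢.r g = 𝒢.l h) : 𝒢.r (𝒢.m g h) = 𝒢.r h := by rw [m_eq hc, 𝒢.r_mul]

theorem m_assoc (h₁ : 𝒢.r g = 𝒢.l h) (h₂ : 𝒢.r h = 𝒢.l k) :
    𝒢.m (𝒢.m g h) k = 𝒢.m g (𝒢.m h k) := by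
  rw [m_eq h₁, m_eq h₂, m_eq ((𝒢.r_mul g h h₁).trans h₂),
    m_eq (h₁.trans (𝒢.l_mul h k h₂).symm), 𝒢.assoc]

theorem one_m (g : G) : 𝒢.m (𝒢.one (𝒢.l g)) g = g := by rw [m_eq (𝒢.r_one _), 𝒢.one_mul]

theorem m_one (g : G) : 𝒢.m g (𝒢.one (𝒢.r g)) = g := by rw [m_eq (𝒢.l_one _).symm, 𝒢.mul_one]

theorem inv_m (g : G) : 𝒢.m (𝒢.inv g) g = 𝒢.one (𝒢.r g) := by
  rw [m_eq (𝒢.r_inv g), 𝒢.inv_mul]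

theorem m_inv (g : G) : 𝒢.m g (𝒢.inv g) = 𝒢.one (𝒢.l g) := by
  rw [m_eq (𝒢.l_inv g).symm, 𝒢.mul_inv]

theorem m_m_inv (hc : 𝒢.r g = 𝒢.l h) : 𝒢.m (𝒢.m g h) (𝒢.inv h) = g := by
  rw [m_assoc hc (𝒢.l_inv h).symm, m_inv, ← hc, m_one]

theorem m_inv_m (hc : 𝒢.r g = 𝒢.r h) : 𝒢.m (𝒢.m g (𝒢.inv h)) h = g := by
  rw [m_assoc (hc.trans (𝒢.l_inv h).symm) (𝒢.r_inv h), inv_m, ← hc, m_one]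

theorem inv_m_m (hc : 𝒢.r g = 𝒢.l h) : 𝒢.m (𝒢.inv g) (𝒢.m g h) = h := by
  rw [← m_assoc (𝒢.r_inv g) hc, inv_m, hc, one_m]

theorem m_inv_m' (hc : 𝒢.l g = 𝒢.l h) : 𝒢.m g (𝒢.m (𝒢.inv g) h) = h := by
  rw [← m_assoc (𝒢.l_inv g).symm ((𝒢.r_inv g).trans hc), m_inv, hc, one_m]

theorem inv_inv (g : G) : 𝒢.inv (𝒢.inv g) = g := by
  have h2 := m_m_inv (𝒢 := 𝒢) (g := g) (h := 𝒢.inv g) (𝒢.l_inv g).symm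
  have h3 := one_m (𝒢 := 𝒢) (𝒢.inv (𝒢.inv g))
  rw [𝒢.l_inv, 𝒢.r_inv] at h3
  rw [m_inv] at h2
  exact h3.symm.trans h2

theorem inv_one (x : G₀) : 𝒢.inv (𝒢.one x) = 𝒢.one x := by
  have h1 := m_inv (𝒢 := 𝒢) (𝒢.one x)
  have h2 := one_m (𝒢 := 𝒢) (𝒢.inv (𝒢.one x))
  rw [𝒢.l_inv, 𝒢.r_one] at h2
  rw [h2, 𝒢.l_one] at h1
  exact h1

end Grpd

namespace LieGroupoid

open Grpd

variable {G G₀ : Type*} [TopologicalSpace G] [TopologicalSpace G₀] [SmoothMfd G] [SmoothMfd G₀]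
  {𝒢 : LieGroupoid G G₀} {P : Type*} [NormedAddCommGroup P] [NormedSpace ℝ P]

/-- The product of two composable plots, and its derivative. -/
theorem plotAt_mul {n : ℕ∞} {φ ψ : P → G} {p : P} (hφ : PlotAt n φ p)
    (hψ : PlotAt n ψ p) (hc : ∀ᶠ q in 𝓝 p, 𝒢.r (φ q) = 𝒢.l (ψ q)) :
    PlotAt n (fun q => 𝒢.m (φ q) (ψ q)) p ∧
      ∀ (D : P →L[ℝ] Tan (φ p)) (E : P →L[ℝ] Tan (ψ p)),
        HasFDerivAt (chart (φ p) ∘ φ) D p → HasFDerivAt (chart (ψ p) ∘ ψ) E p →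
        HasFDerivAt (chart (𝒢.m (φ p) (ψ p)) ∘ fun q => 𝒢.m (φ q) (ψ q))
          ((𝒢.tmul (φ p) (ψ p) (𝒢.m (φ p) (ψ p))).comp (D.prod E)) p := by
  have hcp := hc.self_of_nhds
  let u : P → Tan (φ p) × Tan (ψ p) := fun q => (chart (φ p) (φ q), chart (ψ p) (ψ q))
  have hu : ContDiffAt ℝ n u p := hφ.smooth.prodMk hψ.smooth
  have hsrc : ∀ᶠ q in 𝓝 p, φ q ∈ (chart (φ p)).source ∧ ψ q ∈ (chart (ψ p)).source :=
    (hφ.cont.eventually_mem (source_mem_nhds (mem_source _))).and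
      (hψ.cont.eventually_mem (source_mem_nhds (mem_source _)))
  -- Near `p` the pair of plots stays in the composable pairs, so derivatives within that set become
  -- ordinary derivatives after composition with `u`.
  have hmem : u ⁻¹' 𝒢.compSet (φ p) (ψ p) ∈ 𝓝 p := by
    filter_upwards [hsrc, hc] with q hq hq'
    refine ⟨chart_mem_target hq.1, chart_mem_target hq.2, ?_⟩
    rw [(chart (φ p)).left_inv hq.1, (chart (ψ p)).left_inv hq.2]
    exact hq'
  have heq : (chart (𝒢.m (φ p) (ψ p)) ∘ fun q => 𝒢.m (φ q) (ψ q)) =ᶠ[𝓝 p]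
      𝒢.mulRep (φ p) (ψ p) (𝒢.m (φ p) (ψ p)) ∘ u := by
    filter_upwards [hsrc, hc] with q hq hq'
    have e1 := (chart (φ p)).left_inv hq.1
    have e2 := (chart (ψ p)).left_inv hq.2
    simp only [Function.comp_apply, u, mulRep]
    rw [dif_pos (by rw [e1, e2]; exact hq')]
    simp only [e1, e2, m_eq hq']
  have hs : ContDiffWithinAt ℝ ∞ (𝒢.mulRep (φ p) (ψ p) (𝒢.m (φ p) (ψ p)))
      (𝒢.compSet (φ p) (ψ p)) (u p) := by
    have := 𝒢.smooth_mul (φ p) (ψ p) hcp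
    rwa [← m_eq hcp] at this
  refine ⟨⟨?_, ?_⟩, fun D E hD hE => ?_⟩
  · have h1 : ContinuousOn (fun v : G × G => 𝒢.m v.1 v.2) {v | 𝒢.r v.1 = 𝒢.l v.2} := by
      rw [continuousOn_iff_continuous_domRestrict]
      exact 𝒢.continuous_mul.congr fun v => (m_eq v.2).symm
    have h2 : Tendsto (fun q => (φ q, ψ q)) (𝓝 p)
        (𝓝[{v : G × G | 𝒢.r v.1 = 𝒢.l v.2}] (φ p, ψ p)) :=
      tendsto_nhdsWithin_iff.2 ⟨hφ.cont.prodMk hψ.cont, hc⟩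
    exact (h1 (φ p, ψ p) hcp).tendsto.comp h2
  · refine ContDiffAt.congr_of_eventuallyEq ?_ heq
    have h1 := (hs.of_le (coe_le_infty n)).comp p (hu.contDiffWithinAt (s := u ⁻¹'
      𝒢.compSet (φ p) (ψ p))) (fun _ hq => hq)
    exact h1.contDiffAt hmem
  · refine HasFDerivAt.congr_of_eventuallyEq ?_ heq
    have h1 : HasFDerivWithinAt _ (𝒢.tmul (φ p) (ψ p) (𝒢.m (φ p) (ψ p))) _ (u p) :=
      (hs.differentiableWithinAt (by simp)).hasFDerivWithinAt
    have h2 := h1.comp p ((hD.prodMk hE).hasFDerivWithinAt (s := u ⁻¹'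
      𝒢.compSet (φ p) (ψ p))) (fun _ hq => hq)
    exact h2.hasFDerivAt hmem

/-- A derivative within the composable pairs need not be unique as a linear map on `Tan g × Tan h`,
but on velocities of composable curves its value is forced. The pointwise identities for `tmul`
below are read off from this. -/
theorem hasVel_mul {γ δ : ℝ → G} {g h p : G} {u : Tan g} {v : Tan h} (hγ : HasVel γ g u)
    (hδ : HasVel δ h v) (hc : ∀ᶠ t in 𝓝 0, 𝒢.r (γ t) = 𝒢.l (δ t)) (hp : 𝒢.m g h = p) :
    HasVel (fun t => 𝒢.m (γ t) (δ t)) p (𝒢.tmul g h p (u, v)) := by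
  obtain ⟨rfl, hγ1, hγ2⟩ := hγ
  obtain ⟨rfl, hδ1, hδ2⟩ := hδ
  subst hp
  obtain ⟨h1, h2⟩ := plotAt_mul hγ1 hδ1 hc
  refine ⟨rfl, h1, ?_⟩
  simpa using (h2 _ _ hγ2.hasFDerivAt hδ2.hasFDerivAt).hasDerivAt

variable (𝒢) in
/-- `rightTrans`, with the left end of the arrow as a separate argument. -/
def rt (g : G) (z : G₀) : 𝒢.A z →ₗ[ℝ] Tan g :=
  (𝒢.tmul (𝒢.one z) g g).toLinearMap ∘ₗ LinearMap.inl ℝ _ _ ∘ₗ (𝒢.A z).subtype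

variable (𝒢) in
/-- `leftTrans`, with the right end of the arrow as a separate argument. -/
def lt (g : G) (x : G₀) : 𝒢.A x →ₗ[ℝ] Tan g :=
  (𝒢.tmul g (𝒢.one x) g).toLinearMap ∘ₗ LinearMap.inr ℝ _ _ ∘ₗ
    (tmap 𝒢.inv (𝒢.one x) (𝒢.one x)).toLinearMap ∘ₗ (𝒢.A x).subtype

/-- A constant curve in the base lifts through the submersion `r` with any velocity killed by its
tangent map. -/
theorem exists_vel_A {x : G₀} (a : 𝒢.A x) :
    ∃ γ : ℝ → G, HasVel γ (𝒢.one x) (a : Tan (𝒢.one x)) ∧ ∀ᶠ t in 𝓝 0, 𝒢.r (γ t) = x := by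
  have ha : tmap 𝒢.r (𝒢.one x) x (a : Tan (𝒢.one x)) = 0 := a.2
  exact 𝒢.submersion_r.exists_vel_lift (𝒢.r_one x) (β := fun _ => x) (by
    rw [ha]
    exact HasVel.const x)

theorem hasVel_rt {g : G} {z : G₀} (hz : 𝒢.l g = z) {a : 𝒢.A z} {γ : ℝ → G}
    (hγ : HasVel γ (𝒢.one z) (a : Tan (𝒢.one z))) (hr : ∀ᶠ t in 𝓝 0, 𝒢.r (γ t) = z) :
    HasVel (fun t => 𝒢.m (γ t) g) g (𝒢.rt g z a) := by
  subst hz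
  exact hasVel_mul hγ (HasVel.const g) hr (one_m g)

theorem hasVel_lt {g : G} {x : G₀} (hx : 𝒢.r g = x) {a : 𝒢.A x} {γ : ℝ → G}
    (hγ : HasVel γ (𝒢.one x) (a : Tan (𝒢.one x))) (hr : ∀ᶠ t in 𝓝 0, 𝒢.r (γ t) = x) :
    HasVel (fun t => 𝒢.m g (𝒢.inv (γ t))) g (𝒢.lt g x a) := by
  subst hx
  refine hasVel_mul (HasVel.const g) (hγ.map 𝒢.smooth_inv (inv_one _)) ?_ (m_one g)
  filter_upwards [hr] with t ht
  simp only [𝒢.l_inv, ht]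

/-- Right translation by `g⁻¹` undoes right translation by `g`; this gives the injectivity of `rt`.
-/
theorem tmul_rt {g : G} {z : G₀} (hz : 𝒢.l g = z) (a : 𝒢.A z) :
    𝒢.tmul g (𝒢.inv g) (𝒢.one z) (𝒢.rt g z a, 0) = a := by
  obtain ⟨γ, hγ, hr⟩ := exists_vel_A a
  have h1 := hasVel_rt hz hγ hr
  have h2 : ∀ᶠ t in 𝓝 0, 𝒢.r (γ t) = 𝒢.l g := hr.mono fun t ht => ht.trans hz.symm
  refine (hasVel_mul h1 (HasVel.const (𝒢.inv g)) ?_ (by rw [m_inv, hz])).unique hγ ?_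
  · filter_upwards [h2] with t ht
    rw [r_m ht, 𝒢.l_inv]
  · filter_upwards [h2] with t ht
    rw [m_m_inv ht]

/-- Along curves, `g⁻¹ · (g k⁻¹) = k⁻¹`, whose inverse is `k`. -/
theorem tmap_inv_tmul_lt {g : G} {x : G₀} (hx : 𝒢.r g = x) (a : 𝒢.A x) :
    tmap 𝒢.inv (𝒢.one x) (𝒢.one x) (𝒢.tmul (𝒢.inv g) g (𝒢.one x) (0, 𝒢.lt g x a)) = a := by
  obtain ⟨γ, hγ, hr⟩ := exists_vel_A a
  have h1 := hasVel_lt hx hγ hr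
  have h2 : ∀ᶠ t in 𝓝 0, 𝒢.r g = 𝒢.l (𝒢.inv (γ t)) :=
    hr.mono fun t ht => by rw [𝒢.l_inv, ht, hx]
  refine ((hasVel_mul (HasVel.const (𝒢.inv g)) h1 ?_ (by rw [inv_m, hx])).map 𝒢.smooth_inv
    (inv_one x)).unique hγ ?_
  · filter_upwards [h2] with t ht
    rw [l_m ht, 𝒢.r_inv]
  · filter_upwards [h2] with t ht
    simp only [Function.comp_apply]
    rw [inv_m_m ht, inv_inv]

theorem shortExact_rt {g : G} {z x : G₀} (hz : 𝒢.l g = z) (hx : 𝒢.r g = x) :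
    ShortExact (𝒢.rt g z) (tmap 𝒢.r g x).toLinearMap := by
  refine ⟨?_, ?_, le_antisymm ?_ ?_⟩
  · refine (injective_iff_map_eq_zero _).2 fun a ha => ?_
    have := tmul_rt hz a
    rw [ha, ← Prod.zero_eq_mk, map_zero] at this
    exact Subtype.ext this.symm
  · subst hx
    exact 𝒢.submersion_r.2 g
  · rintro _ ⟨a, rfl⟩
    obtain ⟨γ, hγ, hr⟩ := exists_vel_A a
    have h1 := hasVel_rt hz hγ hr
    refine (h1.map 𝒢.submersion_r.1 hx).unique (HasVel.const x) ?_
    filter_upwards [hr] with t ht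
    simp only [Function.comp_apply]
    rw [r_m (ht.trans hz.symm), hx]
  -- A vector killed by `T r` is the velocity of a curve in the `r`-fibre of `g`; translating that
  -- curve by `g⁻¹` to the unit gives the preimage in `A`.
  · intro v hv
    have hv' : tmap 𝒢.r g x v = 0 := hv
    obtain ⟨φ, hφ, hr⟩ := 𝒢.submersion_r.exists_vel_lift hx (β := fun _ => x) (v := v) (by
      rw [hv']
      exact HasVel.const x)
    have hr' : ∀ᶠ t in 𝓝 0, 𝒢.r (φ t) = 𝒢.r g := hr.mono fun t ht => ht.trans hx.symm
    have h1 := hasVel_mul hφ (HasVel.const (𝒢.inv g)) (p := 𝒢.one z)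
      (hr'.mono fun t ht => ht.trans (𝒢.l_inv g).symm) (by rw [m_inv, hz])
    have hr1 : ∀ᶠ t in 𝓝 0, 𝒢.r (𝒢.m (φ t) (𝒢.inv g)) = z := by
      filter_upwards [hr'] with t ht
      rw [r_m (ht.trans (𝒢.l_inv g).symm), 𝒢.r_inv, hz]
    have ha : 𝒢.tmul g (𝒢.inv g) (𝒢.one z) (v, 0) ∈ 𝒢.A z :=
      (h1.map 𝒢.submersion_r.1 (𝒢.r_one z)).unique (HasVel.const z) hr1
    refine ⟨⟨_, ha⟩, (hasVel_rt hz (a := ⟨_, ha⟩) h1 hr1).unique hφ ?_⟩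
    filter_upwards [hr'] with t ht
    rw [m_inv_m ht]

theorem shortExact_lt {g : G} {z x : G₀} (hz : 𝒢.l g = z) (hx : 𝒢.r g = x) :
    ShortExact (𝒢.lt g x) (tmap 𝒢.l g z).toLinearMap := by
  refine ⟨?_, ?_, le_antisymm ?_ ?_⟩
  · refine (injective_iff_map_eq_zero _).2 fun a ha => ?_
    have := tmap_inv_tmul_lt hx a
    rw [ha, ← Prod.zero_eq_mk, map_zero, map_zero] at this
    exact Subtype.ext this.symm
  · subst hz
    exact 𝒢.submersion_l.2 g
  · rintro _ ⟨a, rfl⟩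
    obtain ⟨γ, hγ, hr⟩ := exists_vel_A a
    have h1 := hasVel_lt hx hγ hr
    refine (h1.map 𝒢.submersion_l.1 hz).unique (HasVel.const z) ?_
    filter_upwards [hr] with t ht
    simp only [Function.comp_apply]
    rw [l_m (by rw [𝒢.l_inv, ht, hx]), hz]
  -- Here a curve `φ` in the `l`-fibre of `g` is written as `g k⁻¹` with `k = (g⁻¹ φ)⁻¹`, a curve in
  -- the `r`-fibre through the unit.
  · intro v hv
    have hv' : tmap 𝒢.l g z v = 0 := hv
    obtain ⟨φ, hφ, hl⟩ := 𝒢.submersion_l.exists_vel_lift hz (β := fun _ => z) (v := v) (by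
      rw [hv']
      exact HasVel.const z)
    have hl' : ∀ᶠ t in 𝓝 0, 𝒢.l g = 𝒢.l (φ t) := hl.mono fun t ht => hz.trans ht.symm
    have h1 := (hasVel_mul (HasVel.const (𝒢.inv g)) hφ (p := 𝒢.one x)
      (hl'.mono fun t ht => (𝒢.r_inv g).trans ht) (by rw [inv_m, hx])).map 𝒢.smooth_inv (inv_one x)
    have hr1 : ∀ᶠ t in 𝓝 0, 𝒢.r (𝒢.inv (𝒢.m (𝒢.inv g) (φ t))) = x := by
      filter_upwards [hl'] with t ht
      rw [𝒢.r_inv, l_m ((𝒢.r_inv g).trans ht), 𝒢.l_inv, hx]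
    have ha : tmap 𝒢.inv (𝒢.one x) (𝒢.one x) (𝒢.tmul (𝒢.inv g) g (𝒢.one x) (0, v)) ∈ 𝒢.A x :=
      (h1.map 𝒢.submersion_r.1 (𝒢.r_one x)).unique (HasVel.const x) hr1
    refine ⟨⟨_, ha⟩, (hasVel_lt hx (a := ⟨_, ha⟩) h1 hr1).unique hφ ?_⟩
    filter_upwards [hl'] with t ht
    simp only [Function.comp_apply]
    rw [inv_inv, m_inv_m' ht]

variable (𝒢) in
/-- The tangent space to the manifold of composable pairs at `(g, h)`, where `r g = l h = y`. -/
def compTan (g h : G) (y : G₀) : Submodule ℝ (Tan g × Tan h) :=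
  LinearMap.ker ((tmap 𝒢.r g y).toLinearMap ∘ₗ LinearMap.fst ℝ _ _ -
    (tmap 𝒢.l h y).toLinearMap ∘ₗ LinearMap.snd ℝ _ _)

theorem mem_compTan {g h : G} {y : G₀} {v : Tan g × Tan h} :
    v ∈ 𝒢.compTan g h y ↔ tmap 𝒢.r g y v.1 = tmap 𝒢.l h y v.2 := by
  simp [compTan, sub_eq_zero]

/-! ### The tangent map of the multiplication at a composable pair -/

section Mul

variable {g h p : G} {z y x : G₀}

/-- The first curve is free; the second is a lift through the submersion `l` of its image under `r`.
-/
theorem exists_vel_comp (hg : 𝒢.r g = y) (hh : 𝒢.l h = y) {v : Tan g × Tan h}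
    (hv : v ∈ 𝒢.compTan g h y) : ∃ γ δ : ℝ → G, HasVel γ g v.1 ∧ HasVel δ h v.2 ∧
      ∀ᶠ t in 𝓝 0, 𝒢.r (γ t) = 𝒢.l (δ t) := by
  obtain ⟨γ, hγ⟩ := exists_vel g v.1
  have h1 := hγ.map 𝒢.submersion_r.1 hg
  rw [mem_compTan.1 hv] at h1
  obtain ⟨δ, hδ, hδ'⟩ := 𝒢.submersion_l.exists_vel_lift hh h1
  exact ⟨γ, δ, hγ, hδ, hδ'.mono fun t ht => ht.symm⟩

theorem tmap_l_tmul (hz : 𝒢.l g = z) (hg : 𝒢.r g = y) (hh : 𝒢.l h = y) (hp : 𝒢.m g h = p)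
    {v : Tan g × Tan h} (hv : v ∈ 𝒢.compTan g h y) :
    tmap 𝒢.l p z (𝒢.tmul g h p v) = tmap 𝒢.l g z v.1 := by
  obtain ⟨γ, δ, hγ, hδ, hc⟩ := exists_vel_comp hg hh hv
  have hpz : 𝒢.l p = z := by rw [← hp, l_m (hg.trans hh.symm), hz]
  refine ((hasVel_mul hγ hδ hc hp).map 𝒢.submersion_l.1 hpz).unique
    (hγ.map 𝒢.submersion_l.1 hz) ?_
  filter_upwards [hc] with t ht
  exact l_m ht

theorem tmap_r_tmul (hg : 𝒢.r g = y) (hh : 𝒢.l h = y) (hx : 𝒢.r h = x) (hp : 𝒢.m g h = p)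
    {v : Tan g × Tan h} (hv : v ∈ 𝒢.compTan g h y) :
    tmap 𝒢.r p x (𝒢.tmul g h p v) = tmap 𝒢.r h x v.2 := by
  obtain ⟨γ, δ, hγ, hδ, hc⟩ := exists_vel_comp hg hh hv
  have hpx : 𝒢.r p = x := by rw [← hp, r_m (hg.trans hh.symm), hx]
  refine ((hasVel_mul hγ hδ hc hp).map 𝒢.submersion_r.1 hpx).unique
    (hδ.map 𝒢.submersion_r.1 hx) ?_
  filter_upwards [hc] with t ht
  exact r_m ht

theorem tmul_rt_zero (hz : 𝒢.l g = z) (hg : 𝒢.r g = y) (hh : 𝒢.l h = y) (hp : 𝒢.m g h = p)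
    (a : 𝒢.A z) : 𝒢.tmul g h p (𝒢.rt g z a, 0) = 𝒢.rt p z a := by
  obtain ⟨γ, hγ, hr⟩ := exists_vel_A a
  have hgh : 𝒢.r g = 𝒢.l h := hg.trans hh.symm
  have hr' : ∀ᶠ t in 𝓝 0, 𝒢.r (γ t) = 𝒢.l g := hr.mono fun t ht => ht.trans hz.symm
  refine (hasVel_mul (hasVel_rt hz hγ hr) (HasVel.const h) ?_ hp).unique
    (hasVel_rt (by rw [← hp, l_m hgh, hz]) hγ hr) ?_
  · filter_upwards [hr'] with t ht
    rw [r_m ht, hgh]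
  · filter_upwards [hr'] with t ht
    rw [m_assoc ht hgh, hp]

theorem tmul_zero_lt (hg : 𝒢.r g = y) (hh : 𝒢.l h = y) (hx : 𝒢.r h = x) (hp : 𝒢.m g h = p)
    (a : 𝒢.A x) : 𝒢.tmul g h p (0, 𝒢.lt h x a) = 𝒢.lt p x a := by
  obtain ⟨γ, hγ, hr⟩ := exists_vel_A a
  have hgh : 𝒢.r g = 𝒢.l h := hg.trans hh.symm
  have hr' : ∀ᶠ t in 𝓝 0, 𝒢.r h = 𝒢.l (𝒢.inv (γ t)) :=
    hr.mono fun t ht => by rw [𝒢.l_inv, ht, hx]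
  refine (hasVel_mul (HasVel.const g) (hasVel_lt hx hγ hr) ?_ hp).unique
    (hasVel_lt (by rw [← hp, r_m hgh, hx]) hγ hr) ?_
  · filter_upwards [hr'] with t ht
    rw [l_m ht, hgh]
  · filter_upwards [hr'] with t ht
    rw [← m_assoc hgh ht, hp]

/-- For a curve `k` in the `r`-fibre of `y`, the arrows `g k⁻¹` and `k h` are composable: both
middle ends are `l k`. -/
theorem diag_mem_compTan (hg : 𝒢.r g = y) (hh : 𝒢.l h = y) (a : 𝒢.A y) :
    (𝒢.lt g y a, 𝒢.rt h y a) ∈ 𝒢.compTan g h y := by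
  obtain ⟨γ, hγ, hr⟩ := exists_vel_A a
  have h1 := hasVel_lt hg hγ hr
  have h2 := hasVel_rt hh hγ hr
  refine mem_compTan.2 ((h1.map 𝒢.submersion_r.1 hg).unique (h2.map 𝒢.submersion_l.1 hh) ?_)
  filter_upwards [hr] with t ht
  simp only [Function.comp_apply]
  rw [r_m (by rw [𝒢.l_inv, ht, hg]), l_m (ht.trans hh.symm), 𝒢.r_inv]

/-- The product `(g k⁻¹)(k h) = g h` does not move with `k`. This antidiagonal copy of `A_y` is the
kernel of the tangent multiplication. -/
theorem tmul_diag (hg : 𝒢.r g = y) (hh : 𝒢.l h = y) (hp : 𝒢.m g h = p) (a : 𝒢.A y) :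
    𝒢.tmul g h p (𝒢.lt g y a, 𝒢.rt h y a) = 0 := by
  obtain ⟨γ, hγ, hr⟩ := exists_vel_A a
  have h1 := hasVel_lt hg hγ hr
  have h2 := hasVel_rt hh hγ hr
  have hr1 : ∀ᶠ t in 𝓝 0, 𝒢.r g = 𝒢.l (𝒢.inv (γ t)) :=
    hr.mono fun t ht => by rw [𝒢.l_inv, ht, hg]
  have hr2 : ∀ᶠ t in 𝓝 0, 𝒢.r (γ t) = 𝒢.l h := hr.mono fun t ht => ht.trans hh.symm
  refine (hasVel_mul h1 h2 ?_ hp).unique (HasVel.const p) ?_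
  · filter_upwards [hr1, hr2] with t ht ht'
    rw [r_m ht, l_m ht', 𝒢.r_inv]
  · filter_upwards [hr1, hr2] with t ht ht'
    rw [m_assoc ht (by rw [l_m ht', 𝒢.r_inv]), inv_m_m ht', hp]

end Mul

variable (𝒢) in
/-- The relation `Corresponds`, with the ends of the arrow as separate arguments. -/
def Corr (g : G) (z x : G₀) (q : 𝒢.Q z) (q' : 𝒢.Q x) : Prop :=
  Balanced ((-1) ^ (finrank ℝ (𝒢.A z) * finrank ℝ (𝒢.A x))) (𝒢.rt g z)
    (tmap 𝒢.r g x).toLinearMap (𝒢.lt g x) (tmap 𝒢.l g z).toLinearMap q q'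

theorem finrank_euc (x : G₀) : finrank ℝ (Tan x) = dim x := finrank_euclideanSpace_fin

/-! ### The isomorphisms `j_g` and their multiplicativity -/

namespace Corr

variable {g h p : G} {z y x : G₀} {q : 𝒢.Q z} {q' : 𝒢.Q y} {q'' : 𝒢.Q x}

theorem exists_right (hz : 𝒢.l g = z) (hy : 𝒢.r g = y) (q : 𝒢.Q z) :
    ∃ q' : 𝒢.Q y, 𝒢.Corr g z y q q' :=
  Balanced.exists_right (shortExact_rt hz hy) (shortExact_lt hz hy) (finrank_euc y)
    (finrank_euc z) q

theorem right_unique (hz : 𝒢.l g = z) (hy : 𝒢.r g = y) {q₁ q₂ : 𝒢.Q y} (h₁ : 𝒢.Corr g z y q q₁)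
    (h₂ : 𝒢.Corr g z y q q₂) : q₁ = q₂ :=
  Balanced.right_unique (shortExact_rt hz hy) (shortExact_lt hz hy) (finrank_euc y)
    (finrank_euc z) h₁ h₂

/-- The tangent space `K` of composable pairs projects onto `T_g G` and `T_h G` and is mapped onto
`T_p G` by multiplication. The kernels are `A_x` (moving `h` alone), `A_z` (moving `g` alone) and
the antidiagonal `A_y`, the configuration of `Balanced.trans`. -/
theorem trans (hz : 𝒢.l g = z) (hg : 𝒢.r g = y) (hh : 𝒢.l h = y) (hx : 𝒢.r h = x)
    (hp : 𝒢.m g h = p) (h₁ : 𝒢.Corr g z y q q') (h₂ : 𝒢.Corr h y x q' q'') :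
    𝒢.Corr p z x q q'' := by
  have hgh : 𝒢.r g = 𝒢.l h := hg.trans hh.symm
  have hpz : 𝒢.l p = z := by rw [← hp, l_m hgh, hz]
  have hpx : 𝒢.r p = x := by rw [← hp, r_m hgh, hx]
  have sR₁ := shortExact_rt hz hg
  have sL₁ := shortExact_lt hz hg
  have sR₂ := shortExact_rt hh hx
  have sL₂ := shortExact_lt hh hx
  have sR₃ := shortExact_rt hpz hpx
  have sL₃ := shortExact_lt hpz hpx
  have kR : ∀ a, tmap 𝒢.r g y (𝒢.rt g z a) = 0 := sR₁.apply_apply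
  have kL : ∀ a, tmap 𝒢.l h y (𝒢.lt h x a) = 0 := sL₂.apply_apply
  let K := 𝒢.compTan g h y
  let π₁ : K →ₗ[ℝ] Tan g := LinearMap.fst ℝ _ _ ∘ₗ K.subtype
  let π₂ : K →ₗ[ℝ] Tan h := LinearMap.snd ℝ _ _ ∘ₗ K.subtype
  let μ : K →ₗ[ℝ] Tan p := (𝒢.tmul g h p).toLinearMap ∘ₗ K.subtype
  let jR : 𝒢.A z →ₗ[ℝ] K := (LinearMap.inl ℝ _ _ ∘ₗ 𝒢.rt g z).codRestrict K fun a =>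
    mem_compTan.2 (by simp [kR])
  let jL : 𝒢.A x →ₗ[ℝ] K := (LinearMap.inr ℝ _ _ ∘ₗ 𝒢.lt h x).codRestrict K fun a =>
    mem_compTan.2 (by simp [kL])
  let D : 𝒢.A y →ₗ[ℝ] K := ((𝒢.lt g y).prod (𝒢.rt h y)).codRestrict K fun a =>
    diag_mem_compTan hg hh a
  have eR₃ : μ ∘ₗ jR = 𝒢.rt p z := LinearMap.ext fun a => tmul_rt_zero hz hg hh hp a
  have eL₃ : μ ∘ₗ jL = 𝒢.lt p x := LinearMap.ext fun a => tmul_zero_lt hg hh hx hp a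
  have eD : ∀ a, μ (D a) = 0 := fun a => tmul_diag hg hh hp a
  have s₁ : ShortExact jL π₁ := by
    refine ⟨fun a b hab => sL₂.inj (congrArg (fun v : K => v.1.2) hab), fun u => ?_,
      le_antisymm ?_ ?_⟩
    · obtain ⟨v, hv⟩ := sL₂.surj (tmap 𝒢.r g y u)
      exact ⟨⟨(u, v), mem_compTan.2 hv.symm⟩, rfl⟩
    · rintro _ ⟨a, rfl⟩
      rfl
    · rintro ⟨⟨u, v⟩, huv⟩ hu
      have hu' : u = 0 := hu
      subst hu'
      have hv : v ∈ LinearMap.ker (tmap 𝒢.l h y).toLinearMap := by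
        have := mem_compTan.1 huv
        simp only [map_zero] at this
        exact this.symm
      rw [← sL₂.exact] at hv
      obtain ⟨a, rfl⟩ := hv
      exact ⟨a, rfl⟩
  have s₂ : ShortExact jR π₂ := by
    refine ⟨fun a b hab => sR₁.inj (congrArg (fun v : K => v.1.1) hab), fun v => ?_,
      le_antisymm ?_ ?_⟩
    · obtain ⟨u, hu⟩ := sR₁.surj (tmap 𝒢.l h y v)
      exact ⟨⟨(u, v), mem_compTan.2 hu⟩, rfl⟩
    · rintro _ ⟨a, rfl⟩
      rfl
    · rintro ⟨⟨u, v⟩, huv⟩ hv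
      have hv' : v = 0 := hv
      subst hv'
      have hu : u ∈ LinearMap.ker (tmap 𝒢.r g y).toLinearMap := by
        have := mem_compTan.1 huv
        simp only [map_zero] at this
        exact this
      rw [← sR₁.exact] at hu
      obtain ⟨a, rfl⟩ := hu
      exact ⟨a, rfl⟩
  have ez : (tmap 𝒢.l p z).toLinearMap ∘ₗ μ = (tmap 𝒢.l g z).toLinearMap ∘ₗ π₁ :=
    LinearMap.ext fun v => tmap_l_tmul hz hg hh hp v.2
  have ex : (tmap 𝒢.r p x).toLinearMap ∘ₗ μ = (tmap 𝒢.r h x).toLinearMap ∘ₗ π₂ :=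
    LinearMap.ext fun v => tmap_r_tmul hg hh hx hp v.2
  have s₃ : ShortExact D μ := by
    refine ⟨fun a b hab => sL₁.inj (congrArg (fun v : K => v.1.1) hab), fun w => ?_,
      le_antisymm ?_ ?_⟩
    -- A first approximation `k` has the right image under `T l`; the error is a left translate of a
    -- vector of `A_x`, which `jL` supplies.
    · obtain ⟨k, hk⟩ := (sL₁.surj.comp s₁.surj) (tmap 𝒢.l p z w)
      have hk' : tmap 𝒢.l p z (μ k) = tmap 𝒢.l p z w := (LinearMap.congr_fun ez k).trans hk
      have hw : w - μ k ∈ LinearMap.ker (tmap 𝒢.l p z).toLinearMap := by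
        rw [LinearMap.mem_ker, map_sub]
        exact sub_eq_zero.2 hk'.symm
      rw [← sL₃.exact] at hw
      obtain ⟨b, hb⟩ := hw
      refine ⟨k + jL b, ?_⟩
      have := LinearMap.congr_fun eL₃ b
      rw [LinearMap.comp_apply] at this
      rw [map_add, this, hb]
      abel
    · rintro _ ⟨a, rfl⟩
      exact eD a
    -- If `μ k = 0`, then `T l` kills the first component, so subtracting some `D a` makes that
    -- component zero. What remains is `jL b`, and injectivity of left translation at `p` forces `b
    -- = 0`.
    · intro k hk
      have hk0 : μ k = 0 := hk
      have h1 : π₁ k ∈ LinearMap.ker (tmap 𝒢.l g z).toLinearMap := by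
        have := LinearMap.congr_fun ez k
        rw [LinearMap.comp_apply, hk0, map_zero] at this
        exact this.symm
      rw [← sL₁.exact] at h1
      obtain ⟨a, ha⟩ := h1
      have h2 : k - D a ∈ LinearMap.ker π₁ := by
        rw [LinearMap.mem_ker, map_sub, sub_eq_zero]
        exact ha.symm
      rw [← s₁.exact] at h2
      obtain ⟨b, hb⟩ := h2
      have h3 : 𝒢.lt p x b = 0 := by
        rw [← eL₃, LinearMap.comp_apply, hb, map_sub, hk0, eD, sub_zero]
      have hb0 : b = 0 := sL₃.inj (h3.trans (map_zero _).symm)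
      refine ⟨a, ?_⟩
      rw [hb0, map_zero] at hb
      exact (sub_eq_zero.1 hb.symm).symm
  exact Balanced.trans (π₁ := π₁) (π₂ := π₂) (μ := μ) (jR := jR) (jL := jL) (D := D)
    sR₁ sL₁ sR₂ sL₂ sR₃ sL₃ s₁ s₂ s₃ rfl eR₃ rfl eL₃ rfl rfl
    (LinearMap.ext fun v => mem_compTan.1 v.2) ez ex (finrank_euc x) (finrank_euc y)
    (finrank_euc z) h₁ h₂

end Corr

end LieGroupoid

end DiffStack

end

noncomputable section

namespace DiffStack

open TopologicalSpace Module SmoothMfd Filter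
open scoped ContDiff TensorProduct Topology

/-! ### Smooth families of surjective linear maps -/

section Families

variable {V E F : Type*} [NormedAddCommGroup V] [NormedSpace ℝ V] [NormedAddCommGroup E]
  [NormedSpace ℝ E] [NormedAddCommGroup F] [NormedSpace ℝ F]
  [FiniteDimensional ℝ F] {v₀ : V}

/-- For a right inverse `S₀` at `v₀`, the endomorphism `M v ∘ S₀` is the identity at `v₀`, hence
invertible nearby with smooth inverse; correct `S₀` by it. -/
theorem exists_smooth_rightInverse {M : V → E →L[ℝ] F} (hM : ContDiffAt ℝ ∞ M v₀)
    (hs : Function.Surjective (M v₀)) : ∃ S : V → F →L[ℝ] E, ContDiffAt ℝ ∞ S v₀ ∧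
      ∀ᶠ v in 𝓝 v₀, ∀ w, M v (S v w) = w := by
  obtain ⟨S₀, hS₀⟩ := (M v₀).exists_rightInverse_of_surjective (LinearMap.range_eq_top.2 hs)
  have : CompleteSpace F := FiniteDimensional.complete ℝ F
  let N : V → F →L[ℝ] F := fun v => (M v).comp S₀
  have hN : ContDiffAt ℝ ∞ N v₀ := hM.clm_comp contDiffAt_const
  have hN0 : N v₀ = 1 := hS₀
  have hinv : ContDiffAt ℝ ∞ (fun v => Ring.inverse (N v)) v₀ := by
    have h1 := contDiffAt_ringInverse ℝ (1 : (F →L[ℝ] F)ˣ) (n := ∞)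
    rw [Units.val_one, ← hN0] at h1
    exact h1.comp v₀ hN
  have hu : ∀ᶠ v in 𝓝 v₀, IsUnit (N v) := by
    refine hN.continuousAt.eventually_mem (Units.isOpen.mem_nhds ?_)
    rw [hN0]
    exact isUnit_one
  refine ⟨fun v => S₀.comp (Ring.inverse (N v)), contDiffAt_const.clm_comp hinv, ?_⟩
  filter_upwards [hu] with v hv w
  exact congrArg (fun D => D w) (Ring.mul_inverse_cancel _ hv)

variable [FiniteDimensional ℝ E]

/-- A fixed basis of the kernel at `v₀` is projected to the kernel of `M v` by `1 - S v ∘ M v`.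
Nothing changes at `v₀`, and linear independence is an open condition. -/
theorem exists_smooth_kernel_frame {M : V → E →L[ℝ] F} (hM : ContDiffAt ℝ ∞ M v₀)
    (hs : Function.Surjective (M v₀)) {k : ℕ} (hk : k + finrank ℝ F = finrank ℝ E) :
    ∃ β : V → Fin k → E, (∀ i, ContDiffAt ℝ ∞ (fun v => β v i) v₀) ∧
      ∀ᶠ v in 𝓝 v₀, (∀ i, M v (β v i) = 0) ∧ LinearIndependent ℝ (β v) := by
  obtain ⟨S, hS, hS'⟩ := exists_smooth_rightInverse hM hs
  have hker : finrank ℝ (LinearMap.ker (M v₀).toLinearMap) = k := by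
    have := LinearMap.finrank_range_add_finrank_ker (M v₀).toLinearMap
    rw [LinearMap.range_eq_top.2 hs, finrank_top] at this
    omega
  let b := finBasisOfFinrankEq ℝ _ hker
  let β : V → Fin k → E := fun v i => (b i : E) - S v (M v (b i : E))
  have hβ : ∀ i, ContDiffAt ℝ ∞ (fun v => β v i) v₀ := fun i =>
    contDiffAt_const.sub (hS.clm_apply (hM.clm_apply contDiffAt_const))
  refine ⟨β, hβ, ?_⟩
  have hlin : ∀ᶠ v in 𝓝 v₀, LinearIndependent ℝ (β v) := by
    have hc : ContinuousAt β v₀ := continuousAt_pi.2 fun i => (hβ i).continuousAt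
    refine hc.eventually_mem (isOpen_setOfPred_linearIndependent.mem_nhds ?_)
    have h0 : β v₀ = Submodule.subtype _ ∘ b := by
      funext i
      have : M v₀ (b i : E) = 0 := (b i).2
      simp [β, this]
    change LinearIndependent ℝ (β v₀)
    rw [h0]
    exact b.linearIndependent.map' _ (Submodule.ker_subtype _)
  filter_upwards [hS', hlin] with v hv hv'
  exact ⟨fun i => by rw [map_sub, hv, sub_self], hv'⟩

/-- In a basis the value is a polynomial in the coordinates of the arguments. -/
theorem contDiffAt_multilinear {n : ℕ} {N : WithTop ℕ∞}
    (f : MultilinearMap ℝ (fun _ : Fin n => E) ℝ)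
    {w : V → Fin n → E} (hw : ∀ i, ContDiffAt ℝ N (fun v => w v i) v₀) :
    ContDiffAt ℝ N (fun v => f (w v)) v₀ := by
  let b := finBasis ℝ E
  have h : ∀ v, f (w v) = ∑ r : Fin n → Fin (finrank ℝ E),
      (∏ i, b.coord (r i) (w v i)) • f fun i => b (r i) := by
    intro v
    have h1 : w v = fun i => ∑ j, b.coord j (w v i) • b j := by
      funext i
      exact (b.sum_repr (w v i)).symm
    conv_lhs => rw [h1]
    rw [f.map_sum]
    exact Finset.sum_congr rfl fun r _ => f.map_smul_univ _ _
  simp only [h]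
  refine ContDiffAt.sum fun r _ => ?_
  refine ContDiffAt.smul (f := fun v => ∏ i, b.coord (r i) (w v i))
    (contDiffAt_prod fun i _ => ?_) contDiffAt_const
  exact (LinearMap.toContinuousLinearMap (b.coord (r i))).contDiff.contDiffAt.comp v₀ (hw i)

theorem contDiffAt_ιMulti {n : ℕ} {N : WithTop ℕ∞} (l : ExteriorAlgebra ℝ E →ₗ[ℝ] ℝ)
    {w : V → Fin n → E} (hw : ∀ i, ContDiffAt ℝ N (fun v => w v i) v₀) :
    ContDiffAt ℝ N (fun v => l (ExteriorAlgebra.ιMulti ℝ n (w v))) v₀ :=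
  contDiffAt_multilinear (l.compMultilinearMap (ExteriorAlgebra.ιMulti ℝ n).toMultilinearMap) hw

theorem exists_dual_ne_zero {W : Type*} [AddCommGroup W] [Module ℝ W] {w : W} (hw : w ≠ 0) :
    ∃ l : W →ₗ[ℝ] ℝ, l w ≠ 0 := by
  by_contra! h
  exact hw ((Module.forall_dual_apply_eq_zero_iff ℝ w).1 h)

end Families

/-- The coordinate functionals on Euclidean space. -/
def eStar (n : ℕ) : Fin n → Dual ℝ (Euc n) := (EuclideanSpace.basisFun (Fin n) ℝ).toBasis.coord

theorem eStar_apply_basisFun {n : ℕ} (i j : Fin n) :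
    eStar n i (EuclideanSpace.basisFun (Fin n) ℝ j) = if j = i then 1 else 0 := by
  have := (EuclideanSpace.basisFun (Fin n) ℝ).toBasis.repr_self_apply j i
  simpa [eStar] using this

theorem eStar_linearIndependent (n : ℕ) : LinearIndependent ℝ (eStar n) := by
  have := (EuclideanSpace.basisFun (Fin n) ℝ).toBasis.dualBasis.linearIndependent
  rwa [Basis.coe_dualBasis] at this

theorem comp_append {α β : Type*} {m n : ℕ} (f : α → β) (a : Fin m → α) (b : Fin n → α) :
    f ∘ Fin.append a b = Fin.append (f ∘ a) (f ∘ b) := by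
  funext i
  refine Fin.addCases (fun i => ?_) (fun i => ?_) i <;> simp

theorem exists_eq_smul_tmul {A Y : Type*} [AddCommGroup A] [Module ℝ A] [AddCommGroup Y]
    [Module ℝ Y] [FiniteDimensional ℝ A] [FiniteDimensional ℝ Y] {n : ℕ} (hn : finrank ℝ Y = n)
    {α : detLine A} {θ : ⋀[ℝ]^n (Dual ℝ Y)} (hα : α ≠ 0) (hθ : θ ≠ 0)
    (q : detLine A ⊗[ℝ] ⋀[ℝ]^n (Dual ℝ Y)) : ∃ c : ℝ, q = (c • α) ⊗ₜ θ := by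
  obtain ⟨α', θ', hα', hθ', h⟩ := exists_tmul_of_ne_zero (A := A) hn
  have h2 : finrank ℝ (⋀[ℝ]^n (Dual ℝ Y)) = 1 := by
    rw [exteriorPower.finrank_eq, Subspace.dual_finrank_eq, hn, Nat.choose_self]
  obtain ⟨d, rfl⟩ := exists_smul_eq_of_finrank_eq_one finrank_detLine hα α'
  obtain ⟨e, rfl⟩ := exists_smul_eq_of_finrank_eq_one h2 hθ θ'
  obtain ⟨c, rfl⟩ := h q
  exact ⟨e * c * d, by
    rw [TensorProduct.tmul_smul, TensorProduct.smul_tmul', smul_smul, smul_smul]⟩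

/-- The degrees `m` and `n` are kept apart because the dimensions at neighbouring points are equal
only propositionally; the value is the determinant of the identity. -/
theorem pairingDual_eq_one {T Y : Type*} [AddCommGroup T] [Module ℝ T] [AddCommGroup Y] [Module ℝ Y]
    {m n : ℕ} (h : m = n) {p : T →ₗ[ℝ] Y} {f : Fin m → Dual ℝ Y} {v : Fin m → T}
    {θ : ⋀[ℝ]^n (Dual ℝ Y)} {τ : ⋀[ℝ]^n T}
    (hθ : (θ : ExteriorAlgebra ℝ (Dual ℝ Y)) = ExteriorAlgebra.ιMulti ℝ m f)
    (hτ : (τ : ExteriorAlgebra ℝ T) = ExteriorAlgebra.ιMulti ℝ m v)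
    (hfv : ∀ i j, f i (p (v j)) = if j = i then 1 else 0) :
    exteriorPower.pairingDual ℝ Y n θ (exteriorPower.map n p τ) = 1 := by
  subst h
  have h1 : θ = exteriorPower.ιMulti ℝ m f := Subtype.ext hθ
  have h2 : τ = exteriorPower.ιMulti ℝ m v := Subtype.ext hτ
  rw [h1, h2, exteriorPower.map_apply_ιMulti, exteriorPower.pairingDual_ιMulti_ιMulti,
    ← Matrix.det_one (n := Fin m)]
  congr 1
  ext i j
  simp [hfv, Matrix.one_apply]

/-! ### The coefficient of `j_g` in frames read in fixed charts -/

namespace LieGroupoid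

open Grpd

variable {G G₀ : Type*} [TopologicalSpace G] [TopologicalSpace G₀] [SmoothMfd G] [SmoothMfd G₀]
  {𝒢 : LieGroupoid G G₀}

theorem ιMulti_mem_of_eq {T : Type*} [AddCommGroup T] [Module ℝ T] {m n : ℕ} (h : m = n)
    (v : Fin m → T) : ExteriorAlgebra.ιMulti ℝ m v ∈ ⋀[ℝ]^n T := by
  subst h
  exact ExteriorAlgebra.ιMulti_range ℝ m (Set.mem_range_self v)

theorem localRep_tmul (x₀ x : G₀) (α : detLine (𝒢.A x)) (θ : ⋀[ℝ]^(dim x) (Dual ℝ (Tan x))) :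
    𝒢.localRep x₀ x (α ⊗ₜ θ) =
      ExteriorAlgebra.map ((tmap id (𝒢.one x) (𝒢.one x₀)).toLinearMap ∘ₗ (𝒢.A x).subtype)
        (α : ExteriorAlgebra ℝ (𝒢.A x)) ⊗ₜ
      ExteriorAlgebra.map (fderiv ℝ (rep id x₀ x) (chart x₀ x)).toLinearMap.dualMap
        (θ : ExteriorAlgebra ℝ (Dual ℝ (Tan x))) :=
  rfl

/-- A frame of `A` at `x` and the coordinates around `x₀` give a basis vector of `Q` at `x`. -/
theorem exists_frame {x₀ x : G₀} (hx : x ∈ (chart x₀).source) {k : ℕ}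
    (hk : finrank ℝ (𝒢.A x) = k) {B : Fin k → 𝒢.A x} (hB : LinearIndependent ℝ B) :
    ∃ (α : detLine (𝒢.A x)) (θ : ⋀[ℝ]^(dim x) (Dual ℝ (Tan x))),
      (α : ExteriorAlgebra ℝ (𝒢.A x)) = ExteriorAlgebra.ιMulti ℝ k B ∧
      (θ : ExteriorAlgebra ℝ (Dual ℝ (Tan x))) = ExteriorAlgebra.ιMulti ℝ (dim x₀)
        (fun j => eStar (dim x₀) j ∘ₗ (tmap id x x₀).toLinearMap) ∧
      (∀ q : 𝒢.Q x, ∃ c : ℝ, q = (c • α) ⊗ₜ θ) ∧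
      ∀ c : ℝ, 𝒢.localRep x₀ x ((c • α) ⊗ₜ θ) = c • (ExteriorAlgebra.ιMulti ℝ k
        (fun i => tmap id (𝒢.one x) (𝒢.one x₀) (B i : Tan (𝒢.one x))) ⊗ₜ
          ExteriorAlgebra.ιMulti ℝ (dim x₀) (eStar (dim x₀))) := by
  have hd := dim_eq_of_mem_source hx
  have hinv' : ∀ w, tmap id x x₀ (fderiv ℝ (rep id x₀ x) (chart x₀ x) w) = w := fun w =>
    congrArg (fun D => D w) (tmap_id_comp_rep_id hx)
  let α : detLine (𝒢.A x) := ⟨ExteriorAlgebra.ιMulti ℝ k B, ιMulti_mem_of_eq hk.symm B⟩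
  let f : Fin (dim x₀) → Dual ℝ (Tan x) :=
    fun j => eStar (dim x₀) j ∘ₗ (tmap id x x₀).toLinearMap
  let θ : ⋀[ℝ]^(dim x) (Dual ℝ (Tan x)) :=
    ⟨ExteriorAlgebra.ιMulti ℝ (dim x₀) f, ιMulti_mem_of_eq hd.symm f⟩
  have e1 : (fderiv ℝ (rep id x₀ x) (chart x₀ x)).toLinearMap.dualMap ∘ f = eStar (dim x₀) := by
    funext j
    ext1 w
    change eStar (dim x₀) j (tmap id x x₀ (fderiv ℝ (rep id x₀ x) (chart x₀ x) w)) = _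
    rw [hinv']
  have hf : LinearIndependent ℝ f :=
    LinearIndependent.of_comp (fderiv ℝ (rep id x₀ x) (chart x₀ x)).toLinearMap.dualMap
      (by rw [e1]; exact eStar_linearIndependent (dim x₀))
  have hα : α ≠ 0 := fun h => ιMulti_ne_zero hB (congrArg Subtype.val h)
  have hθ : θ ≠ 0 := fun h => ιMulti_ne_zero hf (congrArg Subtype.val h)
  refine ⟨α, θ, rfl, rfl, fun q => ?_, fun c => ?_⟩
  · exact exists_eq_smul_tmul (finrank_euc x) hα hθ q
  · rw [localRep_tmul, SetLike.val_smul, map_smul, ← TensorProduct.smul_tmul']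
    congr 1
    simp only [α, θ]
    rw [ExteriorAlgebra.map_apply_ιMulti, ExteriorAlgebra.map_apply_ιMulti]
    rw [e1]
    rfl

theorem finrank_A_add (x : G₀) : finrank ℝ (𝒢.A x) + dim x = dim (𝒢.one x) := by
  have := (shortExact_rt (𝒢 := 𝒢) (𝒢.l_one x) (𝒢.r_one x)).finrank_eq
  rwa [finrank_euclideanSpace_fin, finrank_euclideanSpace_fin] at this

/-- The relation between the coefficients of corresponding elements of `Q` with respect to
frames that are given in fixed charts. -/
theorem Corr.coeff {x₀ y₀ x y : G₀} {g₀ g : G} (hy : 𝒢.l g = y) (hx : 𝒢.r g = x)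
    (hxs : x ∈ (chart x₀).source) (hys : y ∈ (chart y₀).source) (hgs : g ∈ (chart g₀).source)
    (h1xs : 𝒢.one x ∈ (chart (𝒢.one x₀)).source) (h1ys : 𝒢.one y ∈ (chart (𝒢.one y₀)).source)
    {j k : ℕ} (hj : j + dim x₀ = dim g₀) (hk : k + dim x₀ = dim (𝒢.one x₀))
    {b : Fin k → Tan (𝒢.one x₀)} (hb : LinearIndependent ℝ b)
    (hb0 : ∀ i, fderiv ℝ (rep 𝒢.r (𝒢.one x₀) x₀) (chart (𝒢.one x₀) (𝒢.one x)) (b i) = 0)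
    {β : Fin j → Tan g₀} (hβ : LinearIndependent ℝ β)
    (hβ0 : ∀ i, fderiv ℝ (rep 𝒢.r g₀ x₀) (chart g₀ g) (β i) = 0)
    {u : Fin (dim x₀) → Tan g₀} (hu : ∀ i, fderiv ℝ (rep 𝒢.r g₀ x₀) (chart g₀ g) (u i) =
      EuclideanSpace.basisFun (Fin (dim x₀)) ℝ i)
    {u' : Fin (dim y₀) → Tan g₀} (hu' : ∀ i, fderiv ℝ (rep 𝒢.l g₀ y₀) (chart g₀ g) (u' i) =
      EuclideanSpace.basisFun (Fin (dim y₀)) ℝ i)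
    {dL : Tan (𝒢.one x₀) →L[ℝ] Tan g₀} (hdL : ∀ a : 𝒢.A x, tmap id g g₀ (𝒢.lt g x a) =
      dL (tmap id (𝒢.one x) (𝒢.one x₀) (a : Tan (𝒢.one x))))
    {dR : Tan g₀ →L[ℝ] Tan (𝒢.one y₀)} (hdR : ∀ a : 𝒢.A y,
      tmap id (𝒢.one y) (𝒢.one y₀) (a : Tan (𝒢.one y)) = dR (tmap id g g₀ (𝒢.rt g y a)))
    {q : 𝒢.Q y} {q' : 𝒢.Q x} (hq : 𝒢.Corr g y x q q') :
    LinearIndependent ℝ (fun i => dR (β i)) ∧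
    LinearIndependent ℝ (Fin.append (fun i => dL (b i)) u') ∧
    ∃ c c' : ℝ,
      𝒢.localRep y₀ y q = c • (ExteriorAlgebra.ιMulti ℝ j (fun i => dR (β i)) ⊗ₜ
        ExteriorAlgebra.ιMulti ℝ (dim y₀) (eStar (dim y₀))) ∧
      𝒢.localRep x₀ x q' = c' • (ExteriorAlgebra.ιMulti ℝ k b ⊗ₜ
        ExteriorAlgebra.ιMulti ℝ (dim x₀) (eStar (dim x₀))) ∧
      ((-1) ^ (j * k) * c) • ExteriorAlgebra.ιMulti ℝ (j + dim x₀) (Fin.append β u) =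
        c' • ExteriorAlgebra.ιMulti ℝ (k + dim y₀) (Fin.append (fun i => dL (b i)) u') := by
  have sR := shortExact_rt hy hx
  have sL := shortExact_lt hy hx
  let Cg := tmap id g g₀
  -- `Cg` and `Ig` are mutually inverse coordinate changes between the chart at `g` and the fixed
  -- chart at `g₀`.
  let Ig := fderiv ℝ (rep id g₀ g) (chart g₀ g)
  have hCI : ∀ w, Cg (Ig w) = w := fun w => congrArg (fun D => D w) (tmap_id_comp_rep_id hgs)
  have hIC : ∀ w, Ig (Cg w) = w := fun w => congrArg (fun D => D w) (rep_id_comp_tmap_id hgs)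
  have hC1 : ∀ w, tmap id (𝒢.one x) (𝒢.one x₀) (fderiv ℝ (rep id (𝒢.one x₀) (𝒢.one x))
    (chart (𝒢.one x₀) (𝒢.one x)) w) = w :=
    fun w => congrArg (fun D => D w) (tmap_id_comp_rep_id h1xs)
  have hCx := tmap_id_injective hxs
  have hr : ∀ w, tmap id x x₀ (tmap 𝒢.r g x w) =
      fderiv ℝ (rep 𝒢.r g₀ x₀) (chart g₀ g) (Cg w) := fun w => by
    subst hx
    exact congrArg (fun D => D w) (tmap_id_comp_tmap 𝒢.submersion_r.1 hgs hxs)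
  have hl : ∀ w, tmap id y y₀ (tmap 𝒢.l g y w) =
      fderiv ℝ (rep 𝒢.l g₀ y₀) (chart g₀ g) (Cg w) := fun w => by
    subst hy
    exact congrArg (fun D => D w) (tmap_id_comp_tmap 𝒢.submersion_l.1 hgs hys)
  have hr1 : ∀ w, tmap id x x₀ (tmap 𝒢.r (𝒢.one x) x w) =
      fderiv ℝ (rep 𝒢.r (𝒢.one x₀) x₀) (chart (𝒢.one x₀) (𝒢.one x))
        (tmap id (𝒢.one x) (𝒢.one x₀) w) := fun w => by
    have key : ∀ x', 𝒢.r (𝒢.one x) = x' → x' ∈ (chart x₀).source →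
        tmap id x' x₀ (tmap 𝒢.r (𝒢.one x) x' w) =
          fderiv ℝ (rep 𝒢.r (𝒢.one x₀) x₀) (chart (𝒢.one x₀) (𝒢.one x))
            (tmap id (𝒢.one x) (𝒢.one x₀) w) := by
      rintro _ rfl h
      exact congrArg (fun D => D w) (tmap_id_comp_tmap 𝒢.submersion_r.1 h1xs h)
    exact key x (𝒢.r_one x) hxs
  have hdx := dim_eq_of_mem_source hxs
  have hdy := dim_eq_of_mem_source hys
  have hkx : finrank ℝ (𝒢.A x) = k := by
    have h1 := finrank_A_add (𝒢 := 𝒢) x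
    have h2 := dim_eq_of_mem_source h1xs
    omega
  have hjy : finrank ℝ (𝒢.A y) = j := by
    have h1 := sR.finrank_eq
    have h2 := dim_eq_of_mem_source hgs
    rw [finrank_euclideanSpace_fin, finrank_euclideanSpace_fin] at h1
    omega
  -- the frame at `x`
  have hBmem : ∀ i, fderiv ℝ (rep id (𝒢.one x₀) (𝒢.one x)) (chart (𝒢.one x₀) (𝒢.one x)) (b i) ∈
      𝒢.A x := fun i => by
    refine hCx ?_
    change tmap id x x₀ (tmap 𝒢.r (𝒢.one x) x _) = _
    rw [hr1, hC1, hb0, map_zero]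
  let B : Fin k → 𝒢.A x := fun i => ⟨_, hBmem i⟩
  have hBb : ∀ i, tmap id (𝒢.one x) (𝒢.one x₀) (B i : Tan (𝒢.one x)) = b i := fun i => hC1 (b i)
  have hB : LinearIndependent ℝ B := by
    refine LinearIndependent.of_comp
      ((tmap id (𝒢.one x) (𝒢.one x₀)).toLinearMap ∘ₗ (𝒢.A x).subtype) ?_
    have : ((tmap id (𝒢.one x) (𝒢.one x₀)).toLinearMap ∘ₗ (𝒢.A x).subtype) ∘ B = b := funext hBb
    rwa [this]
  -- the frame at `y`
  have hAmem : ∀ i, ∃ a : 𝒢.A y, 𝒢.rt g y a = Ig (β i) := fun i => by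
    have : Ig (β i) ∈ LinearMap.ker (tmap 𝒢.r g x).toLinearMap := by
      refine hCx ?_
      change tmap id x x₀ (tmap 𝒢.r g x _) = _
      rw [hr, hCI, hβ0, map_zero]
    rwa [← sR.exact] at this
  choose a ha using hAmem
  have hCa : ∀ i, Cg (𝒢.rt g y (a i)) = β i := fun i => by rw [ha, hCI]
  have hA : LinearIndependent ℝ a := by
    refine LinearIndependent.of_comp (Cg.toLinearMap ∘ₗ 𝒢.rt g y) ?_
    have : (Cg.toLinearMap ∘ₗ 𝒢.rt g y) ∘ a = β := funext hCa
    rwa [this]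
  have hC1y : ∀ i, tmap id (𝒢.one y) (𝒢.one y₀) (a i : Tan (𝒢.one y)) = dR (β i) := fun i => by
    rw [hdR]
    exact congrArg dR (hCa i)
  have hCL : ∀ i, Cg (𝒢.lt g x (B i)) = dL (b i) := fun i => by
    rw [← hBb]
    exact hdL (B i)
  obtain ⟨α, θ, hα, hθ, hq1, hloc⟩ := exists_frame hys hjy hA
  obtain ⟨α', θ', hα', hθ', hq1', hloc'⟩ := exists_frame hxs hkx hB
  obtain ⟨c, rfl⟩ := hq1 q
  obtain ⟨c', rfl⟩ := hq1' q'
  have hIu : ∀ i, tmap id x x₀ (tmap 𝒢.r g x (Ig (u i))) =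
      EuclideanSpace.basisFun (Fin (dim x₀)) ℝ i := fun i => by rw [hr, hCI, hu]
  have hIu' : ∀ i, tmap id y y₀ (tmap 𝒢.l g y (Ig (u' i))) =
      EuclideanSpace.basisFun (Fin (dim y₀)) ℝ i := fun i => by rw [hl, hCI, hu']
  refine ⟨?_, ?_, c, c', ?_, ?_, ?_⟩
  · have h1 := tmap_id_injective h1ys
    have h2 := hA.map' ((tmap id (𝒢.one y) (𝒢.one y₀)).toLinearMap ∘ₗ (𝒢.A y).subtype)
      (LinearMap.ker_eq_bot.2 (h1.comp Subtype.val_injective))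
    have h3 : ((tmap id (𝒢.one y) (𝒢.one y₀)).toLinearMap ∘ₗ (𝒢.A y).subtype) ∘ a =
        fun i => dR (β i) := funext hC1y
    rwa [h3] at h2
  · have h1 := sL.append_linearIndependent hB (t := fun i => Ig (u' i)) (by
      refine LinearIndependent.of_comp (tmap id y y₀).toLinearMap ?_
      have : (tmap id y y₀).toLinearMap ∘ (tmap 𝒢.l g y).toLinearMap ∘ (fun i => Ig (u' i)) =
          (EuclideanSpace.basisFun (Fin (dim y₀)) ℝ).toBasis := by
        funext i
        rw [OrthonormalBasis.coe_toBasis]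
        exact hIu' i
      rw [this]
      exact Basis.linearIndependent _)
    have h2 := h1.map' Cg.toLinearMap (LinearMap.ker_eq_bot.2 fun v w hvw => by
      rw [← hIC v, ← hIC w]
      exact congrArg Ig hvw)
    have e1 : Cg.toLinearMap ∘ 𝒢.lt g x ∘ B = fun i => dL (b i) := funext hCL
    have e2 : (Cg.toLinearMap ∘ fun i => Ig (u' i)) = u' := funext fun i => hCI _
    rwa [comp_append, e1, e2] at h2
  · rw [hloc]
    simp only [hC1y]
  · rw [hloc']
    simp only [hBb]
  -- Lifts of the coordinate vectors are normalized against the coordinate forms. `tmul_iff` then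
  -- leaves one equation, which `Cg` carries into the fixed space `Λ T_{g₀} G`.
  · let τ : ⋀[ℝ]^(dim y) (Tan g) := ⟨ExteriorAlgebra.ιMulti ℝ (dim y₀) (fun i => Ig (u' i)),
      ιMulti_mem_of_eq hdy.symm _⟩
    let τ' : ⋀[ℝ]^(dim x) (Tan g) := ⟨ExteriorAlgebra.ιMulti ℝ (dim x₀) (fun i => Ig (u i)),
      ιMulti_mem_of_eq hdx.symm _⟩
    have hτ := pairingDual_eq_one (p := (tmap 𝒢.l g y).toLinearMap) hdy.symm hθ (τ := τ) rfl
      (fun i l => by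
        change eStar _ i (tmap id y y₀ (tmap 𝒢.l g y (Ig (u' l)))) = _
        rw [hIu', eStar_apply_basisFun])
    have hτ' := pairingDual_eq_one (p := (tmap 𝒢.r g x).toLinearMap) hdx.symm hθ' (τ := τ') rfl
      (fun i l => by
        change eStar _ i (tmap id x x₀ (tmap 𝒢.r g x (Ig (u l)))) = _
        rw [hIu, eStar_apply_basisFun])
    have h1 := (Balanced.tmul_iff sR sL (finrank_euc x) (finrank_euc y) hτ hτ').1 hq
    have h2 := congrArg (ExteriorAlgebra.map Cg.toLinearMap) h1
    rw [SetLike.val_smul, SetLike.val_smul, hα, hα'] at h2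
    simp only [τ, τ', map_smul, ExteriorAlgebra.map_apply_ιMulti, hjy, hkx,
      smul_mul_assoc, smul_smul, ExteriorAlgebra.ιMulti_mul_ιMulti, comp_append] at h2
    have e1 : (Cg.toLinearMap ∘ 𝒢.rt g y ∘ a) = β := funext hCa
    have e2 : (Cg.toLinearMap ∘ 𝒢.lt g x ∘ B) = fun i => dL (b i) := funext hCL
    have e3 : (Cg.toLinearMap ∘ fun i => Ig (u i)) = u := funext fun i => hCI _
    have e4 : (Cg.toLinearMap ∘ fun i => Ig (u' i)) = u' := funext fun i => hCI _
    rwa [e1, e2, e3, e4] at h2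

end LieGroupoid

end DiffStack

end

noncomputable section

namespace DiffStack

open TopologicalSpace Module SmoothMfd Filter
open scoped ContDiff TensorProduct Topology

namespace LieGroupoid

open Grpd

variable {G G₀ : Type*} [TopologicalSpace G] [TopologicalSpace G₀] [SmoothMfd G] [SmoothMfd G₀]
  {𝒢 : LieGroupoid G G₀}

/-! ### Smoothness of invariant sections along orbits -/

variable (𝒢) in
/-- A section of `Q_A` is smooth at `x₀`. -/
def SmoothSectionAt (σ : ∀ x, 𝒢.Q x) (x₀ : G₀) : Prop :=
  ∀ ψ : Dual ℝ
      (ExteriorAlgebra ℝ (Tan (𝒢.one x₀)) ⊗[ℝ] ExteriorAlgebra ℝ (Dual ℝ (Tan x₀))),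
    ContDiffAt ℝ ∞
      (fun v => ψ (𝒢.localRep x₀ ((chart x₀).symm v) (σ ((chart x₀).symm v)))) (chart x₀ x₀)

variable {g₀ : G} {x₀ y₀ : G₀} {s : Tan x₀ → G}

/-- The inverse chart at `x₀` lifts through the submersion `r`. No bisection is needed: `l ∘ s` is
merely smooth, and the two ends may have different dimensions. -/
theorem exists_local_section (hx : 𝒢.r g₀ = x₀) : ∃ s : Tan x₀ → G, s (chart x₀ x₀) = g₀ ∧
    PlotAt ⊤ s (chart x₀ x₀) ∧ ∀ᶠ v in 𝓝 (chart x₀ x₀), 𝒢.r (s v) = (chart x₀).symm v := by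
  subst hx
  have ht := chart_mem_target (mem_source (𝒢.r g₀))
  obtain ⟨S, hS⟩ := (tmap 𝒢.r g₀ (𝒢.r g₀)).exists_rightInverse_of_surjective
    (LinearMap.range_eq_top.2 (𝒢.submersion_r.2 g₀))
  obtain ⟨s, h0, h1, -, h3⟩ := 𝒢.submersion_r.exists_lift g₀
    ((chart (𝒢.r g₀)).left_inv (mem_source _)) (plotAt_chart_symm (n := ⊤) ht) S (by
      rw [hS]
      refine (hasFDerivAt_id _).congr_of_eventuallyEq ?_
      filter_upwards [(chart (𝒢.r g₀)).open_target.mem_nhds ht] with w hw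
      exact (chart (𝒢.r g₀)).right_inv hw)
  exact ⟨s, h0, h1, h3⟩

theorem contDiffAt_fderiv_comp {V E F : Type*} [NormedAddCommGroup V] [NormedSpace ℝ V]
    [NormedAddCommGroup E] [NormedSpace ℝ E] [NormedAddCommGroup F] [NormedSpace ℝ F]
    {f : E → F} {u : V → E} {v : V} (hf : ContDiffAt ℝ ∞ f (u v)) (hu : ContDiffAt ℝ ∞ u v) :
    ContDiffAt ℝ ∞ (fun w => fderiv ℝ f (u w)) v :=
  (hf.fderiv_right (m := ∞) (by simp)).comp v hu

/-- The inverses of the right translations along a local section form a smooth family. -/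
theorem exists_smooth_rt (hx : 𝒢.r g₀ = x₀) (hy : 𝒢.l g₀ = y₀) (hs0 : s (chart x₀ x₀) = g₀)
    (hs : PlotAt ⊤ s (chart x₀ x₀))
    (hsr : ∀ᶠ v in 𝓝 (chart x₀ x₀), 𝒢.r (s v) = (chart x₀).symm v) :
    ∃ dR : Tan x₀ → Tan g₀ →L[ℝ] Tan (𝒢.one y₀), ContDiffAt ℝ ∞ dR (chart x₀ x₀) ∧
      ∀ᶠ v in 𝓝 (chart x₀ x₀), ∀ y, 𝒢.l (s v) = y → ∀ a : 𝒢.A y,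
        tmap id (𝒢.one y) (𝒢.one y₀) (a : Tan (𝒢.one y)) =
          dR v (tmap id (s v) g₀ (𝒢.rt (s v) y a)) := by
  -- In terms of arrows this is `k ↦ k · (s (r k))⁻¹`. On the `r`-fibre of `s v` it is right
  -- translation by `(s v)⁻¹`, so one smooth map encodes the whole family and its derivative at `s
  -- v` inverts the right translation.
  let Ψ : Tan g₀ → G := fun e => 𝒢.m ((chart g₀).symm e) (𝒢.inv (s (rep 𝒢.r g₀ x₀ e)))
  have he : (chart g₀).symm (chart g₀ g₀) = g₀ := (chart g₀).left_inv (mem_source g₀)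
  have hrep0 : rep 𝒢.r g₀ x₀ (chart g₀ g₀) = chart x₀ x₀ := by
    simp only [rep, Function.comp_apply, he, hx]
  have hrep := contDiffAt_rep 𝒢.submersion_r.1 (mem_source g₀)
    (y := x₀) (by rw [hx]; exact mem_source x₀)
  have hk := plotAt_chart_symm (n := ⊤) (chart_mem_target (mem_source g₀))
  have hs' : PlotAt ⊤ (fun e => s (rep 𝒢.r g₀ x₀ e)) (chart g₀ g₀) :=
    PlotAt.comp (rep 𝒢.r g₀ x₀) (by rwa [hrep0]) hrep
  have hrs : ∀ᶠ e in 𝓝 (chart g₀ g₀), 𝒢.r ((chart g₀).symm e) ∈ (chart x₀).source :=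
    (hk.map 𝒢.submersion_r.1).cont.eventually_mem
      (source_mem_nhds (by simp only [Function.comp_apply, he, hx]; exact mem_source x₀))
  have hsr' : ∀ᶠ e in 𝓝 (chart g₀ g₀), 𝒢.r (s (rep 𝒢.r g₀ x₀ e)) =
      (chart x₀).symm (rep 𝒢.r g₀ x₀ e) :=
    hrep.continuousAt.eventually (by rwa [hrep0])
  have hΨ : PlotAt ⊤ Ψ (chart g₀ g₀) := by
    refine (plotAt_mul hk (hs'.map 𝒢.smooth_inv) ?_).1
    filter_upwards [hrs, hsr'] with e h1 h2
    simp only [Function.comp_apply, 𝒢.l_inv, h2]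
    exact ((chart x₀).left_inv h1).symm
  have hΨ0 : Ψ (chart g₀ g₀) = 𝒢.one y₀ := by
    simp only [Ψ, he, hrep0, hs0, m_inv, hy]
  have hF : ContDiffAt ℝ ∞ (chart (𝒢.one y₀) ∘ Ψ) (chart g₀ g₀) :=
    hΨ.chart_comp (by rw [hΨ0]; exact mem_source _)
  have hcs : ContDiffAt ℝ ∞ (fun v => chart g₀ (s v)) (chart x₀ x₀) :=
    hs.chart_comp (by rw [hs0]; exact mem_source _)
  have hF' : ContDiffAt ℝ ∞ (chart (𝒢.one y₀) ∘ Ψ) (chart g₀ (s (chart x₀ x₀))) := by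
    rwa [hs0]
  refine ⟨fun v => fderiv ℝ (chart (𝒢.one y₀) ∘ Ψ) (chart g₀ (s v)),
    contDiffAt_fderiv_comp hF' hcs, ?_⟩
  have hd : ∀ᶠ v in 𝓝 (chart x₀ x₀),
      DifferentiableAt ℝ (chart (𝒢.one y₀) ∘ Ψ) (chart g₀ (s v)) :=
    hcs.continuousAt.eventually (((hF'.of_le (by simp : (1 : WithTop ℕ∞) ≤ ∞)).eventually
      (by simp)).mono fun e he => he.differentiableAt (by simp))
  have hsrc : ∀ᶠ v in 𝓝 (chart x₀ x₀), s v ∈ (chart g₀).source :=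
    hs.cont.eventually_mem (source_mem_nhds (by rw [hs0]; exact mem_source _))
  have h1src : ∀ᶠ v in 𝓝 (chart x₀ x₀), 𝒢.one (𝒢.l (s v)) ∈ (chart (𝒢.one y₀)).source :=
    ((hs.map 𝒢.submersion_l.1).map 𝒢.smooth_one).cont.eventually_mem
      (source_mem_nhds (by simp only [Function.comp_apply, hs0, hy]; exact mem_source _))
  have hv := (chart x₀).open_target.mem_nhds (chart_mem_target (mem_source x₀))
  filter_upwards [hd, hsrc, h1src, hsr, hv] with v hd hsrc h1src hsr hv y hy a
  subst hy
  obtain ⟨γ, hγ, hr⟩ := exists_vel_A a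
  have hδ := hasVel_rt rfl hγ hr
  have hδ' := hδ.hasDerivAt_chart hsrc
  have hδs : ∀ᶠ t in 𝓝 0, 𝒢.m (γ t) (s v) ∈ (chart g₀).source :=
    hδ.plot.cont.eventually_mem (source_mem_nhds (by rw [hδ.eq]; exact hsrc))
  have hd' : HasFDerivAt (chart (𝒢.one y₀) ∘ Ψ) (fderiv ℝ (chart (𝒢.one y₀) ∘ Ψ)
      (chart g₀ (s v))) ((chart g₀ ∘ fun t => 𝒢.m (γ t) (s v)) 0) := by
    rw [Function.comp_apply, hδ.eq]
    exact hd.hasFDerivAt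
  refine (hγ.hasDerivAt_chart h1src).unique ((hd'.comp_hasDerivAt (0 : ℝ) hδ').congr_of_eventuallyEq ?_)
  filter_upwards [hδs, hr] with t ht ht'
  simp only [Function.comp_apply, Ψ, rep, (chart g₀).left_inv ht]
  rw [r_m ht', hsr, (chart x₀).right_inv hv, m_m_inv ht']

/-- The left translations along a local section form a smooth family. -/
theorem exists_smooth_lt (hx : 𝒢.r g₀ = x₀) (hs0 : s (chart x₀ x₀) = g₀)
    (hs : PlotAt ⊤ s (chart x₀ x₀))
    (hsr : ∀ᶠ v in 𝓝 (chart x₀ x₀), 𝒢.r (s v) = (chart x₀).symm v) :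
    ∃ dL : Tan x₀ → Tan (𝒢.one x₀) →L[ℝ] Tan g₀, ContDiffAt ℝ ∞ dL (chart x₀ x₀) ∧
      ∀ᶠ v in 𝓝 (chart x₀ x₀), ∀ a : 𝒢.A ((chart x₀).symm v),
        tmap id (s v) g₀ (𝒢.lt (s v) ((chart x₀).symm v) a) =
          dL v (tmap id (𝒢.one ((chart x₀).symm v)) (𝒢.one x₀)
            (a : Tan (𝒢.one ((chart x₀).symm v)))) := by
  let i₀ := 𝒢.one x₀
  -- In terms of arrows this is `k ↦ s (r k) · k⁻¹`; on each `r`-fibre it is the map whose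
  -- derivative at the unit is `lt`.
  let Λ : Tan i₀ → G := fun e => 𝒢.m (s (rep 𝒢.r i₀ x₀ e)) (𝒢.inv ((chart i₀).symm e))
  have he : (chart i₀).symm (chart i₀ i₀) = i₀ := (chart i₀).left_inv (mem_source i₀)
  have hri : 𝒢.r i₀ = x₀ := 𝒢.r_one x₀
  have hrep0 : rep 𝒢.r i₀ x₀ (chart i₀ i₀) = chart x₀ x₀ := by
    simp only [rep, Function.comp_apply, he, hri]
  have hrep := contDiffAt_rep 𝒢.submersion_r.1 (mem_source i₀)
    (y := x₀) (by rw [hri]; exact mem_source x₀)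
  have hk := plotAt_chart_symm (n := ⊤) (chart_mem_target (mem_source i₀))
  have hs' : PlotAt ⊤ (fun e => s (rep 𝒢.r i₀ x₀ e)) (chart i₀ i₀) :=
    PlotAt.comp (rep 𝒢.r i₀ x₀) (by rwa [hrep0]) hrep
  have hrs : ∀ᶠ e in 𝓝 (chart i₀ i₀), 𝒢.r ((chart i₀).symm e) ∈ (chart x₀).source :=
    (hk.map 𝒢.submersion_r.1).cont.eventually_mem
      (source_mem_nhds (by simp only [Function.comp_apply, he, hri]; exact mem_source x₀))
  have hsr' : ∀ᶠ e in 𝓝 (chart i₀ i₀), 𝒢.r (s (rep 𝒢.r i₀ x₀ e)) =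
      (chart x₀).symm (rep 𝒢.r i₀ x₀ e) :=
    hrep.continuousAt.eventually (by rwa [hrep0])
  have hΛ : PlotAt ⊤ Λ (chart i₀ i₀) := by
    refine (plotAt_mul hs' (hk.map 𝒢.smooth_inv) ?_).1
    filter_upwards [hrs, hsr'] with e h1 h2
    simp only [Function.comp_apply, 𝒢.l_inv, h2]
    exact (chart x₀).left_inv h1
  have hΛ0 : Λ (chart i₀ i₀) = g₀ := by
    simp only [Λ, he, hrep0, hs0, i₀, Grpd.inv_one]
    rw [← hx, m_one]
  have hF : ContDiffAt ℝ ∞ (chart g₀ ∘ Λ) (chart i₀ i₀) :=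
    hΛ.chart_comp (by rw [hΛ0]; exact mem_source _)
  have hx0 : (chart x₀).symm (chart x₀ x₀) = x₀ := (chart x₀).left_inv (mem_source x₀)
  have hone := (plotAt_chart_symm (n := ⊤) (chart_mem_target (mem_source x₀))).map 𝒢.smooth_one
  have hco : ContDiffAt ℝ ∞ (fun v => chart i₀ (𝒢.one ((chart x₀).symm v))) (chart x₀ x₀) :=
    hone.chart_comp (by simp only [Function.comp_apply, hx0]; exact mem_source _)
  have hF' : ContDiffAt ℝ ∞ (chart g₀ ∘ Λ)
      (chart i₀ (𝒢.one ((chart x₀).symm (chart x₀ x₀)))) := by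
    rwa [hx0]
  refine ⟨fun v => fderiv ℝ (chart g₀ ∘ Λ) (chart i₀ (𝒢.one ((chart x₀).symm v))),
    contDiffAt_fderiv_comp hF' hco, ?_⟩
  have hd : ∀ᶠ v in 𝓝 (chart x₀ x₀),
      DifferentiableAt ℝ (chart g₀ ∘ Λ) (chart i₀ (𝒢.one ((chart x₀).symm v))) :=
    hco.continuousAt.eventually (((hF'.of_le (by simp : (1 : WithTop ℕ∞) ≤ ∞)).eventually
      (by simp)).mono fun e he => he.differentiableAt (by simp))
  have hsrc : ∀ᶠ v in 𝓝 (chart x₀ x₀), s v ∈ (chart g₀).source :=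
    hs.cont.eventually_mem (source_mem_nhds (by rw [hs0]; exact mem_source _))
  have h1src : ∀ᶠ v in 𝓝 (chart x₀ x₀), 𝒢.one ((chart x₀).symm v) ∈ (chart i₀).source :=
    hone.cont.eventually_mem
      (source_mem_nhds (by simp only [Function.comp_apply, hx0]; exact mem_source _))
  have hv := (chart x₀).open_target.mem_nhds (chart_mem_target (mem_source x₀))
  filter_upwards [hd, hsrc, h1src, hsr, hv] with v hd hsrc h1src hsr hv a
  obtain ⟨γ, hγ, hr⟩ := exists_vel_A a
  have hγ' := hγ.hasDerivAt_chart h1src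
  have hγs : ∀ᶠ t in 𝓝 0, γ t ∈ (chart i₀).source :=
    hγ.plot.cont.eventually_mem (source_mem_nhds (by rw [hγ.eq]; exact h1src))
  have hδ := (hasVel_lt hsr hγ hr).hasDerivAt_chart hsrc
  have hd' : HasFDerivAt (chart g₀ ∘ Λ) (fderiv ℝ (chart g₀ ∘ Λ)
      (chart i₀ (𝒢.one ((chart x₀).symm v)))) ((chart i₀ ∘ γ) 0) := by
    rw [Function.comp_apply, hγ.eq]
    exact hd.hasFDerivAt
  refine hδ.unique ((hd'.comp_hasDerivAt (0 : ℝ) hγ').congr_of_eventuallyEq ?_)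
  filter_upwards [hγs, hr] with t ht ht'
  simp only [Function.comp_apply, Λ, rep, (chart i₀).left_inv ht]
  rw [ht', (chart x₀).right_inv hv]

theorem contDiffAt_append {V E : Type*} [NormedAddCommGroup V] [NormedSpace ℝ V]
    [NormedAddCommGroup E] [NormedSpace ℝ E] {v₀ : V} {m n : ℕ} {a : V → Fin m → E}
    {b : V → Fin n → E} (ha : ∀ i, ContDiffAt ℝ ∞ (fun v => a v i) v₀)
    (hb : ∀ i, ContDiffAt ℝ ∞ (fun v => b v i) v₀) (i : Fin (m + n)) :
    ContDiffAt ℝ ∞ (fun v => Fin.append (a v) (b v) i) v₀ := by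
  refine Fin.addCases (fun i => ?_) (fun i => ?_) i
  · simpa only [Fin.append_left] using ha i
  · simpa only [Fin.append_right] using hb i

/-- Here `f₁ / f₂` will be the coefficient at the left end, `f₃ / f₄` the ratio of two top
multivectors at the arrow, and `f₅` a component of the frame at the right end. -/
theorem contDiffAt_of_coeff {V : Type*} [NormedAddCommGroup V] [NormedSpace ℝ V] {v₀ : V}
    {f f₁ f₂ f₃ f₄ f₅ : V → ℝ} (ε : ℝ) (h₁ : ContDiffAt ℝ ∞ f₁ v₀) (h₂ : ContDiffAt ℝ ∞ f₂ v₀)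
    (h₃ : ContDiffAt ℝ ∞ f₃ v₀) (h₄ : ContDiffAt ℝ ∞ f₄ v₀) (h₅ : ContDiffAt ℝ ∞ f₅ v₀)
    (n₂ : f₂ v₀ ≠ 0) (n₄ : f₄ v₀ ≠ 0)
    (h : ∀ᶠ v in 𝓝 v₀, f₂ v ≠ 0 → f₄ v ≠ 0 →
      f v = ε * (f₁ v / f₂ v) * f₃ v / f₄ v * f₅ v) : ContDiffAt ℝ ∞ f v₀ := by
  have F : ContDiffAt ℝ ∞ (fun v => ε * (f₁ v / f₂ v) * f₃ v / f₄ v * f₅ v) v₀ :=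
    (((contDiffAt_const.mul (h₁.div h₂ n₂)).mul h₃).div h₄ n₄).mul h₅
  refine F.congr_of_eventuallyEq ?_
  filter_upwards [h, h₂.continuousAt.eventually_ne n₂, h₄.continuousAt.eventually_ne n₄]
    with v hv a b using hv a b

set_option maxHeartbeats 1000000 in
/-- An invariant section that is smooth at the left end of an arrow is smooth at its right end. -/
theorem IsInvariant.smoothSectionAt {σ : ∀ x, 𝒢.Q x} (hσ : 𝒢.IsInvariant σ) (hx : 𝒢.r g₀ = x₀)
    (hy : 𝒢.l g₀ = y₀) (hs : 𝒢.SmoothSectionAt σ y₀) : 𝒢.SmoothSectionAt σ x₀ := by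
  intro ψ
  obtain ⟨s, hs0, hsp, hsr⟩ := exists_local_section hx
  obtain ⟨dR, hdR, hdR'⟩ := exists_smooth_rt hx hy hs0 hsp hsr
  obtain ⟨dL, hdL, hdL'⟩ := exists_smooth_lt hx hs0 hsp hsr
  have hx0 : (chart x₀).symm (chart x₀ x₀) = x₀ := (chart x₀).left_inv (mem_source x₀)
  have hxp := plotAt_chart_symm (n := ⊤) (chart_mem_target (mem_source x₀))
  have hone := hxp.map 𝒢.smooth_one
  have hyp := hsp.map 𝒢.submersion_l.1
  have hyone := hyp.map 𝒢.smooth_one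
  have hcs : ContDiffAt ℝ ∞ (fun v => chart g₀ (s v)) (chart x₀ x₀) :=
    hsp.chart_comp (by rw [hs0]; exact mem_source _)
  have hco : ContDiffAt ℝ ∞ (fun v => chart (𝒢.one x₀) (𝒢.one ((chart x₀).symm v)))
      (chart x₀ x₀) :=
    hone.chart_comp (by simp only [Function.comp_apply, hx0]; exact mem_source _)
  have hcy : ContDiffAt ℝ ∞ (fun v => chart y₀ (𝒢.l (s v))) (chart x₀ x₀) :=
    hyp.chart_comp (by simp only [Function.comp_apply, hs0, hy]; exact mem_source _)
  have h1r := 𝒢.r_one x₀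
  -- the derivatives of `r` and `l` in charts
  have hMr : ContDiffAt ℝ ∞ (fun v => fderiv ℝ (rep 𝒢.r g₀ x₀) (chart g₀ (s v)))
      (chart x₀ x₀) :=
    contDiffAt_fderiv_comp (by
      rw [hs0]
      exact contDiffAt_rep 𝒢.submersion_r.1 (mem_source g₀) (by rw [hx]; exact mem_source _)) hcs
  have hMl : ContDiffAt ℝ ∞ (fun v => fderiv ℝ (rep 𝒢.l g₀ y₀) (chart g₀ (s v)))
      (chart x₀ x₀) :=
    contDiffAt_fderiv_comp (by
      rw [hs0]
      exact contDiffAt_rep 𝒢.submersion_l.1 (mem_source g₀) (by rw [hy]; exact mem_source _)) hcs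
  have hM1 : ContDiffAt ℝ ∞ (fun v => fderiv ℝ (rep 𝒢.r (𝒢.one x₀) x₀)
      (chart (𝒢.one x₀) (𝒢.one ((chart x₀).symm v)))) (chart x₀ x₀) :=
    contDiffAt_fderiv_comp (by
      rw [hx0]
      exact contDiffAt_rep 𝒢.submersion_r.1 (mem_source _) (by rw [h1r]; exact mem_source _)) hco
  have sr := (shortExact_rt hy hx).surj
  have sl := (shortExact_lt hy hx).surj
  have s1 := (shortExact_rt (𝒢.l_one x₀) h1r).surj
  have er := (shortExact_rt hy hx).finrank_eq
  rw [finrank_euclideanSpace_fin, finrank_euclideanSpace_fin] at er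
  have e1 := finrank_A_add (𝒢 := 𝒢) x₀
  have sr' : Function.Surjective
      (fderiv ℝ (rep 𝒢.r g₀ x₀) (chart g₀ (s (chart x₀ x₀)))) := by
    rw [hs0]
    exact sr
  have sl' : Function.Surjective
      (fderiv ℝ (rep 𝒢.l g₀ y₀) (chart g₀ (s (chart x₀ x₀)))) := by
    rw [hs0]
    exact sl
  have s1' : Function.Surjective (fderiv ℝ (rep 𝒢.r (𝒢.one x₀) x₀)
      (chart (𝒢.one x₀) (𝒢.one ((chart x₀).symm (chart x₀ x₀))))) := by
    rw [hx0]
    exact s1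
  -- The data moving smoothly with `v`: lifts of coordinate vectors through `T r` and `T l`, a frame
  -- of `ker T r` at `s v`, and a frame of `A` at the right end.
  obtain ⟨Sr, hSr, hSr'⟩ := exists_smooth_rightInverse hMr sr'
  obtain ⟨Sl, hSl, hSl'⟩ := exists_smooth_rightInverse hMl sl'
  obtain ⟨β, hβ, hβ'⟩ := exists_smooth_kernel_frame hMr sr' (k := finrank ℝ (𝒢.A y₀))
    (by rw [finrank_euclideanSpace_fin, finrank_euclideanSpace_fin]; exact er)
  obtain ⟨b, hb, hb'⟩ := exists_smooth_kernel_frame hM1 s1' (k := finrank ℝ (𝒢.A x₀))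
    (by rw [finrank_euclideanSpace_fin, finrank_euclideanSpace_fin]; exact e1)
  let u : Tan x₀ → Fin (dim x₀) → Tan g₀ := fun v i =>
    Sr v (EuclideanSpace.basisFun (Fin (dim x₀)) ℝ i)
  let u' : Tan x₀ → Fin (dim y₀) → Tan g₀ := fun v i =>
    Sl v (EuclideanSpace.basisFun (Fin (dim y₀)) ℝ i)
  have hu : ∀ i, ContDiffAt ℝ ∞ (fun v => u v i) (chart x₀ x₀) := fun i =>
    hSr.clm_apply contDiffAt_const
  have hu' : ∀ i, ContDiffAt ℝ ∞ (fun v => u' v i) (chart x₀ x₀) := fun i =>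
    hSl.clm_apply contDiffAt_const
  have hdRβ : ∀ i, ContDiffAt ℝ ∞ (fun v => dR v (β v i)) (chart x₀ x₀) := fun i =>
    hdR.clm_apply (hβ i)
  have hdLb : ∀ i, ContDiffAt ℝ ∞ (fun v => dL v (b v i)) (chart x₀ x₀) := fun i =>
    hdL.clm_apply (hb i)
  have hv := (chart x₀).open_target.mem_nhds (chart_mem_target (mem_source x₀))
  have hgsrc : ∀ᶠ v in 𝓝 (chart x₀ x₀), s v ∈ (chart g₀).source :=
    hsp.cont.eventually_mem (source_mem_nhds (by rw [hs0]; exact mem_source _))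
  have hysrc : ∀ᶠ v in 𝓝 (chart x₀ x₀), 𝒢.l (s v) ∈ (chart y₀).source :=
    hyp.cont.eventually_mem
      (source_mem_nhds (by simp only [Function.comp_apply, hs0, hy]; exact mem_source _))
  have hy1src : ∀ᶠ v in 𝓝 (chart x₀ x₀), 𝒢.one (𝒢.l (s v)) ∈ (chart (𝒢.one y₀)).source :=
    hyone.cont.eventually_mem
      (source_mem_nhds (by simp only [Function.comp_apply, hs0, hy]; exact mem_source _))
  have hx1src : ∀ᶠ v in 𝓝 (chart x₀ x₀),
      𝒢.one ((chart x₀).symm v) ∈ (chart (𝒢.one x₀)).source :=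
    hone.cont.eventually_mem
      (source_mem_nhds (by simp only [Function.comp_apply, hx0]; exact mem_source _))
  have key : ∀ᶠ v in 𝓝 (chart x₀ x₀),
      LinearIndependent ℝ (fun i => dR v (β v i)) ∧
      LinearIndependent ℝ (Fin.append (fun i => dL v (b v i)) (u' v)) ∧
      ∃ c c' : ℝ,
        𝒢.localRep y₀ (𝒢.l (s v)) (σ (𝒢.l (s v))) =
          c • (ExteriorAlgebra.ιMulti ℝ (finrank ℝ (𝒢.A y₀)) (fun i => dR v (β v i)) ⊗ₜ
          ExteriorAlgebra.ιMulti ℝ (dim y₀) (eStar (dim y₀))) ∧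
        𝒢.localRep x₀ ((chart x₀).symm v) (σ ((chart x₀).symm v)) =
          c' • (ExteriorAlgebra.ιMulti ℝ (finrank ℝ (𝒢.A x₀)) (b v) ⊗ₜ
          ExteriorAlgebra.ιMulti ℝ (dim x₀) (eStar (dim x₀))) ∧
        ((-1) ^ (finrank ℝ (𝒢.A y₀) * finrank ℝ (𝒢.A x₀)) * c) •
            ExteriorAlgebra.ιMulti ℝ (finrank ℝ (𝒢.A y₀) + dim x₀) (Fin.append (β v) (u v)) =
          c' • ExteriorAlgebra.ιMulti ℝ (finrank ℝ (𝒢.A x₀) + dim y₀)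
            (Fin.append (fun i => dL v (b v i)) (u' v)) := by
    filter_upwards [hsr, hdR', hdL', hSr', hSl', hβ', hb', hv, hgsrc, hysrc, hy1src, hx1src]
      with v hsr hdR hdL hSr hSl hβ hb hv hg hy hy1 hx1
    refine Corr.coeff rfl hsr ((chart x₀).map_target hv) hy hg hx1 hy1 er e1 hb.2 hb.1 hβ.2 hβ.1
      (fun i => hSr _) (fun i => hSl _) hdL (hdR _ rfl) ?_
    -- The right end of `s v` equals `(chart x₀).symm v` only propositionally, so it is generalized
    -- before substitution.
    have : ∀ x, 𝒢.r (s v) = x → 𝒢.Corr (s v) (𝒢.l (s v)) x (σ (𝒢.l (s v))) (σ x) := by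
      rintro _ rfl
      exact hσ (s v)
    exact this _ hsr
  obtain ⟨k1, k2, -⟩ := key.self_of_nhds
  -- The functionals are chosen nonzero at the base point; by continuity the denominators stay
  -- nonzero nearby.
  obtain ⟨l₁, hl₁⟩ := exists_dual_ne_zero (ιMulti_ne_zero k1)
  obtain ⟨l₂, hl₂⟩ := exists_dual_ne_zero (ιMulti_ne_zero (eStar_linearIndependent (dim y₀)))
  obtain ⟨l₃, hl₃⟩ := exists_dual_ne_zero (ιMulti_ne_zero k2)
  let ψ₀ : Dual ℝ
      (ExteriorAlgebra ℝ (Tan (𝒢.one y₀)) ⊗[ℝ] ExteriorAlgebra ℝ (Dual ℝ (Tan y₀))) :=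
    LinearMap.mul' ℝ ℝ ∘ₗ TensorProduct.map l₁ l₂
  have hψ₀ : ∀ a b, ψ₀ (a ⊗ₜ b) = l₁ a * l₂ b := fun a b => rfl
  -- The smoothness hypothesis at `y₀` enters only here, composed with the smooth map `l ∘ s` in the
  -- chart at `y₀`.
  have f1 : ContDiffAt ℝ ∞ (fun v => ψ₀ (𝒢.localRep y₀ ((chart y₀).symm (chart y₀ (𝒢.l (s v))))
      (σ ((chart y₀).symm (chart y₀ (𝒢.l (s v))))))) (chart x₀ x₀) := by
    have h1 := hs ψ₀
    have h2 : chart y₀ (𝒢.l (s (chart x₀ x₀))) = chart y₀ y₀ := by rw [hs0, hy]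
    rw [← h2] at h1
    exact ContDiffAt.comp
      (g := fun w => ψ₀ (𝒢.localRep y₀ ((chart y₀).symm w) (σ ((chart y₀).symm w))))
      (f := fun v => chart y₀ (𝒢.l (s v))) (chart x₀ x₀) h1 hcy
  have f2 := contDiffAt_ιMulti l₁ hdRβ
  have f3 := contDiffAt_ιMulti l₃ (contDiffAt_append hβ hu)
  have f4 := contDiffAt_ιMulti l₃ (contDiffAt_append hdLb hu')
  have f5 := contDiffAt_ιMulti (ψ ∘ₗ (TensorProduct.mk ℝ _ _).flip
    (ExteriorAlgebra.ιMulti ℝ (dim x₀) (eStar (dim x₀)))) hb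
  refine contDiffAt_of_coeff ((-1) ^ (finrank ℝ (𝒢.A y₀) * finrank ℝ (𝒢.A x₀))) f1
    (f2.mul contDiffAt_const) f3 f4 f5 (mul_ne_zero hl₁ hl₂) hl₃ ?_
  filter_upwards [key, hysrc] with v hv hy h1 h3
  obtain ⟨-, -, c, c', e1, e2, e3⟩ := hv
  have e3' := congrArg l₃ e3
  rw [map_smul, map_smul, smul_eq_mul, smul_eq_mul] at e3'
  have e1' := congrArg ψ₀ e1
  rw [map_smul, hψ₀, smul_eq_mul] at e1'
  have e2' := congrArg ψ e2
  rw [map_smul, smul_eq_mul] at e2'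
  rw [(chart y₀).left_inv hy, e1', e2', mul_div_cancel_right₀ _ h1, e3',
    mul_div_cancel_right₀ _ h3]
  rfl

end LieGroupoid

end DiffStack

end

noncomputable section

namespace DiffStack

open TopologicalSpace Module SmoothMfd Filter
open scoped ContDiff TensorProduct Topology

/-! ### Functoriality of determinant lines under isomorphisms -/

section Determinants

variable {V W T Y : Type*} [AddCommGroup V] [Module ℝ V] [AddCommGroup W] [Module ℝ W]
  [AddCommGroup T] [Module ℝ T] [AddCommGroup Y] [Module ℝ Y]

theorem coe_detMap (e : V ≃ₗ[ℝ] W) (α : detLine V) :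
    (detMap e α : ExteriorAlgebra ℝ W) = ExteriorAlgebra.map e.toLinearMap α :=
  coe_exteriorPower_map _ _ α

theorem exteriorAlgebra_map_map (f : V →ₗ[ℝ] W) (g : W →ₗ[ℝ] T) (a : ExteriorAlgebra ℝ V) :
    ExteriorAlgebra.map g (ExteriorAlgebra.map f a) = ExteriorAlgebra.map (g ∘ₗ f) a := by
  rw [← ExteriorAlgebra.map_comp_map]
  rfl

theorem detMap_symm_detMap (e : V ≃ₗ[ℝ] W) (α : detLine V) : detMap e.symm (detMap e α) = α := by
  refine Subtype.ext ?_
  rw [coe_detMap, coe_detMap, exteriorAlgebra_map_map]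
  simp

theorem map_detMap_symm (e : V ≃ₗ[ℝ] W) (q : detLine V ⊗[ℝ] Y) :
    TensorProduct.map (detMap e.symm) LinearMap.id
      (TensorProduct.map (detMap e) (LinearMap.id : Y →ₗ[ℝ] Y) q) = q := by
  rw [← LinearMap.comp_apply, ← TensorProduct.map_comp, LinearMap.id_comp,
    show detMap e.symm ∘ₗ detMap e = LinearMap.id from
      LinearMap.ext fun α => detMap_symm_detMap e α, TensorProduct.map_id, LinearMap.id_apply]

theorem map_detMap_bijective (e : V ≃ₗ[ℝ] W) : Function.Bijective
    (TensorProduct.map (detMap e) (LinearMap.id : Y →ₗ[ℝ] Y)) :=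
  ⟨Function.LeftInverse.injective (map_detMap_symm e),
    Function.RightInverse.surjective (map_detMap_symm e.symm)⟩

theorem wedgeForm_detMap (e : V ≃ₗ[ℝ] W) (R : W →ₗ[ℝ] T) (p : T →ₗ[ℝ] Y) {n m : ℕ}
    (w : ⋀[ℝ]^n T) (w' : ⋀[ℝ]^m T) (q : detLine V ⊗[ℝ] ⋀[ℝ]^n (Dual ℝ Y)) :
    wedgeForm R p w w' (TensorProduct.map (detMap e) LinearMap.id q) =
      wedgeForm (R ∘ₗ e.toLinearMap) p w w' q := by
  induction q with
  | zero => simp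
  | add x y hx hy => rw [map_add, map_add, map_add, hx, hy]
  | tmul α θ =>
    rw [TensorProduct.map_tmul, wedgeForm_tmul, wedgeForm_tmul, coe_detMap,
      exteriorAlgebra_map_map, LinearMap.id_apply]

/-- The data of the two relations are linked by equations rather than shared, since those of a
restricted groupoid agree with the ambient ones only propositionally. -/
theorem balanced_detMap_iff {V' W' X : Type*} [AddCommGroup V'] [Module ℝ V'] [AddCommGroup W']
    [Module ℝ W'] [AddCommGroup X] [Module ℝ X] (e : V ≃ₗ[ℝ] W) (e' : V' ≃ₗ[ℝ] W')
    {ε₁ ε₂ : ℝ} {R₁ : W →ₗ[ℝ] T} {R₂ : V →ₗ[ℝ] T} {L₁ : W' →ₗ[ℝ] T} {L₂ : V' →ₗ[ℝ] T}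
    {pX₁ pX₂ : T →ₗ[ℝ] X} {pY₁ pY₂ : T →ₗ[ℝ] Y} (hε : ε₁ = ε₂) (hR : R₁ ∘ₗ e.toLinearMap = R₂)
    (hX : pX₁ = pX₂) (hL : L₁ ∘ₗ e'.toLinearMap = L₂) (hY : pY₁ = pY₂) {m n : ℕ}
    (q : detLine V ⊗[ℝ] ⋀[ℝ]^n (Dual ℝ Y)) (q' : detLine V' ⊗[ℝ] ⋀[ℝ]^m (Dual ℝ X)) :
    Balanced ε₁ R₁ pX₁ L₁ pY₁ (TensorProduct.map (detMap e) LinearMap.id q)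
      (TensorProduct.map (detMap e') LinearMap.id q') ↔ Balanced ε₂ R₂ pX₂ L₂ pY₂ q q' := by
  subst hε hR hX hL hY
  simp only [Balanced, wedgeForm_detMap]

theorem map_map_detMap (e : V ≃ₗ[ℝ] W) {f₁ : W →ₗ[ℝ] T} {f₂ : V →ₗ[ℝ] T}
    (hf : f₁ ∘ₗ e.toLinearMap = f₂) {Z : Type*} [AddCommGroup Z] [Module ℝ Z]
    {d₁ d₂ : Y →ₗ[ℝ] Z} (hd : d₁ = d₂) (q : detLine V ⊗[ℝ] Y) :
    TensorProduct.map ((ExteriorAlgebra.map f₁).toLinearMap ∘ₗ (detLine W).subtype) d₁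
        (TensorProduct.map (detMap e) LinearMap.id q) =
      TensorProduct.map ((ExteriorAlgebra.map f₂).toLinearMap ∘ₗ (detLine V).subtype) d₂ q := by
  subst hf hd
  rw [← LinearMap.comp_apply, ← TensorProduct.map_comp, LinearMap.comp_id]
  refine LinearMap.congr_fun (congrArg₂ TensorProduct.map (LinearMap.ext fun α => ?_) rfl) q
  exact (congrArg _ (coe_detMap e α)).trans (exteriorAlgebra_map_map _ _ _)

end Determinants

namespace LieGroupoid

open Grpd

variable {G G₀ : Type*} [TopologicalSpace G] [TopologicalSpace G₀] [SmoothMfd G] [SmoothMfd G₀]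
  {𝒢 : LieGroupoid G G₀} {U : Opens G₀}

/-! ### Restriction to an open set of objects -/

variable (𝒢 U) in
/-- The fibres of the Lie algebroid of the restriction are those of the Lie algebroid. -/
def restrictA (x : U) : 𝒢.A x.1 ≃ₗ[ℝ] (𝒢.restrict U).A x where
  toFun a := ⟨a.1, (SetLike.ext_iff.1 (𝒢.A_restrict U x) a.1).1 a.2⟩
  invFun a := ⟨a.1, (SetLike.ext_iff.1 (𝒢.A_restrict U x) a.1).2 a.2⟩
  map_add' _ _ := rfl
  map_smul' _ _ := rfl
  left_inv _ := rfl
  right_inv _ := rfl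

theorem restrictFibre_bijective (x : U) : Function.Bijective (𝒢.restrictFibre U x) :=
  map_detMap_bijective (𝒢.restrictA U x)

/-- The derivative within a set is local, and near the base point the composable pairs and the
multiplication agree in charts. -/
theorem tmul_restrict (g h p : 𝒢.arrowsOver U) :
    (𝒢.restrict U).tmul g h p = 𝒢.tmul g.1 h.1 p.1 := by
  have hev := 𝒢.mulRep_restrict U g h p
  refine (fderivWithin_congr_set (hev.mono fun v hv => propext hv.1)).trans ?_
  exact Filter.EventuallyEq.fderivWithin_eq
    (eventually_nhdsWithin_of_eventually_nhds (hev.mono fun v hv => hv.2)) hev.self_of_nhds.2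

theorem rt_restrict (g : 𝒢.arrowsOver U) (z : U) :
    (𝒢.restrict U).rt g z ∘ₗ (𝒢.restrictA U z).toLinearMap = 𝒢.rt g.1 z.1 := by
  unfold rt
  rw [tmul_restrict]
  rfl

theorem lt_restrict (g : 𝒢.arrowsOver U) (x : U) :
    (𝒢.restrict U).lt g x ∘ₗ (𝒢.restrictA U x).toLinearMap = 𝒢.lt g.1 x.1 := by
  unfold lt
  rw [tmul_restrict, tmap_opens (U := 𝒢.arrowsOver U) (V := 𝒢.arrowsOver U) 𝒢.inv
    (𝒢.restrict U).inv (fun _ => rfl)]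
  rfl

theorem corr_restrict_iff (g : 𝒢.arrowsOver U) (z x : U) (q : 𝒢.Q z.1) (q' : 𝒢.Q x.1) :
    (𝒢.restrict U).Corr g z x (𝒢.restrictFibre U z q) (𝒢.restrictFibre U x q') ↔
      𝒢.Corr g.1 z.1 x.1 q q' := by
  have hl := tmap_opens (U := 𝒢.arrowsOver U) (V := U) 𝒢.l (𝒢.restrict U).l (fun _ => rfl) g z
  have hr := tmap_opens (U := 𝒢.arrowsOver U) (V := U) 𝒢.r (𝒢.restrict U).r (fun _ => rfl) g x
  exact balanced_detMap_iff (𝒢.restrictA U z) (𝒢.restrictA U x)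
    (by rw [(𝒢.restrictA U z).finrank_eq, (𝒢.restrictA U x).finrank_eq]) (rt_restrict g z)
    (congrArg _ hr) (lt_restrict g x) (congrArg _ hl) q q'

theorem localRep_restrict (x₀ x : U) (hx : x.1 ∈ (chart x₀.1).source) (q : 𝒢.Q x.1) :
    (𝒢.restrict U).localRep x₀ x (𝒢.restrictFibre U x q) = 𝒢.localRep x₀.1 x.1 q := by
  have h1 := tmap_opens (U := 𝒢.arrowsOver U) (V := 𝒢.arrowsOver U) id id (fun _ => rfl)
    ((𝒢.restrict U).one x) ((𝒢.restrict U).one x₀)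
  have h2 : fderiv ℝ (rep (id : U → U) x₀ x) (chart x₀ x) =
      fderiv ℝ (rep id x₀.1 x.1) (chart x₀.1 x.1) := by
    refine Filter.EventuallyEq.fderiv_eq ?_
    filter_upwards [(chart x₀).open_target.mem_nhds ((chart x₀).map_source
      ((chart x₀.1).subtypeRestr_source ⟨x₀⟩ ▸ hx))] with v hv
    exact congrArg (chart x.1) ((chart x₀.1).subtypeRestr_symm_apply ⟨x₀⟩ hv)
  exact map_map_detMap (𝒢.restrictA U x)
    (congrArg (fun f : Tan (𝒢.one x.1) →L[ℝ] Tan (𝒢.one x₀.1) =>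
      f.toLinearMap ∘ₗ (𝒢.A x.1).subtype) h1)
    (congrArg (fun f : Tan x₀.1 →L[ℝ] Tan x.1 =>
      (ExteriorAlgebra.map f.toLinearMap.dualMap).toLinearMap ∘ₗ
        (⋀[ℝ]^(dim x.1) (Dual ℝ (Tan x.1))).subtype) h2) q

theorem smoothSectionAt_restrict_iff (σ : ∀ x, 𝒢.Q x) (x₀ : U) :
    (𝒢.restrict U).SmoothSectionAt (𝒢.restrictSection U σ) x₀ ↔ 𝒢.SmoothSectionAt σ x₀.1 := by
  refine forall_congr' fun ψ => ?_
  have h : ∀ᶠ v in 𝓝 (chart x₀.1 x₀.1),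
      ψ ((𝒢.restrict U).localRep x₀ ((chart x₀).symm v)
        (𝒢.restrictSection U σ ((chart x₀).symm v))) =
      ψ (𝒢.localRep x₀.1 ((chart x₀.1).symm v) (σ ((chart x₀.1).symm v))) := by
    filter_upwards [symm_opens U x₀, (chart x₀.1).open_target.mem_nhds
      (chart_mem_target (mem_source x₀.1))] with v hv hv'
    refine congrArg ψ ((localRep_restrict x₀ ((chart x₀).symm v) ?_ _).trans
      (congrArg (fun y => 𝒢.localRep x₀.1 y (σ y)) hv.2))
    rw [hv.2]
    exact (chart x₀.1).map_target hv'
  exact ⟨fun H => ContDiffAt.congr_of_eventuallyEq H (h.mono fun v hv => hv.symm),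
    fun H => ContDiffAt.congr_of_eventuallyEq H h⟩

/-! ### Extension of invariant sections from a full open set -/

theorem isInvariant_iff {σ : ∀ x, 𝒢.Q x} :
    𝒢.IsInvariant σ ↔ ∀ g z x, 𝒢.l g = z → 𝒢.r g = x → 𝒢.Corr g z x (σ z) (σ x) := by
  refine ⟨?_, fun h g => h g _ _ rfl rfl⟩
  rintro h g _ _ rfl rfl
  exact h g

theorem IsInvariant.restrictSection {σ : ∀ x, 𝒢.Q x} (hσ : 𝒢.IsInvariant σ) :
    (𝒢.restrict U).IsInvariant (𝒢.restrictSection U σ) := fun g =>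
  (corr_restrict_iff g _ _ _ _).2 (hσ g.1)

/-- Fullness provides an arrow from a point of `U` to any given point, and
`IsInvariant.smoothSectionAt` carries smoothness along it. -/
theorem isSmoothSection_restrict_iff (hU : 𝒢.IsFull (U : Set G₀)) {σ : ∀ x, 𝒢.Q x}
    (hσ : 𝒢.IsInvariant σ) :
    𝒢.IsSmoothSection σ ↔ (𝒢.restrict U).IsSmoothSection (𝒢.restrictSection U σ) := by
  refine ⟨fun h x => (smoothSectionAt_restrict_iff σ x).2 (h x.1), fun h x => ?_⟩
  obtain ⟨g, hg, hgU⟩ := hU x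
  exact hσ.smoothSectionAt hg rfl ((smoothSectionAt_restrict_iff σ ⟨𝒢.l g, hgU⟩).1 (h ⟨_, hgU⟩))

/-- The value at `x` is the image under `j_g` of the value at a point of `U`. -/
theorem IsInvariant.ext_of_isFull (hU : 𝒢.IsFull (U : Set G₀)) {σ τ : ∀ x, 𝒢.Q x}
    (hσ : 𝒢.IsInvariant σ) (hτ : 𝒢.IsInvariant τ)
    (h : 𝒢.restrictSection U σ = 𝒢.restrictSection U τ) : σ = τ := by
  funext x
  obtain ⟨g, hg, hgU⟩ := hU x
  have h1 := isInvariant_iff.1 hσ g _ x rfl hg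
  rw [(restrictFibre_bijective (𝒢 := 𝒢) (⟨𝒢.l g, hgU⟩ : U)).1 (congrFun h ⟨𝒢.l g, hgU⟩)] at h1
  exact h1.right_unique rfl hg (isInvariant_iff.1 hτ g _ x rfl hg)

/-- The value at `x` is defined by transport along a chosen arrow `γ x` starting in `U`;
multiplicativity makes the result independent of the choice. -/
theorem exists_isInvariant_extension (hU : 𝒢.IsFull (U : Set G₀))
    {σ' : ∀ x, (𝒢.restrict U).Q x} (hσ' : (𝒢.restrict U).IsInvariant σ') :
    ∃ σ : ∀ x, 𝒢.Q x, 𝒢.IsInvariant σ ∧ 𝒢.restrictSection U σ = σ' := by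
  choose γ hγ hγU using hU
  choose τ hτ using fun x : U => (restrictFibre_bijective (𝒢 := 𝒢) x).2 (σ' x)
  have hcorr : ∀ (h : G) (z x : G₀) (hz : z ∈ U) (hx : x ∈ U), 𝒢.l h = z → 𝒢.r h = x →
      𝒢.Corr h z x (τ ⟨z, hz⟩) (τ ⟨x, hx⟩) := by
    rintro h _ _ hz hx rfl rfl
    refine (corr_restrict_iff (U := U) ⟨h, hz, hx⟩ ⟨_, hz⟩ ⟨_, hx⟩ _ _).1 ?_
    rw [hτ, hτ]
    exact hσ' ⟨h, hz, hx⟩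
  choose σ hσ using fun x => Corr.exists_right (𝒢 := 𝒢) (g := γ x) rfl (hγ x) (τ ⟨_, hγU x⟩)
  refine ⟨σ, fun k => ?_, ?_⟩
  · have h1 := hγ (𝒢.l k)
    have h2 := hγ (𝒢.r k)
    have hl := l_m h1
    have hr := r_m h1
    have hc : 𝒢.r (𝒢.m (γ (𝒢.l k)) k) = 𝒢.l (𝒢.inv (γ (𝒢.r k))) := by
      rw [hr, 𝒢.l_inv, h2]
    have hp := m_inv_m (hr.trans h2.symm)
    -- The arrow `γ (l k) · k · (γ (r k))⁻¹` has both ends in `U`, where invariance is given.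
    -- Composed with `γ (r k)` it is `γ (l k) · k`, so `j` of that arrow sends the value of `τ` to
    -- `σ (r k)`.
    have hh := hcorr (𝒢.m (𝒢.m (γ (𝒢.l k)) k) (𝒢.inv (γ (𝒢.r k)))) _ _ (hγU (𝒢.l k))
      (hγU (𝒢.r k)) ((l_m hc).trans hl) ((r_m hc).trans (𝒢.r_inv _))
    have hA := hh.trans ((l_m hc).trans hl) ((r_m hc).trans (𝒢.r_inv _)) rfl h2 hp (hσ (𝒢.r k))
    -- The image `q` of `σ (l k)` under `j_k` is also the image of the same value of `τ` under the
    -- arrow `γ (l k) · k`; uniqueness identifies it with `σ (r k)`.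
    obtain ⟨q, hq⟩ := Corr.exists_right (𝒢 := 𝒢) (g := k) rfl rfl (σ (𝒢.l k))
    have hB := (hσ (𝒢.l k)).trans rfl h1 rfl rfl rfl hq
    rw [hA.right_unique hl hr hB]
    exact hq
  · funext x
    -- For `x` in `U` the chosen arrow itself belongs to the restriction, although it need not be a
    -- unit.
    have h1 := hcorr (γ x.1) _ _ (hγU x.1) x.2 rfl (hγ x.1)
    exact (congrArg _ ((hσ x.1).right_unique rfl (hγ x.1) h1)).trans (hτ x)

/-! ### The isomorphism of spaces of smooth invariant sections -/

theorem mem_smoothInvariantSections {σ : ∀ x, 𝒢.Q x} :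
    σ ∈ 𝒢.smoothInvariantSections ↔ 𝒢.IsSmoothSection σ ∧ 𝒢.IsInvariant σ :=
  Iff.rfl

variable (𝒢 U) in
/-- Restriction to an open set, as a linear map on smooth invariant sections. -/
def restrictInvariant (hU : 𝒢.IsFull (U : Set G₀)) :
    𝒢.smoothInvariantSections →ₗ[ℝ] (𝒢.restrict U).smoothInvariantSections where
  toFun σ := ⟨𝒢.restrictSection U σ.1,
    (isSmoothSection_restrict_iff hU σ.2.2).1 σ.2.1, σ.2.2.restrictSection⟩
  map_add' _ _ := Subtype.ext (funext fun x => map_add (𝒢.restrictFibre U x) _ _)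
  map_smul' _ _ := Subtype.ext (funext fun x => map_smul (𝒢.restrictFibre U x) _ _)

theorem restrictInvariant_bijective (hU : 𝒢.IsFull (U : Set G₀)) :
    Function.Bijective (𝒢.restrictInvariant U hU) := by
  refine ⟨fun σ τ h => Subtype.ext ?_, ?_⟩
  · exact σ.2.2.ext_of_isFull hU τ.2.2 (congrArg Subtype.val h)
  · intro σ'
    have h' := mem_smoothInvariantSections.1 σ'.2
    have hex := exists_isInvariant_extension hU h'.2
    obtain ⟨σ, hσ, h⟩ := hex
    rw [← h] at h'
    -- The extension was built from arbitrary choices; its smoothness follows from invariance and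
    -- smoothness over `U` alone.
    have hs : 𝒢.IsSmoothSection σ := (isSmoothSection_restrict_iff hU hσ).2 h'.1
    refine ⟨⟨σ, mem_smoothInvariantSections.2 ⟨hs, hσ⟩⟩, Subtype.ext ?_⟩
    exact h

end LieGroupoid

end DiffStack

end

theorem mainTheorem4 {G G₀ : Type*} [TopologicalSpace G] [TopologicalSpace G₀]
    [DiffStack.SmoothMfd G] [DiffStack.SmoothMfd G₀]
    (𝒢 : DiffStack.LieGroupoid G G₀) (U : TopologicalSpace.Opens G₀)
    (hU : 𝒢.IsFull (U : Set G₀)) :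
    (∃ e : 𝒢.smoothInvariantSections ≃ₗ[ℝ] (𝒢.restrict U).smoothInvariantSections,
      ∀ σ, (e σ).1 = 𝒢.restrictSection U σ.1) ∧
    ∀ σ : ∀ x, 𝒢.Q x, 𝒢.IsInvariant σ →
      (𝒢.IsSmoothSection σ ↔ (𝒢.restrict U).IsSmoothSection (𝒢.restrictSection U σ)) :=
  ⟨⟨LinearEquiv.ofBijective _ (DiffStack.LieGroupoid.restrictInvariant_bijective hU),
    fun _ => rfl⟩, fun _ hσ => DiffStack.LieGroupoid.isSmoothSection_restrict_iff hU hσ⟩
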